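/- Let $\mathcal F$ be the fermionic Fock space over $\mathbb C$ spanned by the semi-infinite forms in vectors $u_i, v_i$ ($i\in\mathbb Z$), the monomials $w_1\wedge w_2\wedge\dots$ (factors in the order $\dots,u_N,v_N,u_{N-1},v_{N-1},\dots$) being an orthonormal basis. Let $\phi_i,\psi_i$ be the exterior multiplications by $u_i,v_i$, let $\phi_i^*,\psi_i^*$ be their adjoints, and put $$e_n=\sum_{j}\psi_{j+n}\phi_j^*,\qquad f_n=\sum_j\phi_{j+n}\psi_j^*,\qquad h_n=\sum_{k}\bigl(\psi_k\psi^*_{k+n}-\phi_k\phi^*_{k+n}\bigr)$$ (for $n=0$ the last sum is normally ordered). Let $\Omega_0=u_{-1}\wedge v_{-1}\wedge u_{-2}\wedge v_{-2}\wedge\dots$ and $\Omega_{-2k}=V^k\Omega_0$, where $V$ is the operator with $V\phi_i=\phi_{i+1}V$, $V\psi_i=\psi_{i-1}V$ (and likewise for the adjoints), normalized so that $e_{-(N+1)}\Omega_{-(N+2)}=\Omega_{-N}$ for even $N\ge0$. Let $\mathcal H_0$ be the smallest subspace containing $\Omega_0$ and invariant under all $e_n,f_n,h_n$, let $\mathcal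 H[0]=\{x\in\mathcal H_0: h_0x=0\}$, and let $F_{2k}=\mathbb C[e_0,\dots,e_{-(2k-1)}]\Omega_{-2k}$ and $F_{2k}[0]=F_{2k}\cap\mathcal H[0]$. Let $\Lambda$ be the algebra of symmetric functions over $\mathbb C$. There is a unique linear isomorphism $\Lambda\cong\mathcal H[0]$ under which $1$ corresponds to $\Omega_0$ and, for $n>0$, multiplication by the power sum $p_n$ corresponds to $h_{-n}$ and $2n\,\partial/\partial p_n$ corresponds to $h_n$. For every $k\ge0$ the vectors $e_{-(k-\mu_1)}\cdots e_{-(k-\mu_k)}\Omega_{-2k}$, indexed by the partitions $\mu=(\mu_1\ge\dots\ge\mu_k\ge0)\subset(k^k)$, form a basis of $F_{2k}[0]$, and under this isomorphism, for every partition $\nu\subset(k^k)$, the Schur function $s_\nu$ is $$s_\nu=(-1)^{k(k-1)/2}\sum_{\mu=(0^{r_0}1^{r_1}\dots k^{r_k})\subset(k^k)}\frac{K_{\nu\mu}}{\prod_{j=0}^k r_j!}\;e_{-(k-\mu_1)}\cdots e_{-(k-\mu_k)}\,\Omega_{-2k},$$ where $K_{\nu\mu}$ are the Kostka numbers and $r_j$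 is the number of indices $1\le i\le k$ with $\mu_i=j$. -/

import Mathlib

noncomputable section

namespace FockSL2

/-! ### The fermionic Fock space

The basis vectors `u i`, `v i` (`i ∈ ℤ`) of the one-particle space are numbered by integers so that
the ordering `… ∧ u_N ∧ v_N ∧ u_{N-1} ∧ v_{N-1} ∧ …` of the semi-infinite forms is the decreasing
order of the numbers. -/

/-- The number of the one-particle vector `u_i`. -/
def u (i : ℤ) : ℤ := 2 * i + 1

/-- The number of the one-particle vector `v_i`. -/
def v (i : ℤ) : ℤ := 2 * i

/-- A semi-infinite monomial: the set of its (numbered) factors, which contains every sufficiently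
negative number and no sufficiently large one. The factors are wedged in decreasing order. -/
structure State where
  occ : Set ℤ
  below : ∃ N : ℤ, ∀ a < N, a ∈ occ
  above : ∃ M : ℤ, ∀ a > M, a ∉ occ

/-- The state with the factor `a` added. -/
def State.insert (S : State) (a : ℤ) : State where
  occ := Insert.insert a S.occ
  below := by
    obtain ⟨N, hN⟩ := S.below
    exact ⟨N, fun b hb => Set.mem_insert_of_mem _ (hN b hb)⟩
  above := by
    obtain ⟨M, hM⟩ := S.above
    refine ⟨max M a, fun b hb h => ?_⟩
    rcases Set.mem_insert_iff.1 h with h | h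
    · exact absurd hb (by simp [h])
    · exact hM b (lt_of_le_of_lt (le_max_left _ _) hb) h

/-- The state with the factor `a` removed. -/
def State.erase (S : State) (a : ℤ) : State where
  occ := S.occ \ {a}
  below := by
    obtain ⟨N, hN⟩ := S.below
    refine ⟨min N a, fun b hb => ⟨hN b (lt_of_lt_of_le hb (min_le_left _ _)), fun h => ?_⟩⟩
    have : b = a := h
    exact absurd (lt_of_lt_of_le hb (min_le_right _ _)) (by simp [this])
  above := by
    obtain ⟨M, hM⟩ := S.above
    exact ⟨M, fun b hb h => hM b hb h.1⟩

/-- The state obtained by the substitution `u_i ↦ u_{i+1}`, `v_i ↦ v_{i-1}`. -/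
def State.shift (S : State) : State where
  occ := {b | (∃ i, b = u (i + 1) ∧ u i ∈ S.occ) ∨ (∃ i, b = v (i - 1) ∧ v i ∈ S.occ)}
  below := by
    obtain ⟨N, hN⟩ := S.below
    refine ⟨N - 2, fun b hb => ?_⟩
    rcases Int.even_or_odd' b with ⟨c, hc | hc⟩
    · exact Or.inr ⟨c + 1, by simp [v, hc], hN _ (by simp only [v]; omega)⟩
    · exact Or.inl ⟨c - 1, by simp [u, hc], hN _ (by simp only [u]; omega)⟩
  above := by
    obtain ⟨M, hM⟩ := S.above
    refine ⟨M + 2, fun b hb h => ?_⟩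
    rcases h with ⟨i, h1, h2⟩ | ⟨i, h1, h2⟩
    · exact hM _ (by simp only [u] at h1 ⊢; omega) h2
    · exact hM _ (by simp only [v] at h1 ⊢; omega) h2

/-- The Fock space: the complex vector space with basis the semi-infinite monomials. -/
abbrev Fock : Type := State →₀ ℂ

/-- The sign of moving a factor `a` from the front of the monomial `S` to its place. -/
def wedgeSign (S : State) (a : ℤ) : ℂ := (-1) ^ {b : ℤ | b ∈ S.occ ∧ a < b}.ncard

/-- The linear operator with prescribed values on the basis monomials. -/
def opOfBasis (g : State → Fock) : Module.End ℂ Fock := Finsupp.linearCombination ℂ g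

open Classical in
/-- Exterior multiplication by the one-particle vector number `a`. -/
def wedge (a : ℤ) : Module.End ℂ Fock :=
  opOfBasis fun S => if a ∈ S.occ then 0 else Finsupp.single (S.insert a) (wedgeSign S a)

open Classical in
/-- The adjoint of `wedge a` for the inner product in which the monomials are orthonormal. -/
def contract (a : ℤ) : Module.End ℂ Fock :=
  opOfBasis fun S => if a ∈ S.occ then Finsupp.single (S.erase a) (wedgeSign S a) else 0

/-- The fermions `φ_i`, `φ_i^*` (for the vectors `u_i`) and `ψ_i`, `ψ_i^*` (for `v_i`). -/
def phi (i : ℤ) : Module.End ℂ Fock := wedge (u i)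

def phiStar (i : ℤ) : Module.End ℂ Fock := contract (u i)

def psi (i : ℤ) : Module.End ℂ Fock := wedge (v i)

def psiStar (i : ℤ) : Module.End ℂ Fock := contract (v i)

/-- The infinite sum `∑_{j ∈ ℤ} A j` of operators, computed on each basis monomial (where, in
all the uses below, only finitely many terms do not vanish). -/
def opSum (A : ℤ → Module.End ℂ Fock) : Module.End ℂ Fock :=
  opOfBasis fun S => ∑ᶠ j : ℤ, A j (Finsupp.single S 1)

/-- `e_n`: the coefficient of `z^{-(n+1)}` in `ψ(z) φ^*(z)`, where
`ψ(z) = ∑ ψ_i z^{-(i+1)}` and `φ^*(z) = ∑ φ_i^* z^i`. -/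
def e (n : ℤ) : Module.End ℂ Fock := opSum fun j => psi (j + n) * phiStar j

/-- `f_n`: the coefficient of `z^{-(n+1)}` in `φ(z) ψ^*(z)`. -/
def f (n : ℤ) : Module.End ℂ Fock := opSum fun j => phi (j + n) * psiStar j

/-- The bosons `a_n = ∑_k c_k c^*_{k+n}` (`n ≠ 0`) and
`a_0 = ∑_{k ≥ 1} c_k c^*_k - ∑_{k ≤ 0} c^*_k c_k` of a system of fermions `c_k`, `c^*_k`. -/
def boson (c cStar : ℤ → Module.End ℂ Fock) (n : ℤ) : Module.End ℂ Fock :=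
  if n = 0 then opSum fun k => if 0 < k then c k * cStar k else -(cStar k * c k)
  else opSum fun k => c k * cStar (k + n)

/-- The Heisenberg operators `h_n`, indexed so that `h_n` with `n > 0` annihilate the vacuum and
`h_{-n}` with `n > 0` are the creation operators. -/
def h (n : ℤ) : Module.End ℂ Fock := boson psi psiStar n - boson phi phiStar n

/-- The state of the vacuum `u_{-1} ∧ v_{-1} ∧ u_{-2} ∧ v_{-2} ∧ …`. -/
def vacuumState : State where
  occ := {a | a < 0}
  below := ⟨0, fun _ ha => ha⟩
  above := ⟨0, fun _ ha h => absurd ha (not_lt.2 (le_of_lt h))⟩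

/-- The vacuum vector `Ω = Ω_0`. -/
def vacuum : Fock := Finsupp.single vacuumState 1

/-- The operator `V`, `w_1 ∧ w_2 ∧ … ↦ V_0 w_1 ∧ V_0 w_2 ∧ …`, where `V_0 u_i = u_{i+1}` and
`V_0 v_i = v_{i-1}`. In bringing the result into decreasing order, a factor coming from `v_j`
passes the factors coming from `u_{j-1}` and `u_{j-2}` if these are present; for almost all `j`
both are present or `v_j` is absent. So `V φ_i = φ_{i+1} V` and `V ψ_i = ψ_{i-1} V`, which fixes `V`
up to a scalar; the overall sign is normalized by `e_{-(N+1)} Ω_{-(N+2)} = Ω_{-N}`. -/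
def V : Module.End ℂ Fock :=
  opOfBasis fun S => Finsupp.single S.shift
    (-(-1) ^ {j : ℤ | v j ∈ S.occ ∧ ¬(u (j - 1) ∈ S.occ ↔ u (j - 2) ∈ S.occ)}.ncard)

/-- The vector `Ω_{-2k} = V^k Ω`. -/
def Om (k : ℕ) : Fock := (V ^ k) vacuum

/-- The smallest subspace that contains `x` and is invariant under the operators in `A`. -/
def generated (A : Set (Module.End ℂ Fock)) (x : Fock) : Submodule ℂ Fock :=
  sInf {W | x ∈ W ∧ ∀ T ∈ A, ∀ y ∈ W, T y ∈ W}

/-- The basic module `𝓗_0`: the submodule over the affine Lie algebra generated by the vacuum. -/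
def basicModule : Submodule ℂ Fock :=
  generated (Set.range e ∪ Set.range f ∪ Set.range h) vacuum

/-- The charge `0` subspace `𝓗[0] = {x ∈ 𝓗_0 : h_0 x = 0}`. -/
def chargeZero : Submodule ℂ Fock := basicModule ⊓ LinearMap.ker (h 0)

/-- `F_{2k} = ℂ[e_0, e_{-1}, …, e_{-(2k-1)}] Ω_{-2k}`. -/
def finitePart (k : ℕ) : Submodule ℂ Fock :=
  generated {T | ∃ i : ℕ, i < 2 * k ∧ T = e (-(i : ℤ))} (Om k)

/-! ### Symmetric functions -/

/-- The algebra `Λ` of symmetric functions with complex coefficients: formal power series of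
bounded degree in `x_0, x_1, x_2, …`, invariant under all permutations of the variables. -/
def SymFun : Subalgebra ℂ (MvPowerSeries ℕ ℂ) where
  carrier := {g | (∃ N : ℕ, ∀ d : ℕ →₀ ℕ, N < d.degree → MvPowerSeries.coeff d g = 0) ∧
    ∀ σ : Equiv.Perm ℕ, MvPowerSeries.renameEquiv ℂ σ g = g}
  mul_mem' := by
    rintro a b ⟨⟨N, hN⟩, ha⟩ ⟨⟨M, hM⟩, hb⟩
    refine ⟨⟨N + M, fun d hd => ?_⟩, fun σ => by rw [map_mul, ha, hb]⟩
    classical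
    rw [MvPowerSeries.coeff_mul]
    refine Finset.sum_eq_zero fun p hp => ?_
    rw [Finset.HasAntidiagonal.mem_antidiagonal] at hp
    have hdeg : p.1.degree + p.2.degree = d.degree := by rw [← hp, map_add]
    by_cases h1 : N < p.1.degree
    · rw [hN _ h1, zero_mul]
    · rw [hM _ (by omega), mul_zero]
  add_mem' := by
    rintro a b ⟨⟨N, hN⟩, ha⟩ ⟨⟨M, hM⟩, hb⟩
    refine ⟨⟨max N M, fun d hd => ?_⟩, fun σ => by rw [map_add, ha, hb]⟩
    rw [map_add, hN _ (lt_of_le_of_lt (le_max_left _ _) hd),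
      hM _ (lt_of_le_of_lt (le_max_right _ _) hd), add_zero]
  algebraMap_mem' := by
    intro r
    refine ⟨⟨0, fun d hd => ?_⟩, fun σ => AlgEquiv.commutes _ r⟩
    classical
    rw [MvPowerSeries.algebraMap_apply, Algebra.algebraMap_self_apply, MvPowerSeries.coeff_C,
      if_neg]
    rintro rfl
    simp at hd

open Classical in
/-- Newton's power sum `p_n = ∑_i x_i^n` (`n ≥ 1`), as a power series. -/
def psumSeries (n : ℕ) : MvPowerSeries ℕ ℂ :=
  fun d => if ∃ i, d = Finsupp.single i n then 1 else 0

/-- Newton's power sum `p_n` (`n ≥ 1`) as a symmetric function. -/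
def psum (n : ℕ) : SymFun :=
  ⟨psumSeries n, by
    classical
    refine ⟨⟨n, fun d hd => ?_⟩, fun σ => ?_⟩
    · change (if _ then (1 : ℂ) else 0) = 0
      rw [if_neg]
      rintro ⟨i, rfl⟩
      simp at hd
    · ext d
      obtain ⟨d, rfl⟩ : ∃ d', d = Finsupp.embDomain σ.toEmbedding d' :=
        ⟨d.mapDomain σ.symm, by
          rw [Finsupp.embDomain_eq_mapDomain, ← Finsupp.mapDomain_comp]; simp⟩
      rw [MvPowerSeries.renameEquiv_apply]
      refine (MvPowerSeries.coeff_embDomain_rename σ.toEmbedding (psumSeries n) d).trans ?_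
      change (if _ then (1 : ℂ) else 0) = if _ then (1 : ℂ) else 0
      congr 1
      refine propext ⟨?_, ?_⟩
      · rintro ⟨i, rfl⟩
        exact ⟨σ i, by simp [Finsupp.embDomain_single]⟩
      · rintro ⟨i, hi⟩
        refine ⟨σ.symm i, Finsupp.embDomain_injective σ.toEmbedding ?_⟩
        rw [hi, Finsupp.embDomain_single]
        simp⟩

/-- The Kostka number `K_{ν a}`: the number of semistandard tableaux of shape `ν` with
`a i` entries equal to `i` for every `i`. -/
def kostka (ν : YoungDiagram) (a : ℕ → ℕ) : ℕ :=
  Nat.card {T : SemistandardYoungTableau ν //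
    ∀ i, (ν.cells.filter fun c => T c.1 c.2 = i).card = a i}

/-- The Schur function `s_ν = ∑_T x^T`, the sum over the semistandard tableaux of shape `ν`. -/
def schur (ν : YoungDiagram) : MvPowerSeries ℕ ℂ := fun d => (kostka ν d : ℂ)

/-- `ν ⊂ (k^k)`. -/
def InSquare (k : ℕ) (ν : YoungDiagram) : Prop := ∀ c ∈ ν, c.1 < k ∧ c.2 < k

/-- The partitions `μ = (μ_1 ≥ … ≥ μ_k)` with `0 ≤ μ_i ≤ k`, i.e. `μ ⊂ (k^k)`. -/
abbrev SquarePartition (k : ℕ) : Type := {μ : Fin k → Fin (k + 1) // Antitone μ}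

/-- The sequence of the parts of `μ`, continued by zeros. -/
def parts {k : ℕ} (μ : SquarePartition k) (i : ℕ) : ℕ :=
  if hi : i < k then (μ.1 ⟨i, hi⟩ : ℕ) else 0

/-- The number `r_j` of the `μ_i`, `1 ≤ i ≤ k`, that are equal to `j`. -/
def mult {k : ℕ} (μ : SquarePartition k) (j : Fin (k + 1)) : ℕ :=
  (Finset.univ.filter fun i : Fin k => μ.1 i = j).card

/-- The vector `e_{-(k-μ_1)} … e_{-(k-μ_k)} Ω_{-2k}`. -/
def eVec (k : ℕ) (μ : SquarePartition k) : Fock :=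
  (List.ofFn fun i : Fin k => e (-((k : ℤ) - ((μ.1 i : ℕ) : ℤ)))).prod (Om k)

/-- The realization of the charge `0` subspace by symmetric functions: the vacuum corresponds to
`1`, the operator `h_{-n}` to multiplication by `p_n`, and `h_n` to the derivation
`2n ∂/∂p_n`, for `n > 0`. -/
structure IsRealization (Φ : SymFun ≃ₗ[ℂ] chargeZero) : Prop where
  map_one : (Φ 1 : Fock) = vacuum
  map_psum_mul : ∀ n : ℕ, 0 < n → ∀ g : SymFun, (Φ (psum n * g) : Fock) = h (-(n : ℤ)) (Φ g)
  map_deriv : ∀ n : ℕ, 0 < n → ∃ D : Derivation ℂ SymFun SymFun,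
    (∀ m : ℕ, 0 < m → D (psum m) = if m = n then ((2 * n : ℕ) : SymFun) else 0) ∧
    ∀ g : SymFun, (Φ (D g) : Fock) = h (n : ℤ) (Φ g)

end FockSL2

end

/-! ### Anticommutation relations and irreducibility of the Fock space -/

noncomputable section
namespace FockSL2

/-! Realization. The operators `h n` satisfy `[h m, h n] = 2 m δ_{m,-n}` (`lie_h_h`), and the charge
zero part of the basic module is the polynomial module over the vacuum in the creation operators `h
(-n)`. Indeed the sum of the polynomial modules over all extremal vectors is stable under every `e
n`, `f n`, `h n`, and `h 0` acts on its summands by different scalars (`chargeZero_eq`). The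
polynomials act freely on the vacuum (`polyActOn_vacuum_injective`) and the power sums generate the
symmetric functions freely (`powerEquiv`), so a realization exists and is unique.

Vertex operators. Write `H_n` for the complete homogeneous polynomial in the power sums `p_i = h
(-i)`. The single input from the fermions is `e_{n-2k-1} Ω_{-2(k+1)} = H_n Ω_{-2k}` (`e_Om`). It
comes from a norm comparison: the vectors on the two sides behave alike under `h r`, `r > 0`, and
both have norm `n + 1` (on the left a number of monomials, on the right a consequence of Newton's
recursion), which forces equality up to a sign computed for `n = 0`. Moving `e` past `H` produces
the coefficients of `(1 - y)^2` (`e_mul_hpoly`). Iterating, `e_{a_1-k} ⋯ e_{a_k-k} Ω_{-2k}` becomes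
`(-1)^{k(k-1)/2}` times the image of `z^a Δ(z) Δ(z⁻¹)` under the linear map `z^b ↦ ∏ H_{b_i}`, where
`Δ` is the Vandermonde determinant (`eProd_eq`).

Schur functions. Under this map the factor `Δ(z⁻¹)` turns `z^b` into the Jacobi–Trudi determinant
`det H_{b_i - j}` (`hprod_mono_mul_vdmInv`). Multiplying `s_ν(z) = ∑ K_{νa} z^a` by `Δ(z)` gives an
alternant, whose `k!` terms all contribute the same determinant `s_ν` (`sum_kostka_weylSum`).
Grouping the exponents `a` by their decreasing rearrangement `μ`, of which there are `k! / ∏ r_j!`,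
yields the formula (`jtPoly_eq_sum`).

Basis. The formula puts the linearly independent `s_ν`, `ν ⊂ (k^k)`, into the span of equally many
vectors, which are therefore independent. Conversely, an element of charge zero in the finite part
is a combination of words of exactly `k` letters `e_n` with `n ≤ 0`. Such a word is a combination of
determinants `det H_{c_i - j}` with `c_i < 2k`, and these straighten to `0` or to `± s_ν` with `ν ⊂
(k^k)` (`jtPoly_mem_span_squareSchur`). -/

/-- The ring of operators, found here without unfolding the additive structure of `Fock`. -/
abbrev endRing : Ring (Module.End ℂ Fock) := Module.End.instRing

attribute [local instance] endRing

theorem State.eq_of_occ_eq {S T : State} (hST : S.occ = T.occ) : S = T := by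
  cases S; cases T; cases hST; rfl

theorem State.finite_occ_gt (S : State) (a : ℤ) : {b : ℤ | b ∈ S.occ ∧ a < b}.Finite := by
  obtain ⟨M, hM⟩ := S.above
  refine (Set.finite_Icc a M).subset fun b hb => ⟨hb.2.le, ?_⟩
  by_contra hlt
  exact hM b (not_le.1 hlt) hb.1

@[simp] theorem State.mem_insert {S : State} {a b : ℤ} :
    b ∈ (S.insert a).occ ↔ b = a ∨ b ∈ S.occ := Set.mem_insert_iff

@[simp] theorem State.mem_erase {S : State} {a b : ℤ} :
    b ∈ (S.erase a).occ ↔ b ∈ S.occ ∧ b ≠ a := by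
  simp [State.erase]

theorem wedgeSign_mul_self (S : State) (a : ℤ) : wedgeSign S a * wedgeSign S a = 1 := by
  rw [wedgeSign, ← mul_pow]; norm_num

theorem wedgeSign_ne_zero (S : State) (a : ℤ) : wedgeSign S a ≠ 0 := by
  rw [wedgeSign]; exact pow_ne_zero _ (by norm_num)

theorem wedgeSign_insert {S : State} {a b : ℤ} (hb : b ∉ S.occ) :
    wedgeSign (S.insert b) a = if a < b then -wedgeSign S a else wedgeSign S a := by
  split_ifs with hab
  · have hset : {c : ℤ | c ∈ (S.insert b).occ ∧ a < c} =
        Insert.insert b {c : ℤ | c ∈ S.occ ∧ a < c} := by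
      ext c
      simp only [State.mem_insert, Set.mem_ofPred_eq, Set.mem_insert_iff]
      constructor
      · rintro ⟨hc | hc, hc'⟩
        · exact Or.inl hc
        · exact Or.inr ⟨hc, hc'⟩
      · rintro (rfl | hc)
        · exact ⟨Or.inl rfl, hab⟩
        · exact ⟨Or.inr hc.1, hc.2⟩
    rw [wedgeSign, hset, Set.ncard_insert_of_notMem (fun hc => hb hc.1) (S.finite_occ_gt a),
      pow_succ, wedgeSign]
    ring
  · have hset : {c : ℤ | c ∈ (S.insert b).occ ∧ a < c} = {c : ℤ | c ∈ S.occ ∧ a < c} := by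
      ext c
      simp only [State.mem_insert, Set.mem_ofPred_eq]
      constructor
      · rintro ⟨rfl | hc, hc'⟩
        · exact absurd hc' hab
        · exact ⟨hc, hc'⟩
      · rintro ⟨hc, hc'⟩
        exact ⟨Or.inr hc, hc'⟩
    rw [wedgeSign, hset, wedgeSign]

theorem State.insert_erase {S : State} {a : ℤ} (ha : a ∈ S.occ) : (S.erase a).insert a = S := by
  apply State.eq_of_occ_eq
  ext c
  rw [State.mem_insert, State.mem_erase]
  by_cases hc : c = a <;> simp [hc, ha]

theorem State.erase_insert {S : State} {a : ℤ} (ha : a ∉ S.occ) : (S.insert a).erase a = S := by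
  apply State.eq_of_occ_eq
  ext c
  rw [State.mem_erase, State.mem_insert]
  by_cases hc : c = a <;> simp [hc, ha]

theorem State.insert_comm (S : State) (a b : ℤ) :
    (S.insert a).insert b = (S.insert b).insert a := by
  apply State.eq_of_occ_eq
  ext c
  simp only [State.mem_insert]
  tauto

theorem State.erase_comm (S : State) (a b : ℤ) : (S.erase a).erase b = (S.erase b).erase a := by
  apply State.eq_of_occ_eq
  ext c
  simp only [State.mem_erase]
  tauto

theorem State.erase_insert_comm (S : State) {a b : ℤ} (hab : a ≠ b) :
    (S.insert a).erase b = (S.erase b).insert a := by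
  apply State.eq_of_occ_eq
  ext c
  simp only [State.mem_erase, State.mem_insert]
  by_cases hc : c = a
  · simp [hc, hab]
  · simp [hc]

theorem wedgeSign_erase {S : State} {a b : ℤ} (hb : b ∈ S.occ) :
    wedgeSign (S.erase b) a = if a < b then -wedgeSign S a else wedgeSign S a := by
  have hins := wedgeSign_insert (S := S.erase b) (a := a) (b := b) (by simp)
  rw [State.insert_erase hb] at hins
  rw [hins]
  split_ifs <;> simp

theorem opOfBasis_single (g : State → Fock) (S : State) (c : ℂ) :
    opOfBasis g (Finsupp.single S c) = c • g S := by
  simp [opOfBasis]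

theorem end_ext {A B : Module.End ℂ Fock}
    (hAB : ∀ S, A (Finsupp.single S 1) = B (Finsupp.single S 1)) : A = B :=
  Finsupp.lhom_ext' fun S => LinearMap.ext_ring (hAB S)

theorem wedge_of_mem {S : State} {a : ℤ} (ha : a ∈ S.occ) (c : ℂ) :
    wedge a (Finsupp.single S c) = 0 := by
  simp [wedge, opOfBasis_single, ha]

theorem wedge_of_notMem {S : State} {a : ℤ} (ha : a ∉ S.occ) (c : ℂ) :
    wedge a (Finsupp.single S c) = Finsupp.single (S.insert a) (c * wedgeSign S a) := by
  simp [wedge, opOfBasis_single, ha]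

theorem contract_of_mem {S : State} {a : ℤ} (ha : a ∈ S.occ) (c : ℂ) :
    contract a (Finsupp.single S c) = Finsupp.single (S.erase a) (c * wedgeSign S a) := by
  simp [contract, opOfBasis_single, ha]

theorem contract_of_notMem {S : State} {a : ℤ} (ha : a ∉ S.occ) (c : ℂ) :
    contract a (Finsupp.single S c) = 0 := by
  simp [contract, opOfBasis_single, ha]

/-- Of two distinct factors only the smaller one has to pass the other, so exactly one of the two
orders picks up an extra sign. -/
theorem wedge_mul_wedge (a b : ℤ) : wedge a * wedge b + wedge b * wedge a = 0 := by
  refine end_ext fun S => ?_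
  simp only [LinearMap.add_apply, Module.End.mul_apply, LinearMap.zero_apply]
  by_cases hab : a = b
  · subst hab
    by_cases ha : a ∈ S.occ
    · simp [wedge_of_mem ha]
    · rw [wedge_of_notMem ha, wedge_of_mem (by simp)]; simp
  by_cases ha : a ∈ S.occ
  · rw [wedge_of_mem ha]
    by_cases hb : b ∈ S.occ
    · simp [wedge_of_mem hb]
    · rw [wedge_of_notMem hb, wedge_of_mem (by simp [ha])]; simp
  · by_cases hb : b ∈ S.occ
    · rw [wedge_of_mem hb, wedge_of_notMem ha, wedge_of_mem (by simp [hb])]; simp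
    · rw [wedge_of_notMem ha, wedge_of_notMem hb, wedge_of_notMem (by simp [ha, hab]),
        wedge_of_notMem (by simp [hb, Ne.symm hab]), State.insert_comm S a b,
        wedgeSign_insert hb, wedgeSign_insert ha, ← Finsupp.single_add]
      rcases lt_or_gt_of_ne hab with hlt | hlt
      · rw [if_pos hlt, if_neg (not_lt.2 hlt.le), Finsupp.single_eq_zero]; ring
      · rw [if_pos hlt, if_neg (not_lt.2 hlt.le), Finsupp.single_eq_zero]; ring

theorem contract_mul_contract (a b : ℤ) : contract a * contract b + contract b * contract a = 0 := by
  refine end_ext fun S => ?_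
  simp only [LinearMap.add_apply, Module.End.mul_apply, LinearMap.zero_apply]
  by_cases hab : a = b
  · subst hab
    by_cases ha : a ∈ S.occ
    · rw [contract_of_mem ha, contract_of_notMem (by simp)]; simp
    · simp [contract_of_notMem ha]
  by_cases ha : a ∈ S.occ
  · by_cases hb : b ∈ S.occ
    · rw [contract_of_mem ha, contract_of_mem hb, contract_of_mem (by simp [ha, hab]),
        contract_of_mem (by simp [hb, Ne.symm hab]), State.erase_comm S a b,
        wedgeSign_erase hb, wedgeSign_erase ha, ← Finsupp.single_add]
      rcases lt_or_gt_of_ne hab with hlt | hlt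
      · rw [if_pos hlt, if_neg (not_lt.2 hlt.le), Finsupp.single_eq_zero]; ring
      · rw [if_pos hlt, if_neg (not_lt.2 hlt.le), Finsupp.single_eq_zero]; ring
    · rw [contract_of_notMem hb, contract_of_mem ha, contract_of_notMem (by simp [hb])]; simp
  · rw [contract_of_notMem ha]
    by_cases hb : b ∈ S.occ
    · rw [contract_of_mem hb, contract_of_notMem (by simp [ha])]; simp
    · simp [contract_of_notMem hb]

theorem contract_mul_wedge (a b : ℤ) :
    contract a * wedge b + wedge b * contract a = if a = b then 1 else 0 := by
  refine end_ext fun S => ?_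
  simp only [LinearMap.add_apply, Module.End.mul_apply]
  split_ifs with hab
  · subst hab
    rw [Module.End.one_apply]
    by_cases ha : a ∈ S.occ
    · rw [wedge_of_mem ha, contract_of_mem ha, wedge_of_notMem (by simp), State.insert_erase ha,
        wedgeSign_erase ha, if_neg (lt_irrefl a), mul_assoc, wedgeSign_mul_self]; simp
    · rw [contract_of_notMem ha, wedge_of_notMem ha, contract_of_mem (by simp),
        State.erase_insert ha, wedgeSign_insert ha, if_neg (lt_irrefl a), mul_assoc,
        wedgeSign_mul_self]; simp
  · rw [LinearMap.zero_apply]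
    by_cases ha : a ∈ S.occ
    · by_cases hb : b ∈ S.occ
      · rw [wedge_of_mem hb, contract_of_mem ha, wedge_of_mem (by simp [hb, Ne.symm hab])]; simp
      · rw [wedge_of_notMem hb, contract_of_mem ha, contract_of_mem (by simp [ha]),
          wedge_of_notMem (by simp [hb]), State.erase_insert_comm S (Ne.symm hab),
          wedgeSign_insert hb, wedgeSign_erase ha, ← Finsupp.single_add]
        rcases lt_or_gt_of_ne hab with hlt | hlt
        · rw [if_pos hlt, if_neg (not_lt.2 hlt.le), Finsupp.single_eq_zero]; ring
        · rw [if_pos hlt, if_neg (not_lt.2 hlt.le), Finsupp.single_eq_zero]; ring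
    · rw [contract_of_notMem ha]
      by_cases hb : b ∈ S.occ
      · rw [wedge_of_mem hb]; simp
      · rw [wedge_of_notMem hb, contract_of_notMem (by simp [ha, hab])]; simp

/-- An operator that commutes with all fermions and kills the vacuum vanishes. -/
theorem eq_zero_of_commute {T : Module.End ℂ Fock} (hw : ∀ a, T * wedge a = wedge a * T)
    (hc : ∀ a, T * contract a = contract a * T) (hT : T vacuum = 0) : T = 0 := by
  have hfin : ∀ S : State, (symmDiff S.occ vacuumState.occ).Finite := by
    intro S
    obtain ⟨N, hN⟩ := S.below
    obtain ⟨M, hM⟩ := S.above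
    refine (Set.finite_Icc (min N 0) (max M 0)).subset fun b hb => ?_
    simp only [Set.mem_Icc, Set.mem_symmDiff, vacuumState, Set.mem_ofPred_eq] at hb ⊢
    by_contra hcon
    have h1 := hN b
    have h2 := hM b
    rw [not_and_or, not_le, not_le, lt_min_iff, max_lt_iff] at hcon
    rcases hcon with hcon | hcon
    · have := h1 hcon.1
      rcases hb with hb | hb
      · omega
      · exact hb.2 this
    · have := h2 hcon.1
      rcases hb with hb | hb
      · exact this hb.1
      · omega
  -- Induction on the number of places where a monomial differs from the vacuum: up to sign it is
  -- one fermion applied to a monomial that is one place closer.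
  suffices hS : ∀ (n : ℕ) (S : State), (symmDiff S.occ vacuumState.occ).ncard = n →
      T (Finsupp.single S 1) = 0 from end_ext fun S => by simpa using hS _ S rfl
  intro n
  induction n with
  | zero =>
    intro S hS
    have hz : symmDiff S.occ vacuumState.occ = ∅ := (Set.ncard_eq_zero (hfin S)).1 hS
    have : S = vacuumState := State.eq_of_occ_eq (symmDiff_eq_bot.1 hz)
    rw [this]; exact hT
  | succ n ih =>
    intro S hS
    have hne : (symmDiff S.occ vacuumState.occ).Nonempty := by
      rw [← Set.ncard_pos (hfin S), hS]; omega
    obtain ⟨a, ha⟩ := hne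
    have hcard : ∀ S' : State, symmDiff S'.occ vacuumState.occ =
        symmDiff S.occ vacuumState.occ \ {a} → (symmDiff S'.occ vacuumState.occ).ncard = n := by
      intro S' hS'
      rw [hS', Set.ncard_sdiff_singleton_of_mem ha, hS]; rfl
    rcases ha with ⟨ha, ha'⟩ | ⟨ha', ha⟩
    · have h1 := ih (S.erase a) (hcard _ (by
        ext b
        simp only [Set.mem_symmDiff, State.mem_erase, Set.mem_sdiff, Set.mem_singleton_iff]
        by_cases hb : b = a
        · subst hb; simp [ha']
        · simp [hb]))
      have h2 : Finsupp.single S 1 = wedgeSign (S.erase a) a •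
          wedge a (Finsupp.single (S.erase a) (1 : ℂ)) := by
        rw [wedge_of_notMem (by simp), State.insert_erase ha, Finsupp.smul_single, smul_eq_mul,
          one_mul, wedgeSign_mul_self]
      rw [h2, map_smul, ← Module.End.mul_apply, hw, Module.End.mul_apply, h1]; simp
    · have h1 := ih (S.insert a) (hcard _ (by
        ext b
        simp only [Set.mem_symmDiff, State.mem_insert, Set.mem_sdiff, Set.mem_singleton_iff]
        by_cases hb : b = a
        · subst hb; simp [ha']
        · simp [hb]))
      have h2 : Finsupp.single S 1 = wedgeSign (S.insert a) a •
          contract a (Finsupp.single (S.insert a) (1 : ℂ)) := by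
        rw [contract_of_mem (by simp), State.erase_insert ha, Finsupp.smul_single, smul_eq_mul,
          one_mul, wedgeSign_mul_self]
      rw [h2, map_smul, ← Module.End.mul_apply, hc, Module.End.mul_apply, h1]; simp

/-- Only `S` itself is sent to `S.insert a`. Hence a vector killed by `wedge a` has no component on
monomials that lack the factor `a`. -/
theorem wedge_apply_insert {S : State} {a : ℤ} (ha : a ∉ S.occ) (x : Fock) :
    wedge a x (S.insert a) = wedgeSign S a * x S := by
  induction x using Finsupp.induction_linear with
  | zero => simp
  | add x y hx hy => rw [map_add, Finsupp.add_apply, hx, hy, Finsupp.add_apply, mul_add]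
  | single T c =>
    by_cases haT : a ∈ T.occ
    · have hne : T ≠ S := fun h => ha (h ▸ haT)
      rw [wedge_of_mem haT, Finsupp.single_eq_of_ne' hne]; simp
    · rw [wedge_of_notMem haT]
      by_cases hTS : T = S
      · subst hTS; simp [mul_comm]
      · have hne : T.insert a ≠ S.insert a := fun h => hTS (by
          rw [← State.erase_insert haT, h, State.erase_insert ha])
        rw [Finsupp.single_eq_of_ne' hne, Finsupp.single_eq_of_ne' hTS, mul_zero]

theorem contract_apply_erase {S : State} {a : ℤ} (ha : a ∈ S.occ) (x : Fock) :
    contract a x (S.erase a) = wedgeSign S a * x S := by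
  induction x using Finsupp.induction_linear with
  | zero => simp
  | add x y hx hy => rw [map_add, Finsupp.add_apply, hx, hy, Finsupp.add_apply, mul_add]
  | single T c =>
    by_cases haT : a ∈ T.occ
    · rw [contract_of_mem haT]
      by_cases hTS : T = S
      · subst hTS; simp [mul_comm]
      · have hne : T.erase a ≠ S.erase a := fun h => hTS (by
          rw [← State.insert_erase haT, h, State.insert_erase ha])
        rw [Finsupp.single_eq_of_ne' hne, Finsupp.single_eq_of_ne' hTS, mul_zero]
    · have hne : T ≠ S := fun h => haT (h ▸ ha)
      rw [contract_of_notMem haT, Finsupp.single_eq_of_ne' hne]; simp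

/-- The Fock space is irreducible over the fermions. -/
theorem eq_smul_one_of_commute {T : Module.End ℂ Fock} (hw : ∀ a, T * wedge a = wedge a * T)
    (hc : ∀ a, T * contract a = contract a * T) : T = T vacuum vacuumState • 1 := by
  suffices T - T vacuum vacuumState • (1 : Module.End ℂ Fock) = 0 from sub_eq_zero.1 this
  refine eq_zero_of_commute (fun a => ?_) (fun a => ?_) ?_
  · rw [sub_mul, mul_sub, hw]; simp
  · rw [sub_mul, mul_sub, hc]; simp
  · ext S
    by_cases hS : S = vacuumState
    · subst hS; simp [vacuum]
    · suffices h0 : T vacuum S = 0 by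
        simp only [LinearMap.sub_apply, LinearMap.smul_apply, Module.End.one_apply,
          Finsupp.sub_apply, Finsupp.smul_apply, h0, Finsupp.zero_apply]
        simp [vacuum, Finsupp.single_eq_of_ne' (Ne.symm hS)]
      have hne : S.occ ≠ vacuumState.occ := fun h => hS (State.eq_of_occ_eq h)
      -- `T vacuum` is killed by every fermion that kills the vacuum. At a place where `S` differs
      -- from the vacuum one of these fermions detects the coefficient of `S`, which is therefore
      -- zero.
      have : ∃ a, ¬(a ∈ S.occ ↔ a ∈ vacuumState.occ) := by
        by_contra hcon
        push Not at hcon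
        exact hne (Set.ext hcon)
      obtain ⟨a, ha⟩ := this
      by_cases haS : a ∈ S.occ
      · have hav : a ∉ vacuumState.occ := fun h => ha (by simp [haS, h])
        have h1 : contract a (T vacuum) = 0 := by
          rw [← Module.End.mul_apply, ← hc, Module.End.mul_apply, vacuum, contract_of_notMem hav,
            map_zero]
        have h2 := contract_apply_erase haS (T vacuum)
        rw [h1, Finsupp.zero_apply] at h2
        exact (mul_eq_zero.1 h2.symm).resolve_left (wedgeSign_ne_zero S a)
      · have hav : a ∈ vacuumState.occ := by
          by_contra h
          exact ha (by simp [haS, h])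
        have h1 : wedge a (T vacuum) = 0 := by
          rw [← Module.End.mul_apply, ← hw, Module.End.mul_apply, vacuum, wedge_of_mem hav,
            map_zero]
        have h2 := wedge_apply_insert haS (T vacuum)
        rw [h1, Finsupp.zero_apply] at h2
        exact (mul_eq_zero.1 h2.symm).resolve_left (wedgeSign_ne_zero S a)

end FockSL2
end

/-! ### Currents, bosons and their commutators -/

noncomputable section
namespace FockSL2
attribute [local instance] endRing

/-- The number of the one-particle vector `u_i` (`true`) or `v_i` (`false`). -/
def lab : Bool → ℤ → ℤ
  | true => u
  | false => v

theorem le_lab (s : Bool) (i : ℤ) : 2 * i ≤ lab s i := by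
  cases s <;> simp [lab, u, v]

theorem lab_le (s : Bool) (i : ℤ) : lab s i ≤ 2 * i + 1 := by
  cases s <;> simp [lab, u, v]

theorem lab_inj {s t : Bool} {i j : ℤ} : lab s i = lab t j ↔ s = t ∧ i = j := by
  cases s <;> cases t <;> simp only [lab, u, v, reduceCtorEq, false_and, true_and, iff_false] <;>
    omega

theorem exists_lab (a : ℤ) : ∃ s i, lab s i = a := by
  rcases Int.even_or_odd' a with ⟨c, hc | hc⟩
  · exact ⟨false, c, hc.symm⟩
  · exact ⟨true, c, hc.symm⟩

/-- A family of operators of which almost all vanish on every given monomial. -/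
def LocallyFiniteFamily (A : ℤ → Module.End ℂ Fock) : Prop :=
  ∀ S : State, {j | A j (Finsupp.single S 1) ≠ 0}.Finite

theorem LocallyFiniteFamily.finite_support {A : ℤ → Module.End ℂ Fock}
    (hA : LocallyFiniteFamily A) (x : Fock) : (Function.support fun j => A j x).Finite := by
  induction x using Finsupp.induction_linear with
  | zero => simp
  | add x y hx hy =>
    refine (hx.union hy).subset fun j hj => ?_
    by_contra hcon
    simp only [Set.mem_union, Function.mem_support, not_or, not_not] at hcon hj
    exact hj (by rw [map_add, hcon.1, hcon.2, add_zero])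
  | single S c =>
    refine (hA S).subset fun j hj => ?_
    rw [Function.mem_support, ← mul_one c, ← smul_eq_mul, ← Finsupp.smul_single, map_smul] at hj
    exact fun h0 => hj (by rw [h0, smul_zero])

theorem opSum_apply {A : ℤ → Module.End ℂ Fock} (hA : LocallyFiniteFamily A) (x : Fock) :
    opSum A x = ∑ᶠ j, A j x := by
  induction x using Finsupp.induction_linear with
  | zero => simp
  | add x y hx hy =>
    simp only [map_add]
    rw [hx, hy, finsum_add_distrib (hA.finite_support x) (hA.finite_support y)]
  | single S c =>
    rw [opSum, opOfBasis_single, smul_finsum]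
    refine finsum_congr fun j => ?_
    rw [← map_smul, Finsupp.smul_single, smul_eq_mul, mul_one]

/-- On a fixed vector only finitely many terms act, so an arbitrary operator may be moved inside the
infinite sum. -/
theorem lie_opSum_apply {A : ℤ → Module.End ℂ Fock} (hA : LocallyFiniteFamily A)
    (T : Module.End ℂ Fock) (x : Fock) : ⁅opSum A, T⁆ x = ∑ᶠ j, ⁅A j, T⁆ x := by
  have h1 : T (∑ᶠ j, A j x) = ∑ᶠ j, T (A j x) :=
    T.toAddMonoidHom.map_finsum (hA.finite_support x)
  have hfin : (Function.support fun j => T (A j x)).Finite :=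
    (hA.finite_support x).subset fun j hj h0 => hj (by simp only at h0 ⊢; rw [h0, map_zero])
  rw [Ring.lie_def, LinearMap.sub_apply, Module.End.mul_apply, Module.End.mul_apply,
    opSum_apply hA, opSum_apply hA, h1, ← finsum_sub_distrib (hA.finite_support _) hfin]
  rfl

/-- A bilinear passes a fermion by two anticommutations, and only the pairing of opposite kinds
leaves a term. -/
theorem lie_wedge_contract_wedge (a b d : ℤ) :
    ⁅wedge a * contract b, wedge d⁆ = if b = d then wedge a else 0 := by
  have h1 := contract_mul_wedge b d
  have h2 := wedge_mul_wedge a d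
  have h3 : ⁅wedge a * contract b, wedge d⁆ = wedge a * (contract b * wedge d +
      wedge d * contract b) - (wedge a * wedge d + wedge d * wedge a) * contract b := by
    rw [Ring.lie_def]; noncomm_ring
  rw [h3, h1, h2]
  split_ifs <;> simp

theorem lie_wedge_contract_contract (a b d : ℤ) :
    ⁅wedge a * contract b, contract d⁆ = if d = a then -contract b else 0 := by
  have h1 := contract_mul_wedge d a
  have h2 := contract_mul_contract b d
  have h3 : ⁅wedge a * contract b, contract d⁆ = wedge a * (contract b * contract d +
      contract d * contract b) - (contract d * wedge a + wedge a * contract d) * contract b := by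
    rw [Ring.lie_def]; noncomm_ring
  rw [h3, h1, h2]
  split_ifs <;> simp

/-- For large `j` the level to be emptied is vacant, for very negative `j` the level to be filled is
occupied. The hypothesis rules out that the wedge refills the level just emptied. -/
theorem locallyFinite_pair {s t : Bool} {p q : ℤ} (hst : s ≠ t ∨ p ≠ q) :
    LocallyFiniteFamily fun j => wedge (lab s (j + p)) * contract (lab t (j + q)) := by
  intro S
  obtain ⟨N, hN⟩ := S.below
  obtain ⟨M, hM⟩ := S.above
  refine (Set.finite_Icc (-(|N| + |p| + 1)) (|M| + |q| + 1)).subset fun j hj => ?_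
  rw [Set.mem_ofPred_eq, Module.End.mul_apply] at hj
  have hmem : lab t (j + q) ∈ S.occ := by
    by_contra hcon
    exact hj (by rw [contract_of_notMem hcon, map_zero])
  have hnot : lab s (j + p) ∉ S.occ := by
    intro hcon
    refine hj ?_
    rw [contract_of_mem hmem, wedge_of_mem]
    rw [State.mem_erase]
    refine ⟨hcon, fun h => ?_⟩
    rw [lab_inj] at h
    rcases hst with hst | hst
    · exact hst h.1
    · exact hst (by linarith [h.2])
  have h1 : lab t (j + q) ≤ M := by
    by_contra hcon
    exact hM _ (not_le.1 hcon) hmem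
  have h2 : N ≤ lab s (j + p) := by
    by_contra hcon
    exact hnot (hN _ (not_le.1 hcon))
  have h3 := le_lab t (j + q)
  have h4 := lab_le s (j + p)
  have := le_abs_self M
  have := neg_abs_le N
  have := le_abs_self p
  have := neg_abs_le q
  have := abs_nonneg M
  have := abs_nonneg N
  constructor <;> omega

theorem locallyFinite_normal (s : Bool) : LocallyFiniteFamily fun k =>
    if 0 < k then wedge (lab s k) * contract (lab s k)
    else -(contract (lab s k) * wedge (lab s k)) := by
  intro S
  obtain ⟨N, hN⟩ := S.below
  obtain ⟨M, hM⟩ := S.above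
  refine (Set.finite_Icc (-(|N| + 1)) (|M| + 1)).subset fun k hk => ?_
  simp only [Set.mem_ofPred_eq] at hk
  have h3 := le_lab s k
  have h4 := lab_le s k
  have := le_abs_self M
  have := neg_abs_le N
  have := abs_nonneg M
  have := abs_nonneg N
  split_ifs at hk with h0
  · have hmem : lab s k ∈ S.occ := by
      by_contra hcon
      exact hk (by rw [Module.End.mul_apply, contract_of_notMem hcon, map_zero])
    have h1 : lab s k ≤ M := by
      by_contra hcon
      exact hM _ (not_le.1 hcon) hmem
    constructor <;> omega
  · have hnot : lab s k ∉ S.occ := by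
      intro hcon
      exact hk (by rw [LinearMap.neg_apply, Module.End.mul_apply, wedge_of_mem hcon, map_zero,
        neg_zero])
    have h2 : N ≤ lab s k := by
      by_contra hcon
      exact hnot (hN _ (not_le.1 hcon))
    constructor <;> omega

/-- Normal ordering changes the product by a scalar, which commutators do not see. -/
theorem lie_normal (s : Bool) (k : ℤ) (T : Module.End ℂ Fock) :
    ⁅if 0 < k then wedge (lab s k) * contract (lab s k)
      else -(contract (lab s k) * wedge (lab s k)), T⁆ =
    ⁅wedge (lab s k) * contract (lab s k), T⁆ := by
  split_ifs
  · rfl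
  · have h1 : -(contract (lab s k) * wedge (lab s k)) =
        wedge (lab s k) * contract (lab s k) - 1 := by
      have := contract_mul_wedge (lab s k) (lab s k)
      rw [if_pos rfl] at this
      rw [← this]; noncomm_ring
    rw [h1, Ring.lie_def, Ring.lie_def]; noncomm_ring

/-- The operator `J` has the commutators of `∑_j w_{s, j + n} w_{t, j}^*` with the fermions. -/
structure IsCurrent (s t : Bool) (n : ℤ) (J : Module.End ℂ Fock) : Prop where
  lie_wedge : ∀ r i, ⁅J, wedge (lab r i)⁆ = if r = t then wedge (lab s (i + n)) else 0
  lie_contract : ∀ r i, ⁅J, contract (lab r i)⁆ = if r = s then -contract (lab t (i - n)) else 0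

/-- A given fermion fails to commute with a single term of the sum. Only the commutators of `A j`
are prescribed, so that the normally ordered zero mode is covered too. -/
theorem isCurrent_of_lie_eq {A : ℤ → Module.End ℂ Fock} (hA : LocallyFiniteFamily A)
    {s t : Bool} {p q : ℤ} (hlie : ∀ (j : ℤ) (T : Module.End ℂ Fock),
      ⁅A j, T⁆ = ⁅wedge (lab s (j + p)) * contract (lab t (j + q)), T⁆) :
    IsCurrent s t (p - q) (opSum A) := by
  constructor
  · intro r i
    refine LinearMap.ext fun x => ?_
    rw [lie_opSum_apply hA, finsum_eq_single _ (i - q)]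
    · rw [hlie, lie_wedge_contract_wedge]
      simp only [lab_inj, sub_add_cancel, and_true, eq_comm (a := t)]
      rw [show i - q + p = i + (p - q) by ring]
    · intro j hj
      rw [hlie, lie_wedge_contract_wedge, if_neg, LinearMap.zero_apply]
      rw [lab_inj]
      rintro ⟨-, h⟩
      exact hj (by linarith)
  · intro r i
    refine LinearMap.ext fun x => ?_
    rw [lie_opSum_apply hA, finsum_eq_single _ (i - p)]
    · rw [hlie, lie_wedge_contract_contract]
      simp only [lab_inj, sub_add_cancel, and_true]
      rw [show i - p + q = i - (p - q) by ring]
    · intro j hj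
      rw [hlie, lie_wedge_contract_contract, if_neg, LinearMap.zero_apply]
      rw [lab_inj]
      rintro ⟨-, h⟩
      exact hj (by linarith)

theorem e_eq (n : ℤ) : e n = opSum fun j => wedge (lab false (j + n)) * contract (lab true (j + 0)) := by
  simp only [add_zero]; rfl

theorem f_eq (n : ℤ) : f n = opSum fun j => wedge (lab true (j + n)) * contract (lab false (j + 0)) := by
  simp only [add_zero]; rfl

/-- The bosons of the fermions with the given label. -/
def labBoson (s : Bool) (n : ℤ) : Module.End ℂ Fock :=
  boson (fun k => wedge (lab s k)) (fun k => contract (lab s k)) n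

theorem labBoson_of_ne (s : Bool) {n : ℤ} (hn : n ≠ 0) : labBoson s n =
    opSum fun j => wedge (lab s (j + 0)) * contract (lab s (j + n)) := by
  simp only [labBoson, boson, if_neg hn, add_zero]

theorem h_eq (n : ℤ) : h n = labBoson false n - labBoson true n := rfl

theorem isCurrent_e (n : ℤ) : IsCurrent false true n (e n) := by
  rw [e_eq]
  simpa using isCurrent_of_lie_eq (locallyFinite_pair (p := n) (q := 0) (Or.inl Bool.false_ne_true))
    fun j T => rfl

theorem isCurrent_f (n : ℤ) : IsCurrent true false n (f n) := by
  rw [f_eq]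
  simpa using isCurrent_of_lie_eq
    (locallyFinite_pair (p := n) (q := 0) (Or.inl Bool.false_ne_true.symm)) fun j T => rfl

theorem isCurrent_labBoson (s : Bool) (n : ℤ) : IsCurrent s s (-n) (labBoson s n) := by
  by_cases hn : n = 0
  · subst hn
    have := isCurrent_of_lie_eq (s := s) (t := s) (p := 0) (q := 0) (locallyFinite_normal s)
      (fun j T => by simpa using lie_normal s j T)
    simpa [labBoson, boson] using this
  · rw [labBoson_of_ne s hn]
    simpa using isCurrent_of_lie_eq (locallyFinite_pair (Or.inr (Ne.symm hn))) fun j T => rfl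

/-- The sign with which the fermions with the given label enter `h`. -/
def labSign (s : Bool) : ℂ := if s then -1 else 1

theorem labSign_mul_self (s : Bool) : labSign s * labSign s = 1 := by
  cases s <;> simp [labSign]

theorem lie_h_wedge (n : ℤ) (r : Bool) (i : ℤ) :
    ⁅h n, wedge (lab r i)⁆ = labSign r • wedge (lab r (i - n)) := by
  have h1 : ⁅h n, wedge (lab r i)⁆ =
      ⁅labBoson false n, wedge (lab r i)⁆ - ⁅labBoson true n, wedge (lab r i)⁆ := by
    rw [h_eq, Ring.lie_def, Ring.lie_def, Ring.lie_def]; noncomm_ring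
  rw [h1, (isCurrent_labBoson _ n).lie_wedge, (isCurrent_labBoson _ n).lie_wedge]
  cases r <;> simp [labSign, sub_eq_add_neg]

theorem lie_h_contract (n : ℤ) (r : Bool) (i : ℤ) :
    ⁅h n, contract (lab r i)⁆ = -(labSign r • contract (lab r (i + n))) := by
  have h1 : ⁅h n, contract (lab r i)⁆ =
      ⁅labBoson false n, contract (lab r i)⁆ - ⁅labBoson true n, contract (lab r i)⁆ := by
    rw [h_eq, Ring.lie_def, Ring.lie_def, Ring.lie_def]; noncomm_ring
  rw [h1, (isCurrent_labBoson _ n).lie_contract, (isCurrent_labBoson _ n).lie_contract]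
  cases r <;> simp [labSign]

/-- Reduces an identity of operators to commutators with the fermions and one vacuum coefficient. -/
theorem eq_smul_one_of_lie {T : Module.End ℂ Fock} (hw : ∀ r i, ⁅T, wedge (lab r i)⁆ = 0)
    (hc : ∀ r i, ⁅T, contract (lab r i)⁆ = 0) : T = T vacuum vacuumState • 1 := by
  refine eq_smul_one_of_commute (fun a => ?_) (fun a => ?_)
  · obtain ⟨r, i, rfl⟩ := exists_lab a
    exact sub_eq_zero.1 (hw r i)
  · obtain ⟨r, i, rfl⟩ := exists_lab a
    exact sub_eq_zero.1 (hc r i)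

theorem exists_labBoson_zero_single (s : Bool) (S : State) :
    ∃ q : ℂ, labBoson s 0 (Finsupp.single S 1) = q • Finsupp.single S 1 := by
  suffices hmem : labBoson s 0 (Finsupp.single S 1) ∈ Submodule.span ℂ {Finsupp.single S (1 : ℂ)} by
    obtain ⟨q, hq⟩ := Submodule.mem_span_singleton.1 hmem
    exact ⟨q, hq.symm⟩
  simp only [labBoson, boson, if_true]
  rw [opSum_apply (locallyFinite_normal s)]
  refine finsum_induction (· ∈ Submodule.span ℂ {Finsupp.single S (1 : ℂ)})
    (Submodule.zero_mem _) (fun _ _ => Submodule.add_mem _) fun k => ?_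
  split_ifs
  · rw [Module.End.mul_apply]
    by_cases hk : lab s k ∈ S.occ
    · rw [contract_of_mem hk, wedge_of_notMem (by simp), State.insert_erase hk, ← mul_one (_ * _),
        ← smul_eq_mul, ← Finsupp.smul_single]
      exact Submodule.smul_mem _ _ (Submodule.mem_span_singleton_self _)
    · rw [contract_of_notMem hk, map_zero]
      exact Submodule.zero_mem _
  · rw [LinearMap.neg_apply, Module.End.mul_apply]
    refine Submodule.neg_mem _ ?_
    by_cases hk : lab s k ∈ S.occ
    · rw [wedge_of_mem hk, map_zero]
      exact Submodule.zero_mem _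
    · rw [wedge_of_notMem hk, contract_of_mem (by simp), State.erase_insert hk, ← mul_one (_ * _),
        ← smul_eq_mul, ← Finsupp.smul_single]
      exact Submodule.smul_mem _ _ (Submodule.mem_span_singleton_self _)

theorem lab_mem_vacuum {s : Bool} {i : ℤ} : lab s i ∈ vacuumState.occ ↔ i < 0 := by
  have h1 := le_lab s i
  have h2 := lab_le s i
  simp only [vacuumState, Set.mem_ofPred_eq]
  constructor <;> intro h3 <;> omega

/-- The vacuum is filled up to level `-1`, whereas the normal ordering treats the levels `k ≤ 0` as
filled; the term `k = 0` contributes `-1`. The two labels cancel in `h 0`. -/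
theorem labBoson_zero_vacuum (s : Bool) : labBoson s 0 vacuum = -vacuum := by
  simp only [labBoson, boson, if_true]
  rw [opSum_apply (locallyFinite_normal s), finsum_eq_single _ 0]
  · have hk : lab s 0 ∉ vacuumState.occ := by rw [lab_mem_vacuum]; simp
    rw [if_neg (lt_irrefl _), LinearMap.neg_apply, Module.End.mul_apply, vacuum,
      wedge_of_notMem hk, contract_of_mem (by simp), State.erase_insert hk, wedgeSign_insert hk,
      if_neg (lt_irrefl _), mul_assoc, wedgeSign_mul_self, mul_one]
  · intro k hk
    split_ifs with h0
    · rw [Module.End.mul_apply, vacuum, contract_of_notMem, map_zero]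
      rw [lab_mem_vacuum]; omega
    · rw [LinearMap.neg_apply, Module.End.mul_apply, vacuum, wedge_of_mem, map_zero, neg_zero]
      rw [lab_mem_vacuum]; omega

theorem h_zero_vacuum : h 0 vacuum = 0 := by
  rw [h_eq, LinearMap.sub_apply, labBoson_zero_vacuum, labBoson_zero_vacuum, sub_self]

theorem exists_h_zero_single (S : State) :
    ∃ q : ℂ, h 0 (Finsupp.single S 1) = q • Finsupp.single S 1 := by
  obtain ⟨p, hp⟩ := exists_labBoson_zero_single false S
  obtain ⟨q, hq⟩ := exists_labBoson_zero_single true S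
  exact ⟨p - q, by rw [h_eq, LinearMap.sub_apply, hp, hq, sub_smul]⟩

/-- `h 0` is diagonal on monomials with eigenvalue `0` on the vacuum. -/
theorem h_zero_apply_vacuumState (x : Fock) : h 0 x vacuumState = 0 := by
  induction x using Finsupp.induction_linear with
  | zero => simp
  | add x y hx hy => rw [map_add, Finsupp.add_apply, hx, hy, add_zero]
  | single S c =>
    by_cases hS : S = vacuumState
    · have : Finsupp.single S c = c • vacuum := by simp [hS, vacuum]
      rw [this, map_smul, h_zero_vacuum]; simp
    · obtain ⟨q, hq⟩ := exists_h_zero_single S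
      have : Finsupp.single S c = c • Finsupp.single S (1 : ℂ) := by simp
      rw [this, map_smul, hq, Finsupp.smul_apply, Finsupp.smul_apply, Finsupp.single_eq_of_ne' hS]
      simp

theorem lie_lie' (A B C : Module.End ℂ Fock) : ⁅⁅A, B⁆, C⁆ = ⁅A, ⁅B, C⁆⁆ - ⁅B, ⁅A, C⁆⁆ := by
  simp only [Ring.lie_def]; noncomm_ring

theorem lie_smul_one (A : Module.End ℂ Fock) (c : ℂ) : ⁅A, c • (1 : Module.End ℂ Fock)⁆ = 0 := by
  rw [Ring.lie_def]; simp

theorem lie_smul' (A B : Module.End ℂ Fock) (c : ℂ) : ⁅A, c • B⁆ = c • ⁅A, B⁆ := by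
  rw [Ring.lie_def, Ring.lie_def, mul_smul_comm, smul_mul_assoc, smul_sub]

theorem smul_lie' (A B : Module.End ℂ Fock) (c : ℂ) : ⁅c • A, B⁆ = c • ⁅A, B⁆ := by
  rw [Ring.lie_def, Ring.lie_def, mul_smul_comm, smul_mul_assoc, smul_sub]

theorem lie_neg' (A B : Module.End ℂ Fock) : ⁅A, -B⁆ = -⁅A, B⁆ := by
  rw [Ring.lie_def, Ring.lie_def]; noncomm_ring

theorem sub_lie' (A B C : Module.End ℂ Fock) : ⁅A - B, C⁆ = ⁅A, C⁆ - ⁅B, C⁆ := by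
  simp only [Ring.lie_def]; noncomm_ring

theorem lie_sub' (A B C : Module.End ℂ Fock) : ⁅A, B - C⁆ = ⁅A, B⁆ - ⁅A, C⁆ := by
  simp only [Ring.lie_def]; noncomm_ring

/-- Each `h m` shifts the index of a fermion, with a sign depending only on the label. Such shifts
commute, so the commutator commutes with all fermions. -/
theorem lie_h_h_eq_smul_one (m n : ℤ) :
    ⁅h m, h n⁆ = ⁅h m, h n⁆ vacuum vacuumState • 1 := by
  refine eq_smul_one_of_lie (fun r i => ?_) (fun r i => ?_)
  · rw [lie_lie', lie_h_wedge, lie_h_wedge, lie_smul', lie_smul', lie_h_wedge, lie_h_wedge,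
      sub_right_comm, sub_self]
  · rw [lie_lie', lie_h_contract, lie_h_contract, lie_neg', lie_neg', lie_smul', lie_smul',
      lie_h_contract, lie_h_contract, add_right_comm, sub_self]

theorem lie_h_zero_h (m : ℤ) : ⁅h 0, h m⁆ = 0 := by
  rw [lie_h_h_eq_smul_one, Ring.lie_def, LinearMap.sub_apply, Module.End.mul_apply,
    Module.End.mul_apply, h_zero_vacuum, map_zero, sub_zero, h_zero_apply_vacuumState, zero_smul]

/-- Both sides have the same commutators with the fermions, hence differ by a scalar. For `m = 0`
the scalar is a vacuum coefficient, which vanishes. In general bracketing with `h 0` multiplies the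
difference by `±2`, yet kills scalars, so the scalar is zero. -/
theorem lie_h_current {s t : Bool} (hst : s ≠ t) {m n : ℤ} {J J' : Module.End ℂ Fock}
    (hJ : IsCurrent s t n J) (hJ' : IsCurrent s t (n - m) J') (hJ0 : J vacuum vacuumState = 0)
    (hJ0' : J' vacuum vacuumState = 0) :
    ⁅h m, J⁆ = (2 * labSign s) • J' := by
  have hsign : labSign t = -labSign s := by
    cases s <;> cases t <;> simp_all [labSign]
  have key : ∀ (m n : ℤ) (J J' : Module.End ℂ Fock), IsCurrent s t n J →
      IsCurrent s t (n - m) J' →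
      ⁅h m, J⁆ - (2 * labSign s) • J' =
        (⁅h m, J⁆ - (2 * labSign s) • J') vacuum vacuumState • 1 := by
    intro m n J J' hJ hJ'
    refine eq_smul_one_of_lie (fun r i => ?_) (fun r i => ?_)
    · rw [sub_lie', lie_lie', smul_lie', lie_h_wedge, lie_smul', hJ.lie_wedge, hJ.lie_wedge,
        hJ'.lie_wedge]
      by_cases hr : r = t
      · subst hr
        rw [if_pos rfl, if_pos rfl, if_pos rfl, lie_h_wedge, hsign,
          show i + n - m = i + (n - m) by ring, show i - m + n = i + (n - m) by ring]
        module
      · simp [hr, Ring.lie_def]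
    · rw [sub_lie', lie_lie', smul_lie', lie_h_contract, lie_neg', lie_smul', hJ.lie_contract,
        hJ.lie_contract, hJ'.lie_contract]
      by_cases hr : r = s
      · subst hr
        rw [if_pos rfl, if_pos rfl, if_pos rfl, lie_neg', lie_h_contract, hsign,
          show i - n + m = i - (n - m) by ring, show i + m - n = i - (n - m) by ring]
        module
      · simp [hr, Ring.lie_def]
  have h0 : ∀ (n : ℤ) (J : Module.End ℂ Fock), IsCurrent s t n J → J vacuum vacuumState = 0 →
      ⁅h 0, J⁆ = (2 * labSign s) • J := by
    intro n J hJ hJ0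
    have := key 0 n J J hJ (by simpa using hJ)
    rwa [LinearMap.sub_apply, Ring.lie_def, LinearMap.sub_apply, Module.End.mul_apply,
      Module.End.mul_apply, h_zero_vacuum, map_zero, sub_zero, LinearMap.smul_apply,
      Finsupp.sub_apply, Finsupp.smul_apply, hJ0, h_zero_apply_vacuumState, smul_zero, sub_zero,
      zero_smul, sub_eq_zero, ← Ring.lie_def] at this
  have hs2 : (2 * labSign s) ≠ 0 := by cases s <;> simp [labSign]
  have hT := key m n J J' hJ hJ'
  have hjac : ⁅h 0, ⁅h m, J⁆⁆ = (2 * labSign s) • ⁅h m, J⁆ := by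
    have h1 := lie_lie' (h 0) (h m) J
    rw [lie_h_zero_h, h0 n J hJ hJ0, lie_smul'] at h1
    have h2 : ⁅(0 : Module.End ℂ Fock), J⁆ = 0 := by rw [Ring.lie_def]; simp
    rw [h2] at h1
    exact sub_eq_zero.1 h1.symm
  have h1 : ⁅h 0, ⁅h m, J⁆ - (2 * labSign s) • J'⁆ =
      (2 * labSign s) • (⁅h m, J⁆ - (2 * labSign s) • J') := by
    rw [lie_sub', hjac, lie_smul', h0 _ J' hJ' hJ0', smul_sub]
  rw [hT, lie_smul_one] at h1
  have h2 := (smul_eq_zero.1 h1.symm).resolve_left hs2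
  rw [← hT, sub_eq_zero] at h2
  exact h2

theorem opSum_apply_apply {A : ℤ → Module.End ℂ Fock} (hA : LocallyFiniteFamily A) (x : Fock)
    (S : State) : opSum A x S = ∑ᶠ j, A j x S := by
  rw [opSum_apply hA]
  exact (Finsupp.applyAddHom S).map_finsum (hA.finite_support x)

theorem wedge_contract_vacuum_apply (a b : ℤ) :
    (wedge a * contract b) vacuum vacuumState = if a = b ∧ a < 0 then 1 else 0 := by
  rw [Module.End.mul_apply, vacuum]
  by_cases hb : b ∈ vacuumState.occ
  · rw [contract_of_mem hb]
    split_ifs with hab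
    · rw [hab.1, wedge_of_notMem (by simp), State.insert_erase hb, wedgeSign_erase hb,
        if_neg (lt_irrefl _), mul_assoc, wedgeSign_mul_self]
      simp
    · by_cases ha : a ∈ (vacuumState.erase b).occ
      · rw [wedge_of_mem ha]; rfl
      · rw [wedge_of_notMem ha, Finsupp.single_eq_of_ne']
        intro hcon
        have hb' : b ∈ ((vacuumState.erase b).insert a).occ := by rw [hcon]; exact hb
        rw [State.mem_insert, State.mem_erase] at hb'
        have hba : b = a := by tauto
        exact hab ⟨hba.symm, hba ▸ hb⟩
  · rw [contract_of_notMem hb, map_zero, if_neg]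
    · rfl
    · rintro ⟨rfl, h0⟩
      exact hb h0

theorem e_vacuum_apply (n : ℤ) : e n vacuum vacuumState = 0 := by
  rw [e_eq, opSum_apply_apply (locallyFinite_pair (Or.inl (by simp)))]
  refine finsum_eq_zero_of_forall_eq_zero fun j => ?_
  rw [wedge_contract_vacuum_apply, if_neg]
  rw [lab_inj]; simp

theorem f_vacuum_apply (n : ℤ) : f n vacuum vacuumState = 0 := by
  rw [f_eq, opSum_apply_apply (locallyFinite_pair (Or.inl (by simp)))]
  refine finsum_eq_zero_of_forall_eq_zero fun j => ?_
  rw [wedge_contract_vacuum_apply, if_neg]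
  rw [lab_inj]; simp

theorem lie_h_e (m n : ℤ) : ⁅h m, e n⁆ = (2 : ℂ) • e (n - m) := by
  simpa [labSign] using lie_h_current (by simp) (isCurrent_e n) (isCurrent_e (n - m))
    (e_vacuum_apply n) (e_vacuum_apply _)

theorem lie_h_f (m n : ℤ) : ⁅h m, f n⁆ = (-2 : ℂ) • f (n - m) := by
  simpa [labSign] using lie_h_current (by simp) (isCurrent_f n) (isCurrent_f (n - m))
    (f_vacuum_apply n) (f_vacuum_apply _)

/-- The source of the central term: two step functions with infinite sums have a finite difference,
which counts the levels between the steps with sign. -/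
theorem finsum_lt_sub_lt (n : ℤ) :
    ∑ᶠ k : ℤ, ((if k < n then (1 : ℂ) else 0) - if k < 0 then 1 else 0) = n := by
  rcases le_total 0 n with hn | hn
  · rw [finsum_eq_sum_of_support_subset (s := Finset.Ico 0 n)]
    · rw [Finset.sum_congr rfl (g := fun _ => (1 : ℂ))]
      · simp
        exact_mod_cast Int.toNat_of_nonneg hn
      · intro k hk
        rw [Finset.mem_Ico] at hk
        rw [if_pos hk.2, if_neg (not_lt.2 hk.1), sub_zero]
    · intro k hk
      rw [Function.mem_support] at hk
      simp only [Finset.coe_Ico, Set.mem_Ico]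
      by_contra hcon
      refine hk ?_
      split_ifs <;> first | omega | simp
  · rw [finsum_eq_sum_of_support_subset (s := Finset.Ico n 0)]
    · rw [Finset.sum_congr rfl (g := fun _ => (-1 : ℂ))]
      · simp
        have : (((-n).toNat : ℤ) : ℂ) = ((-n : ℤ) : ℂ) := by
          rw [Int.toNat_of_nonneg (by omega)]
        push_cast at this
        rw [this]; ring
      · intro k hk
        rw [Finset.mem_Ico] at hk
        rw [if_neg (not_lt.2 hk.1), if_pos hk.2, zero_sub]
    · intro k hk
      rw [Function.mem_support] at hk
      simp only [Finset.coe_Ico, Set.mem_Ico]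
      by_contra hcon
      refine hk ?_
      split_ifs <;> first | omega | simp

/-- Bracketing each bilinear with `h m` leaves two bilinears whose vacuum coefficients are
indicators of filled levels. Only their difference is summable, and for `m = -n` it counts the
levels passed by the shift. -/
theorem lie_labBoson_h_vacuum_apply (s : Bool) (m : ℤ) {n : ℤ} (hn : n ≠ 0) :
    ⁅labBoson s n, h m⁆ vacuum vacuumState = if m = -n then labSign s * n else 0 := by
  have hA : LocallyFiniteFamily
      fun j => wedge (lab s (j + 0)) * contract (lab s (j + n)) :=
    locallyFinite_pair (Or.inr (Ne.symm hn))
  have hfin : (Function.support fun j =>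
      ⁅wedge (lab s (j + 0)) * contract (lab s (j + n)), h m⁆ vacuum).Finite := by
    refine ((hA.finite_support (h m vacuum)).union (hA.finite_support vacuum)).subset fun j hj => ?_
    by_contra hcon
    simp only [Set.mem_union, Function.mem_support, not_or, not_not] at hcon hj
    refine hj ?_
    rw [Ring.lie_def, LinearMap.sub_apply, Module.End.mul_apply, hcon.1,
      Module.End.mul_apply (h m), hcon.2, map_zero, sub_zero]
  rw [labBoson_of_ne s hn, lie_opSum_apply hA]
  refine ((Finsupp.applyAddHom vacuumState).map_finsum hfin).trans ?_
  have hterm : ∀ j, (Finsupp.applyAddHom vacuumState)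
      (⁅wedge (lab s (j + 0)) * contract (lab s (j + n)), h m⁆ vacuum) =
      if m = -n then labSign s * ((if j < -n then (1 : ℂ) else 0) - if j < 0 then 1 else 0) * (-1)
      else 0 := by
    intro j
    have h1 : ⁅wedge (lab s (j + 0)) * contract (lab s (j + n)), h m⁆ =
        -(⁅h m, wedge (lab s j)⁆ * contract (lab s (j + n)) +
          wedge (lab s j) * ⁅h m, contract (lab s (j + n))⁆) := by
      rw [add_zero]
      simp only [Ring.lie_def]; noncomm_ring
    rw [h1, lie_h_wedge, lie_h_contract, mul_neg, smul_mul_assoc, mul_smul_comm]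
    simp only [Finsupp.applyAddHom_apply, LinearMap.neg_apply, LinearMap.add_apply,
      LinearMap.smul_apply, Finsupp.neg_apply, Finsupp.add_apply, Finsupp.smul_apply,
      wedge_contract_vacuum_apply, lab_inj, true_and, smul_eq_mul]
    have hlt : ∀ i, lab s i < 0 ↔ i < 0 := fun i => lab_mem_vacuum
    simp only [hlt]
    by_cases hm : m = -n
    · subst hm
      have : j + n < 0 ↔ j < -n := by omega
      simp only [sub_neg_eq_add, add_neg_cancel_right, this, true_and,
        if_true]
      ring
    · have h2 : ¬ (j - m = j + n) := fun h => hm (by linarith)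
      have h3 : ¬ (j = j + n + m) := fun h => hm (by linarith)
      simp [h2, h3, hm]
  rw [finsum_congr hterm]
  split_ifs
  · rw [← finsum_mul, ← mul_finsum, finsum_lt_sub_lt]
    push_cast
    ring
  · exact finsum_zero

/-- Each of the two kinds of fermions contributes `m`, since its sign in `h` enters twice. The case
`n = 0` is apart because the zero mode is normally ordered. -/
theorem lie_h_h (m n : ℤ) : ⁅h m, h n⁆ = if m = -n then (2 * m : ℂ) • 1 else 0 := by
  by_cases hn : n = 0
  · subst hn
    have h1 : ⁅h m, h 0⁆ = -⁅h 0, h m⁆ := by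
      rw [Ring.lie_def, Ring.lie_def]; noncomm_ring
    rw [h1, lie_h_zero_h]
    split_ifs with hm
    · simp at hm; simp [hm]
    · simp
  · rw [lie_h_h_eq_smul_one]
    have h1 : ⁅h m, h n⁆ = -(⁅labBoson false n, h m⁆ - ⁅labBoson true n, h m⁆) := by
      rw [h_eq n, Ring.lie_def, Ring.lie_def, Ring.lie_def]; noncomm_ring
    rw [h1, LinearMap.neg_apply, LinearMap.sub_apply, Finsupp.neg_apply, Finsupp.sub_apply,
      lie_labBoson_h_vacuum_apply _ _ hn, lie_labBoson_h_vacuum_apply _ _ hn]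
    split_ifs with hm
    · subst hm
      congr 1
      simp [labSign]; ring
    · simp

end FockSL2
end

noncomputable section
namespace FockSL2
attribute [local instance] endRing
open scoped ComplexConjugate

/-! ### The Hermitian form -/

/-- The Hermitian form for which the monomials are orthonormal, antilinear in the first variable. -/
def form (x : Fock) : Fock →ₗ[ℂ] ℂ := Finsupp.linearCombination ℂ fun S => conj (x S)

theorem form_single_right (x : Fock) (S : State) (c : ℂ) :
    form x (Finsupp.single S c) = c * conj (x S) := by
  simp [form]

theorem form_add_left (x x' y : Fock) : form (x + x') y = form x y + form x' y := by
  induction y using Finsupp.induction_linear with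
  | zero => simp
  | add y z hy hz => rw [map_add, map_add, map_add, hy, hz]; ring
  | single S c => simp only [form_single_right, Finsupp.add_apply, map_add]; ring

theorem form_zero_left (y : Fock) : form 0 y = 0 := by
  have := form_add_left 0 0 y
  rw [add_zero] at this
  simpa using this

/-- The form as an additive map of its first variable. -/
def formLeft (y : Fock) : Fock →+ ℂ where
  toFun x := form x y
  map_zero' := form_zero_left y
  map_add' x x' := form_add_left x x' y

theorem form_smul_left (c : ℂ) (x y : Fock) : form (c • x) y = conj c * form x y := by
  induction y using Finsupp.induction_linear with
  | zero => simp
  | add y z hy hz => rw [map_add, map_add, hy, hz]; ring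
  | single S d =>
    simp only [form_single_right, Finsupp.smul_apply, smul_eq_mul, map_mul]; ring

theorem form_single_left (S : State) (c : ℂ) (y : Fock) :
    form (Finsupp.single S c) y = conj c * y S := by
  induction y using Finsupp.induction_linear with
  | zero => simp
  | add y z hy hz => rw [map_add, Finsupp.add_apply, hy, hz]; ring
  | single T d =>
    rw [form_single_right]
    by_cases hST : S = T
    · subst hST; simp [mul_comm]
    · rw [Finsupp.single_eq_of_ne' hST, Finsupp.single_eq_of_ne' (Ne.symm hST)]; simp

theorem conj_form (x y : Fock) : conj (form x y) = form y x := by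
  induction y using Finsupp.induction_linear with
  | zero => simp [form_zero_left]
  | add y z hy hz => rw [map_add, map_add, hy, hz, form_add_left]
  | single S d => rw [form_single_right, form_single_left]; simp

theorem eq_zero_of_form_self {x : Fock} (hx : form x x = 0) : x = 0 := by
  rw [form, Finsupp.linearCombination_apply, Finsupp.sum] at hx
  have h1 : ∑ S ∈ x.support, Complex.normSq (x S) = 0 := by
    have h2 : ((∑ S ∈ x.support, Complex.normSq (x S) : ℝ) : ℂ) = 0 := by
      rw [← hx]
      push_cast
      exact Finset.sum_congr rfl fun S _ => by rw [smul_eq_mul, Complex.mul_conj]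
    exact_mod_cast h2
  rw [Finset.sum_eq_zero_iff_of_nonneg fun S _ => Complex.normSq_nonneg _] at h1
  ext S
  by_cases hS : S ∈ x.support
  · simpa using h1 S hS
  · simpa using hS

theorem conj_wedgeSign (S : State) (a : ℤ) : conj (wedgeSign S a) = wedgeSign S a := by
  simp [wedgeSign]

theorem contract_apply_of_mem {S : State} {a : ℤ} (ha : a ∈ S.occ) (y : Fock) :
    contract a y S = 0 := by
  induction y using Finsupp.induction_linear with
  | zero => simp
  | add y z hy hz => rw [map_add, Finsupp.add_apply, hy, hz, add_zero]
  | single T d =>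
    by_cases haT : a ∈ T.occ
    · rw [contract_of_mem haT, Finsupp.single_eq_of_ne']
      rintro rfl
      simp at ha
    · rw [contract_of_notMem haT]; rfl

theorem form_wedge_left (a : ℤ) (x y : Fock) : form (wedge a x) y = form x (contract a y) := by
  induction x using Finsupp.induction_linear with
  | zero => simp [form_zero_left]
  | add x z hx hz => rw [map_add, form_add_left, form_add_left, hx, hz]
  | single S c =>
    rw [form_single_left]
    by_cases ha : a ∈ S.occ
    · rw [wedge_of_mem ha, contract_apply_of_mem ha, form_zero_left, mul_zero]
    · have h1 := contract_apply_erase (S := S.insert a) (a := a) (by simp) y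
      rw [State.erase_insert ha, wedgeSign_insert ha, if_neg (lt_irrefl _)] at h1
      rw [wedge_of_notMem ha, form_single_left, h1, map_mul, conj_wedgeSign]; ring

theorem form_contract_left (a : ℤ) (x y : Fock) : form (contract a x) y = form x (wedge a y) := by
  rw [← conj_form, ← form_wedge_left, conj_form]

/-- The term `j` is adjoint to the term `j + n` of the opposite mode. -/
theorem form_labBoson_left (s : Bool) {n : ℤ} (hn : n ≠ 0) (x y : Fock) :
    form (labBoson s n x) y = form x (labBoson s (-n) y) := by
  have hA : LocallyFiniteFamily fun j => wedge (lab s (j + 0)) * contract (lab s (j + n)) :=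
    locallyFinite_pair (Or.inr (Ne.symm hn))
  have hB : LocallyFiniteFamily fun j => wedge (lab s (j + 0)) * contract (lab s (j + -n)) :=
    locallyFinite_pair (Or.inr (by simpa using hn))
  rw [labBoson_of_ne s hn, labBoson_of_ne s (neg_ne_zero.2 hn), opSum_apply hA, opSum_apply hB]
  refine ((formLeft y).map_finsum (hA.finite_support x)).trans ?_
  refine Eq.trans ?_ ((form x).toAddMonoidHom.map_finsum (hB.finite_support y)).symm
  refine finsum_eq_of_bijective _ (Equiv.addRight n).bijective fun j => ?_
  simp only [formLeft, AddMonoidHom.coe_mk, ZeroHom.coe_mk, Module.End.mul_apply,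
    LinearMap.toAddMonoidHom_coe, Equiv.coe_addRight, add_zero, form_wedge_left,
    form_contract_left, add_neg_cancel_right]

theorem form_h_left {n : ℤ} (hn : n ≠ 0) (x y : Fock) : form (h n x) y = form x (h (-n) y) := by
  rw [h_eq, h_eq, LinearMap.sub_apply, LinearMap.sub_apply, map_sub, sub_eq_add_neg,
    form_add_left, ← form_labBoson_left _ hn, ← form_labBoson_left _ hn, ← neg_one_smul ℂ,
    form_smul_left]
  simp [sub_eq_add_neg]

/-! ### Polynomials in the creation operators -/

theorem h_neg_mul_comm : ∀ a ∈ Set.range fun i : ℕ => h (-((i : ℤ) + 1)),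
    ∀ b ∈ Set.range fun i : ℕ => h (-((i : ℤ) + 1)), a * b = b * a := by
  rintro _ ⟨i, rfl⟩ _ ⟨j, rfl⟩
  have := lie_h_h (-((i : ℤ) + 1)) (-((j : ℤ) + 1))
  rw [if_neg (by omega), Ring.lie_def, sub_eq_zero] at this
  exact this

/-- The action of polynomials by `X i ↦ h_{-(i+1)}`. -/
def polyAct : MvPolynomial ℕ ℂ →ₐ[ℂ] Module.End ℂ Fock :=
  -- `aeval` needs a commutative target, so the evaluation takes place in the subalgebra generated
  -- by the creation operators, which commute.
  letI : CommSemiring (Algebra.adjoin ℂ (Set.range fun i : ℕ => h (-((i : ℤ) + 1)))) :=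
    { (inferInstance : Semiring (Algebra.adjoin ℂ (Set.range fun i : ℕ => h (-((i : ℤ) + 1))))) with
      mul_comm := (Algebra.isMulCommutative_adjoin ℂ h_neg_mul_comm).is_comm.comm }
  (Algebra.adjoin ℂ (Set.range fun i : ℕ => h (-((i : ℤ) + 1)))).val.comp
    (MvPolynomial.aeval fun i : ℕ => ⟨h (-((i : ℤ) + 1)), Algebra.subset_adjoin ⟨i, rfl⟩⟩)

@[simp] theorem polyAct_X (i : ℕ) : polyAct (MvPolynomial.X i) = h (-((i : ℤ) + 1)) := by
  simp [polyAct]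

theorem polyAct_C (c : ℂ) : polyAct (MvPolynomial.C c) = c • 1 := by
  rw [← MvPolynomial.algebraMap_eq, AlgHom.commutes, Algebra.algebraMap_eq_smul_one]

open MvPolynomial in
-- Bracketing with `h (i + 1)` is a derivation that sends the generator number `i` to the scalar `2
-- (i + 1)` and kills all others.
theorem lie_h_polyAct (i : ℕ) (g : MvPolynomial ℕ ℂ) :
    ⁅h ((i : ℤ) + 1), polyAct g⁆ = (2 * ((i : ℂ) + 1)) • polyAct (pderiv i g) := by
  induction g using MvPolynomial.induction_on with
  | C a => rw [polyAct_C, lie_smul_one]; simp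
  | add p q hp hq =>
    have h1 : ⁅h ((i : ℤ) + 1), polyAct p + polyAct q⁆ =
        ⁅h ((i : ℤ) + 1), polyAct p⁆ + ⁅h ((i : ℤ) + 1), polyAct q⁆ := by
      simp only [Ring.lie_def]; noncomm_ring
    rw [map_add, map_add, h1, hp, hq, map_add, smul_add]
  | mul_X p j hp =>
    have h1 : ⁅h ((i : ℤ) + 1), polyAct p * polyAct (X j)⁆ =
        ⁅h ((i : ℤ) + 1), polyAct p⁆ * polyAct (X j) +
          polyAct p * ⁅h ((i : ℤ) + 1), polyAct (X j)⁆ := by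
      simp only [Ring.lie_def]; noncomm_ring
    rw [map_mul, h1, hp, Derivation.leibniz, polyAct_X, lie_h_h, pderiv_X, smul_eq_mul,
      smul_eq_mul, map_add, map_mul, map_mul, polyAct_X]
    have hc : polyAct (pderiv i p) * h (-((j : ℤ) + 1)) =
        h (-((j : ℤ) + 1)) * polyAct (pderiv i p) := by
      rw [← polyAct_X, ← map_mul, ← map_mul, mul_comm]
    rw [smul_mul_assoc, hc]
    by_cases hij : j = i
    · subst hij
      rw [if_pos (neg_neg _).symm, Pi.single_eq_same, map_one, mul_one, smul_add, add_comm,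
        mul_smul_comm, mul_one]
      push_cast
      rfl
    · rw [if_neg (by omega), Pi.single_eq_of_ne hij]
      simp

/-! ### Complete homogeneous polynomials in the power sums -/

open MvPolynomial in
/-- The complete homogeneous symmetric function as a polynomial in the power sums
`p_{i+1} = X i`. -/
def hpoly : ℕ → MvPolynomial ℕ ℂ
  | 0 => 1
  | n + 1 => C (1 / ((n : ℂ) + 1)) * ∑ i : Fin (n + 1), X (i : ℕ) * hpoly (n - i)
termination_by n => n
decreasing_by omega

/-- `hpoly` continued by zero to negative degrees. -/
def hpolyInt (n : ℤ) : MvPolynomial ℕ ℂ := if 0 ≤ n then hpoly n.toNat else 0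

theorem hpolyInt_of_neg {n : ℤ} (hn : n < 0) : hpolyInt n = 0 := if_neg (not_le.2 hn)

@[simp] theorem hpolyInt_natCast (n : ℕ) : hpolyInt n = hpoly n := by simp [hpolyInt]

@[simp] theorem hpolyInt_zero : hpolyInt 0 = 1 := by simp [hpolyInt, hpoly]

open MvPolynomial in
-- Newton's recursion. As the terms of negative degree vanish, `N` is free, and recursions of
-- different degrees can be summed over one common range.
theorem smul_hpolyInt (n : ℤ) (N : ℕ) (hN : n ≤ N) :
    (n : ℂ) • hpolyInt n = ∑ i ∈ Finset.range N, X i * hpolyInt (n - 1 - i) := by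
  have hzero : ∀ i : ℕ, n - 1 - i < 0 → (X i : MvPolynomial ℕ ℂ) * hpolyInt (n - 1 - i) = 0 :=
    fun i hi => by rw [hpolyInt_of_neg hi, mul_zero]
  rcases le_or_gt n 0 with hn | hn
  · rw [Finset.sum_eq_zero fun i _ => hzero i (by omega)]
    rcases hn.eq_or_lt with rfl | hn
    · simp
    · rw [hpolyInt_of_neg hn, smul_zero]
  · obtain ⟨m, rfl⟩ : ∃ m : ℕ, n = (m : ℤ) + 1 := ⟨(n - 1).toNat, by omega⟩
    have hsub : Finset.range (m + 1) ⊆ Finset.range N := by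
      intro i hi
      simp only [Finset.mem_range] at hi ⊢
      omega
    rw [← Finset.sum_subset hsub fun i _ hi => hzero i (by
      simp only [Finset.mem_range] at hi; omega)]
    have h1 : ((m : ℤ) + 1) = ((m + 1 : ℕ) : ℤ) := by push_cast; ring
    have h2 : ∑ i ∈ Finset.range (m + 1), (X i : MvPolynomial ℕ ℂ) *
        hpolyInt ((m : ℤ) + 1 - 1 - i) = ∑ i : Fin (m + 1), X (i : ℕ) * hpoly (m - i) := by
      rw [← Fin.sum_univ_eq_sum_range (fun i : ℕ => (X i : MvPolynomial ℕ ℂ) *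
        hpolyInt ((m : ℤ) + 1 - 1 - i))]
      refine Finset.sum_congr rfl fun i _ => ?_
      have : (m : ℤ) + 1 - 1 - (i : ℕ) = ((m - i : ℕ) : ℤ) := by
        have := i.2
        omega
      rw [this, hpolyInt_natCast]
    have hm : ((m : ℂ) + 1) ≠ 0 := by exact_mod_cast Nat.succ_ne_zero m
    rw [h2, h1, hpolyInt_natCast, hpoly, ← smul_eq_C_mul, smul_smul]
    push_cast
    rw [mul_one_div_cancel hm, one_smul]

open MvPolynomial in
-- In the generating series `exp (∑ p_r t^r / r)` the derivative in `p_{i+1}` is multiplication by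
-- `t^{i+1} / (i+1)`. Here this is derived from Newton's recursion.
theorem pderiv_hpolyInt (i : ℕ) (n : ℤ) :
    ((i : ℂ) + 1) • pderiv i (hpolyInt n) = hpolyInt (n - (i + 1)) := by
  have hneg : ∀ n : ℤ, n ≤ 0 → ((i : ℂ) + 1) • pderiv i (hpolyInt n) = hpolyInt (n - (i + 1)) := by
    intro n hn
    rw [hpolyInt_of_neg (by omega : n - (i + 1) < 0)]
    rcases hn.eq_or_lt with rfl | hn
    · simp
    · rw [hpolyInt_of_neg hn]; simp
  rcases le_or_gt n 0 with hn | hn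
  · exact hneg n hn
  obtain ⟨m, rfl⟩ : ∃ m : ℕ, n = m := ⟨n.toNat, by omega⟩
  induction m using Nat.strong_induction_on with
  | _ m ih =>
    have ih' : ∀ r : ℕ, ((i : ℂ) + 1) • pderiv i (hpolyInt ((m : ℤ) - 1 - r)) =
        hpolyInt ((m : ℤ) - 1 - r - (i + 1)) := by
      intro r
      rcases le_or_gt ((m : ℤ) - 1 - r) 0 with h0 | h0
      · exact hneg _ h0
      · have := ih (m - 1 - r) (by omega) (by omega)
        rwa [show (((m - 1 - r : ℕ)) : ℤ) = (m : ℤ) - 1 - r by omega] at this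
    have hm : ((m : ℤ) : ℂ) ≠ 0 := by exact_mod_cast hn.ne'
    refine smul_right_injective _ hm ?_
    change ((m : ℤ) : ℂ) • ((i : ℂ) + 1) • pderiv i (hpolyInt (m : ℤ)) =
      ((m : ℤ) : ℂ) • hpolyInt ((m : ℤ) - (i + 1))
    rw [smul_comm, ← Derivation.map_smul, smul_hpolyInt (m : ℤ) (m + i + 1) (by omega), map_sum,
      Finset.smul_sum]
    -- Differentiating the second factors reproduces the recursion in degree `m - (i + 1)`. The one
    -- term in which `X i` itself is differentiated supplies the missing `i + 1` copies, for a total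
    -- of `m`.
    have h1 : ∀ r ∈ Finset.range (m + i + 1), ((i : ℂ) + 1) •
        pderiv i ((X r : MvPolynomial ℕ ℂ) * hpolyInt ((m : ℤ) - 1 - r)) =
        X r * hpolyInt ((m : ℤ) - (i + 1) - 1 - r) +
          if r = i then ((i : ℂ) + 1) • hpolyInt ((m : ℤ) - (i + 1)) else 0 := by
      intro r _
      rw [Derivation.leibniz, smul_add, smul_eq_mul, smul_eq_mul, ← mul_smul_comm, ih', pderiv_X]
      rw [show (m : ℤ) - 1 - r - (i + 1) = (m : ℤ) - (i + 1) - 1 - r by ring]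
      congr 1
      by_cases hr : r = i
      · subst hr
        simp [show (m : ℤ) - 1 - r = (m : ℤ) - (r + 1) by ring]
      · simp [hr]
    rw [Finset.sum_congr rfl h1, Finset.sum_add_distrib,
      ← smul_hpolyInt ((m : ℤ) - (i + 1)) (m + i + 1) (by omega), Finset.sum_ite_eq' ,
      if_pos (by simp), ← add_smul]
    push_cast
    congr 1
    ring

end FockSL2
end

noncomputable section
namespace FockSL2
attribute [local instance] endRing
open scoped ComplexConjugate

/-! ### Vectors obtained from a highest weight vector by one current -/

open MvPolynomial in
/-- The substitution `p_n ↦ δ p_n` in the complete homogeneous polynomials. -/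
def hpolyScaled (δ : ℂ) (n : ℤ) : MvPolynomial ℕ ℂ := aeval (fun i => δ • X i) (hpolyInt n)

theorem hpolyScaled_one (n : ℤ) : hpolyScaled 1 n = hpolyInt n := by
  simp [hpolyScaled]

open MvPolynomial in
theorem smul_hpolyScaled (δ : ℂ) (n : ℕ) : (n : ℂ) • hpolyScaled δ n =
    ∑ i ∈ Finset.range n, δ • (X i * hpolyScaled δ ((n : ℤ) - 1 - i)) := by
  have h1 := congrArg (aeval (R := ℂ) fun i => δ • (X i : MvPolynomial ℕ ℂ))
    (smul_hpolyInt (n : ℤ) n le_rfl)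
  rw [map_smul, map_sum] at h1
  push_cast at h1
  rw [hpolyScaled, h1]
  refine Finset.sum_congr rfl fun i _ => ?_
  rw [map_mul, aeval_X, smul_mul_assoc, hpolyScaled]

open MvPolynomial in
theorem pderiv_aeval_smul (δ : ℂ) (i : ℕ) (g : MvPolynomial ℕ ℂ) :
    pderiv i (aeval (fun i => δ • (X i : MvPolynomial ℕ ℂ)) g) =
      δ • aeval (fun i => δ • (X i : MvPolynomial ℕ ℂ)) (pderiv i g) := by
  induction g using MvPolynomial.induction_on with
  | C a => simp
  | add p q hp hq => rw [map_add, map_add, map_add, map_add, hp, hq, smul_add]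
  | mul_X p j hp =>
    rw [map_mul, Derivation.leibniz, Derivation.leibniz, hp, aeval_X, Derivation.map_smul,
      pderiv_X, smul_eq_mul, smul_eq_mul, smul_eq_mul, smul_eq_mul, map_add, map_mul, map_mul,
      aeval_X, smul_add]
    congr 1
    · by_cases hij : j = i
      · subst hij; simp
      · simp [Pi.single_eq_of_ne hij]
    · rw [mul_smul_comm]

theorem h_polyAct_apply {y : Fock} (hy : ∀ r : ℤ, 0 < r → h r y = 0) (i : ℕ)
    (g : MvPolynomial ℕ ℂ) : h ((i : ℤ) + 1) (polyAct g y) =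
      (2 * ((i : ℂ) + 1)) • polyAct (MvPolynomial.pderiv i g) y := by
  have h1 := congrArg (fun T : Module.End ℂ Fock => T y) (lie_h_polyAct i g)
  simp only [Ring.lie_def, LinearMap.sub_apply, Module.End.mul_apply, LinearMap.smul_apply] at h1
  rwa [hy _ (by omega), map_zero, sub_zero] at h1

theorem h_hpolyScaled_apply {y : Fock} (hy : ∀ r : ℤ, 0 < r → h r y = 0) (δ : ℂ) (i : ℕ)
    (n : ℤ) : h ((i : ℤ) + 1) (polyAct (hpolyScaled δ n) y) =
      (2 * δ) • polyAct (hpolyScaled δ (n - (i + 1))) y := by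
  rw [h_polyAct_apply hy, hpolyScaled, pderiv_aeval_smul, hpolyScaled, ← pderiv_hpolyInt i n,
    map_smul, map_smul, map_smul, LinearMap.smul_apply, LinearMap.smul_apply, smul_smul, smul_smul]
  congr 1
  ring

/-- Newton's recursion and adjointness reduce the pairing to pairings with the `h (i + 1) z`, `i <
n`; in particular a `z` killed by `h 1, …, h n` pairs to zero when `n > 0`. -/
theorem smul_form_hpolyScaled {δ : ℂ} (hδ : conj δ = δ) (n : ℕ) (y z : Fock) :
    (n : ℂ) * form (polyAct (hpolyScaled δ n) y) z = ∑ i ∈ Finset.range n,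
      δ * form (polyAct (hpolyScaled δ ((n : ℤ) - 1 - i)) y) (h ((i : ℤ) + 1) z) := by
  have h1 : (n : ℂ) * form (polyAct (hpolyScaled δ n) y) z =
      form (polyAct ((n : ℂ) • hpolyScaled δ n) y) z := by
    rw [map_smul, LinearMap.smul_apply, form_smul_left]; simp
  rw [h1, smul_hpolyScaled, map_sum, LinearMap.sum_apply]
  refine (map_sum (formLeft z) _ _).trans (Finset.sum_congr rfl fun i _ => ?_)
  change form _ z = _
  rw [map_smul, map_mul, polyAct_X, LinearMap.smul_apply, Module.End.mul_apply, form_smul_left, hδ,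
    form_h_left (by omega), neg_neg]

/-- `n` times the norm is twice the sum of the preceding norms, and `2 (1 + ⋯ + n) = n (n + 1)`. -/
theorem form_hpolyScaled_self {δ : ℂ} (hδ : conj δ = δ) (hδ2 : δ * δ = 1) {y : Fock}
    (hy : ∀ r : ℤ, 0 < r → h r y = 0) (n : ℕ) :
    form (polyAct (hpolyScaled δ n) y) (polyAct (hpolyScaled δ n) y) = (n + 1) * form y y := by
  induction n using Nat.strong_induction_on with
  | _ n ih =>
    rcases Nat.eq_zero_or_pos n with rfl | hn
    · simp [hpolyScaled]
    · have hn0 : (n : ℂ) ≠ 0 := by exact_mod_cast hn.ne'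
      refine mul_left_cancel₀ hn0 ?_
      rw [smul_form_hpolyScaled hδ]
      have h1 : ∀ i ∈ Finset.range n, δ * form (polyAct (hpolyScaled δ ((n : ℤ) - 1 - i)) y)
          (h ((i : ℤ) + 1) (polyAct (hpolyScaled δ n) y)) =
          2 * (((n - 1 - i : ℕ) : ℂ) + 1) * form y y := by
        intro i hi
        rw [Finset.mem_range] at hi
        rw [h_hpolyScaled_apply hy, show (n : ℤ) - (i + 1) = ((n - 1 - i : ℕ) : ℤ) by omega,
          show (n : ℤ) - 1 - i = ((n - 1 - i : ℕ) : ℤ) by omega, map_smul, ih _ (by omega),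
          smul_eq_mul]
        linear_combination 2 * (((n - 1 - i : ℕ) : ℂ) + 1) * form y y * hδ2
      rw [Finset.sum_congr rfl h1, ← Finset.sum_mul,
        Finset.sum_range_reflect (fun i => 2 * ((i : ℂ) + 1)) n, ← mul_assoc]
      congr 1
      clear h1 ih hn hn0
      induction n with
      | zero => simp
      | succ n ih => rw [Finset.sum_range_succ, ih]; push_cast; ring

/-- A sequence of vectors with the lowering relations and the norms of
`polyAct (hpolyScaled δ n) y` is that sequence. -/
theorem eq_polyAct_hpolyScaled {δ : ℂ} (hδ : conj δ = δ) (hδ2 : δ * δ = 1) {y : Fock}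
    (hy : ∀ r : ℤ, 0 < r → h r y = 0) {x : ℤ → Fock} {ε : ℂ} (hε : ε * conj ε = 1)
    (hx0 : x 0 = ε • y)
    (hx : ∀ (i : ℕ) (n : ℤ), h ((i : ℤ) + 1) (x n) = (2 * δ) • x (n - (i + 1)))
    (hnorm : ∀ n : ℕ, form (x n) (x n) = (n + 1) * form y y) (n : ℕ) :
    x n = ε • polyAct (hpolyScaled δ n) y := by
  induction n using Nat.strong_induction_on with
  | _ n ih =>
    rcases Nat.eq_zero_or_pos n with rfl | hn
    · simpa [hpolyScaled] using hx0
    · set H := polyAct (hpolyScaled δ n) y with hH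
      have hD : ∀ i ∈ Finset.range n, h ((i : ℤ) + 1) (x n - ε • H) = 0 := by
        intro i hi
        rw [Finset.mem_range] at hi
        rw [map_sub, hx, map_smul, hH, h_hpolyScaled_apply hy,
          show (n : ℤ) - (i + 1) = ((n - 1 - i : ℕ) : ℤ) by omega, ih _ (by omega), smul_comm,
          sub_self]
      -- By induction the difference is killed by `h 1, …, h n`, hence orthogonal to `H`.
      have horth : form H (x n - ε • H) = 0 := by
        have hn0 : (n : ℂ) ≠ 0 := by exact_mod_cast hn.ne'
        refine mul_left_cancel₀ hn0 ?_
        rw [hH, smul_form_hpolyScaled hδ, mul_zero]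
        exact Finset.sum_eq_zero fun i hi => by rw [hD i hi, map_zero, mul_zero]
      have horth' : form (x n - ε • H) H = 0 := by rw [← conj_form, horth, map_zero]
      have hHH : form H H = (n + 1) * form y y := form_hpolyScaled_self hδ hδ2 hy n
      -- Pythagoras: as `x n` and `H` have equal norms, the difference has norm zero.
      have hexp : form (x n) (x n) = form (x n - ε • H) (x n - ε • H) + form H H := by
        conv_lhs => rw [← sub_add_cancel (x n) (ε • H)]
        rw [form_add_left, map_add, map_add, form_smul_left, form_smul_left, horth, map_smul,
          map_smul, horth']
        linear_combination form H H * hε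
      rw [hnorm, hHH] at hexp
      have := eq_zero_of_form_self (x := x n - ε • H) (by linear_combination -hexp)
      exact sub_eq_zero.1 this

/-! ### Level states and the action of the currents on them -/

/-- The monomial in which the level `i` with label `s` is filled if and only if `i < b s`. -/
def levelState (b : Bool → ℤ) : State where
  occ := {a | ∃ s i, a = lab s i ∧ i < b s}
  below := by
    refine ⟨2 * min (b true) (b false), fun a ha => ?_⟩
    obtain ⟨s, i, rfl⟩ := exists_lab a
    have := le_lab s i
    refine ⟨s, i, rfl, ?_⟩
    cases s <;> omega
  above := by
    refine ⟨2 * max (b true) (b false), fun a ha => ?_⟩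
    rintro ⟨s, i, rfl, hi⟩
    have := lab_le s i
    cases s <;> omega

@[simp] theorem lab_mem_levelState {b : Bool → ℤ} {s : Bool} {i : ℤ} :
    lab s i ∈ (levelState b).occ ↔ i < b s := by
  constructor
  · rintro ⟨t, j, h1, h2⟩
    obtain ⟨rfl, rfl⟩ := lab_inj.1 h1
    exact h2
  · exact fun hi => ⟨s, i, rfl, hi⟩

theorem levelState_zero : levelState (fun _ => 0) = vacuumState := by
  apply State.eq_of_occ_eq
  ext a
  obtain ⟨s, i, rfl⟩ := exists_lab a
  rw [lab_mem_levelState, lab_mem_vacuum]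

/-- The vector of a level state. -/
def levelVec (b : Bool → ℤ) : Fock := Finsupp.single (levelState b) 1

theorem form_levelVec_self (b : Bool → ℤ) : form (levelVec b) (levelVec b) = 1 := by
  simp [levelVec, form_single_left]

/-- For `r > 0` each term moves a factor `r` levels down within its label, where every level is
already filled. -/
theorem h_levelVec {r : ℤ} (hr : 0 < r) (b : Bool → ℤ) : h r (levelVec b) = 0 := by
  have h1 : ∀ s, labBoson s r (levelVec b) = 0 := by
    intro s
    rw [labBoson_of_ne s hr.ne', opSum_apply (locallyFinite_pair (Or.inr hr.ne)),
      finsum_eq_zero_of_forall_eq_zero]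
    intro j
    rw [Module.End.mul_apply, levelVec]
    by_cases hj : lab s (j + r) ∈ (levelState b).occ
    · rw [contract_of_mem hj, wedge_of_mem]
      rw [lab_mem_levelState] at hj
      rw [State.mem_erase, lab_mem_levelState, Ne, lab_inj]
      constructor
      · omega
      · rintro ⟨-, h2⟩
        omega
    · rw [contract_of_notMem hj, map_zero]
  rw [h_eq, LinearMap.sub_apply, h1, h1, sub_zero]

/-- The current `∑_j w_{t, j + n} w_{s, j}^*`. -/
def current (t s : Bool) (n : ℤ) : Module.End ℂ Fock :=
  opSum fun j => wedge (lab t (j + n)) * contract (lab s (j + 0))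

theorem e_eq_current (n : ℤ) : e n = current false true n := e_eq n

theorem f_eq_current (n : ℤ) : f n = current true false n := f_eq n

theorem lie_h_current' {t s : Bool} (hts : t ≠ s) (m n : ℤ) :
    ⁅h m, current t s n⁆ = (2 * labSign t) • current t s (n - m) := by
  cases t <;> cases s
  · exact absurd rfl hts
  · rw [← e_eq_current, ← e_eq_current, lie_h_e]; simp [labSign]
  · rw [← f_eq_current, ← f_eq_current, lie_h_f]; simp [labSign]
  · exact absurd rfl hts

/-- The monomial `levelState b` with the level `j` moved to the level `j + n` of the other label. -/
def movedState (b : Bool → ℤ) (t s : Bool) (n j : ℤ) : State :=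
  ((levelState b).erase (lab s j)).insert (lab t (j + n))

/-- The sign of the move to `movedState`. -/
def movedSign (b : Bool → ℤ) (t s : Bool) (n j : ℤ) : ℂ :=
  wedgeSign (levelState b) (lab s j) *
    wedgeSign ((levelState b).erase (lab s j)) (lab t (j + n))

theorem movedSign_mul_conj (b : Bool → ℤ) (t s : Bool) (n j : ℤ) :
    movedSign b t s n j * conj (movedSign b t s n j) = 1 := by
  rw [movedSign, map_mul, conj_wedgeSign, conj_wedgeSign, mul_mul_mul_comm, wedgeSign_mul_self,
    wedgeSign_mul_self, one_mul]

theorem current_levelVec {t s : Bool} (hts : t ≠ s) (b : Bool → ℤ) (n : ℤ) :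
    current t s n (levelVec b) = ∑ j ∈ Finset.Ico (b t - n) (b s),
      Finsupp.single (movedState b t s n j) (movedSign b t s n j) := by
  rw [current, opSum_apply (locallyFinite_pair (Or.inl hts)),
    finsum_eq_sum_of_support_subset (s := Finset.Ico (b t - n) (b s))]
  · refine Finset.sum_congr rfl fun j hj => ?_
    rw [Finset.mem_Ico] at hj
    rw [add_zero, Module.End.mul_apply, levelVec, contract_of_mem (by simp [hj.2]),
      wedge_of_notMem, one_mul]
    · rfl
    · rw [State.mem_erase, lab_mem_levelState]
      omega
  · intro j hj
    rw [Function.mem_support, add_zero, Module.End.mul_apply, levelVec] at hj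
    simp only [Finset.coe_Ico, Set.mem_Ico]
    have h1 : j < b s := by
      by_contra hcon
      exact hj (by rw [contract_of_notMem (by simpa using hcon), map_zero])
    refine ⟨?_, h1⟩
    by_contra hcon
    refine hj ?_
    rw [contract_of_mem (by simpa using h1), wedge_of_mem]
    rw [State.mem_erase, lab_mem_levelState, Ne, lab_inj]
    exact ⟨by omega, fun h => hts h.1⟩

/-- The moves produce pairwise distinct monomials with coefficients `±1`, so the norm is the number
of possible moves. -/
theorem form_current_levelVec_self {t s : Bool} (hts : t ≠ s) (b : Bool → ℤ) (n : ℤ) :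
    form (current t s n (levelVec b)) (current t s n (levelVec b)) =
      ((b s - (b t - n)).toNat : ℂ) := by
  rw [current_levelVec hts, map_sum]
  rw [Finset.sum_congr rfl (g := fun _ => (1 : ℂ))]
  · simp
  · intro j hj
    rw [form_single_right, Finsupp.finsetSum_apply, Finset.sum_eq_single j]
    · rw [Finsupp.single_eq_same, movedSign_mul_conj]
    · intro i hi hij
      rw [Finsupp.single_eq_of_ne']
      intro hcon
      have hmem : lab s j ∈ (movedState b t s n i).occ := by
        rw [movedState, State.mem_insert, State.mem_erase, lab_mem_levelState, Ne, lab_inj,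
          lab_inj]
        rw [Finset.mem_Ico] at hj
        exact Or.inr ⟨hj.2, fun h => hij h.2.symm⟩
      rw [hcon, movedState, State.mem_insert, State.mem_erase, lab_inj] at hmem
      rcases hmem with hmem | hmem
      · exact hts hmem.1.symm
      · exact hmem.2 rfl
    · exact fun h => absurd hj h

/-- In the lowest mode that acts nontrivially there is a single move: the topmost filled level of
`s` goes to the lowest empty level of `t`, and the result is again a level state. -/
theorem movedState_top {t s : Bool} (hts : t ≠ s) {b b' : Bool → ℤ} (hs : b' s = b s - 1)
    (ht : b' t = b t + 1) : movedState b t s (b t - b s + 1) (b s - 1) = levelState b' := by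
  apply State.eq_of_occ_eq
  ext a
  obtain ⟨r, i, rfl⟩ := exists_lab a
  rw [movedState, State.mem_insert, State.mem_erase, lab_mem_levelState, lab_mem_levelState, Ne,
    lab_inj, lab_inj]
  by_cases hr : r = s
  · subst hr
    have : ¬ r = t := Ne.symm hts
    simp only [this, false_and, false_or, true_and]
    omega
  · have hr' : r = t := by cases r <;> cases s <;> cases t <;> simp_all
    subst hr'
    simp only [hr, false_and, not_false_eq_true, and_true, true_and]
    omega

/-- This is where fermions meet bosons: the `n + 1` possible moves match the norm `n + 1` on the
polynomial side, and the commutator with `h` gives the same lowering relations. The sign is that of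
the single move for `n = 0`. -/
theorem current_levelVec_eq {t s : Bool} (hts : t ≠ s) {b b' : Bool → ℤ} (hs : b' s = b s - 1)
    (ht : b' t = b t + 1) (n : ℕ) : current t s (b t - b s + 1 + n) (levelVec b) =
      movedSign b t s (b t - b s + 1) (b s - 1) •
        polyAct (hpolyScaled (labSign t) n) (levelVec b') := by
  refine eq_polyAct_hpolyScaled (x := fun n => current t s (b t - b s + 1 + n) (levelVec b))
    (y := levelVec b') ?_ (labSign_mul_self t) (fun r hr => h_levelVec hr b')
    (movedSign_mul_conj _ _ _ _ _) ?_ ?_ ?_ n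
  · cases t <;> simp [labSign]
  · have : Finset.Ico (b t - (b t - b s + 1)) (b s) = {b s - 1} := by
      ext i
      simp only [Finset.mem_Ico, Finset.mem_singleton]
      omega
    simp only [add_zero]
    rw [current_levelVec hts, this, Finset.sum_singleton, movedState_top hts hs ht, levelVec,
      Finsupp.smul_single, smul_eq_mul, mul_one]
  · intro i n
    have h1 := congrArg (fun T : Module.End ℂ Fock => T (levelVec b))
      (lie_h_current' hts ((i : ℤ) + 1) (b t - b s + 1 + n))
    simp only [Ring.lie_def, LinearMap.sub_apply, Module.End.mul_apply, LinearMap.smul_apply] at h1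
    rw [h_levelVec (by omega), map_zero, sub_zero] at h1
    rw [h1, show b t - b s + 1 + n - (i + 1) = b t - b s + 1 + (n - (i + 1)) by ring]
  · intro n
    rw [form_current_levelVec_self hts, form_levelVec_self]
    have : (b s - (b t - (b t - b s + 1 + (n : ℤ)))).toNat = n + 1 := by omega
    rw [this]
    push_cast
    ring

theorem current_levelVec_eq_zero {t s : Bool} (hts : t ≠ s) {b : Bool → ℤ} {n : ℤ}
    (hn : n < b t - b s + 1) : current t s n (levelVec b) = 0 := by
  rw [current_levelVec hts, Finset.Ico_eq_empty (by omega), Finset.sum_empty]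

theorem current_levelVec_mem {t s : Bool} (hts : t ≠ s) {b b' : Bool → ℤ} (hs : b' s = b s - 1)
    (ht : b' t = b t + 1) (n : ℤ) :
    ∃ g, current t s n (levelVec b) = polyAct g (levelVec b') := by
  rcases lt_or_ge n (b t - b s + 1) with hn | hn
  · exact ⟨0, by rw [current_levelVec_eq_zero hts hn]; simp⟩
  · obtain ⟨m, rfl⟩ : ∃ m : ℕ, n = b t - b s + 1 + m := ⟨(n - (b t - b s + 1)).toNat, by omega⟩
    exact ⟨movedSign b t s (b t - b s + 1) (b s - 1) • hpolyScaled (labSign t) m, by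
      rw [current_levelVec_eq hts hs ht, map_smul, LinearMap.smul_apply]⟩

end FockSL2
end

noncomputable section
namespace FockSL2
attribute [local instance] endRing
open scoped ComplexConjugate

/-! ### The charge zero part of the basic module -/

/-- Eigenspaces for distinct eigenvalues are independent, so the component of `x` outside `W i`,
being itself a `c i`-eigenvector, is zero. -/
theorem mem_of_mem_iSup_of_eigenvector {M ι : Type*} [AddCommGroup M] [Module ℂ M]
    {T : Module.End ℂ M} {W : ι → Submodule ℂ M} {c : ι → ℂ} (hc : Function.Injective c)
    (hW : ∀ i, ∀ x ∈ W i, T x = c i • x) {i : ι} {x : M} (hx : x ∈ ⨆ j, W j)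
    (hTx : T x = c i • x) : x ∈ W i := by
  have hind := (Module.End.eigenspaces_iSupIndep T).comp hc
  have hle : ∀ j, W j ≤ T.eigenspace (c j) := fun j y hy =>
    Module.End.mem_eigenspace_iff.2 (hW j y hy)
  have hsup : (⨆ j, W j) ≤ W i ⊔ ⨆ j, ⨆ (_ : j ≠ i), W j := by
    refine iSup_le fun j => ?_
    by_cases hj : j = i
    · subst hj
      exact le_sup_left
    · exact le_sup_of_le_right (le_iSup₂_of_le j hj le_rfl)
  obtain ⟨a, ha, b, hb, rfl⟩ := Submodule.mem_sup.1 (hsup hx)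
  have hb1 : b ∈ T.eigenspace (c i) := by
    rw [Module.End.mem_eigenspace_iff]
    rw [map_add, hW i a ha, smul_add] at hTx
    exact add_left_cancel hTx
  have hb2 : b ∈ ⨆ j, ⨆ (_ : j ≠ i), T.eigenspace (c j) :=
    iSup₂_mono (fun j _ => hle j) hb
  have hb0 : b = 0 := by
    have := (Submodule.disjoint_def.1 (hind i)) b hb1 hb2
    exact this
  rw [hb0, add_zero]
  exact ha

/-- The highest levels of the extremal vectors `Ω_{-2m}`. -/
def extremalLevel (m : ℤ) (s : Bool) : ℤ := if s then m else -m

/-- The extremal vector `Ω_{-2m}`, up to its sign. -/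
def extremalVec (m : ℤ) : Fock := levelVec (extremalLevel m)

theorem extremalVec_zero : extremalVec 0 = vacuum := by
  have : extremalLevel 0 = fun _ => 0 := by
    funext s
    simp [extremalLevel]
  rw [extremalVec, levelVec, this, levelState_zero, vacuum]

theorem h_vacuum {r : ℤ} (hr : 0 < r) : h r vacuum = 0 := by
  rw [← extremalVec_zero]
  exact h_levelVec hr _

/-- The map `g ↦ g(h_{-1}, h_{-2}, …) y`. -/
def polyActOn (y : Fock) : MvPolynomial ℕ ℂ →ₗ[ℂ] Fock :=
  (LinearMap.applyₗ y).comp polyAct.toLinearMap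

@[simp] theorem polyActOn_apply (y : Fock) (g : MvPolynomial ℕ ℂ) :
    polyActOn y g = polyAct g y := rfl

theorem h_zero_polyAct (g : MvPolynomial ℕ ℂ) : h 0 * polyAct g = polyAct g * h 0 := by
  induction g using MvPolynomial.induction_on with
  | C a => rw [polyAct_C]; simp
  | add p q hp hq => rw [map_add, mul_add, add_mul, hp, hq]
  | mul_X p j hp =>
    have h1 := lie_h_zero_h (-((j : ℤ) + 1))
    rw [Ring.lie_def, sub_eq_zero] at h1
    rw [map_mul, polyAct_X, ← mul_assoc, hp, mul_assoc, h1, mul_assoc]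

theorem e_extremalVec (m : ℤ) (n : ℕ) : e (1 - 2 * m + n) (extremalVec m) =
    movedSign (extremalLevel m) false true (1 - 2 * m) (m - 1) •
      polyAct (hpolyInt n) (extremalVec (m - 1)) := by
  have h1 := current_levelVec_eq (t := false) (s := true) (by simp) (b := extremalLevel m)
    (b' := extremalLevel (m - 1)) (by simp [extremalLevel]) (by simp [extremalLevel]; ring) n
  have h2 : extremalLevel m false - extremalLevel m true + 1 = 1 - 2 * m := by
    simp [extremalLevel]; ring
  have h3 : extremalLevel m true - 1 = m - 1 := by simp [extremalLevel]
  have h4 : labSign false = 1 := rfl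
  rw [h2, h3, h4, hpolyScaled_one] at h1
  rw [e_eq_current, extremalVec, extremalVec, h1]

/-- Every monomial is an eigenvector. The lowest `e` that acts nontrivially takes the vector number
`m` to `±` the vector number `m - 1` and changes the eigenvalue by `2`; the vacuum fixes the start.
-/
theorem h_zero_extremalVec (m : ℤ) : h 0 (extremalVec m) = (-2 * m : ℂ) • extremalVec m := by
  have hne : ∀ m, extremalVec m ≠ 0 := fun m => by simp [extremalVec, levelVec]
  have hex : ∀ m, ∃ q : ℂ, h 0 (extremalVec m) = q • extremalVec m :=
    fun m => exists_h_zero_single _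
  choose q hq using hex
  have hstep : ∀ m, q (m - 1) = q m + 2 := by
    intro m
    have h1 := congrArg (fun T : Module.End ℂ Fock => T (extremalVec m)) (lie_h_e 0 (1 - 2 * m))
    simp only [Ring.lie_def, LinearMap.sub_apply, Module.End.mul_apply, LinearMap.smul_apply,
      sub_zero] at h1
    have h2 := e_extremalVec m 0
    set ε := movedSign (extremalLevel m) false true (1 - 2 * m) (m - 1) with hε
    have hε0 : ε ≠ 0 := by
      intro h0
      have := movedSign_mul_conj (extremalLevel m) false true (1 - 2 * m) (m - 1)
      rw [← hε, h0] at this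
      simp at this
    simp only [Nat.cast_zero, add_zero, hpolyInt_zero, map_one, Module.End.one_apply] at h2
    rw [hq, map_smul, h2, map_smul, hq, sub_eq_iff_eq_add, smul_smul, smul_smul, smul_smul,
      ← add_smul] at h1
    have h3 := smul_left_injective ℂ (hne (m - 1)) h1
    refine mul_left_cancel₀ hε0 ?_
    linear_combination h3
  have h0 : q 0 = 0 := by
    have := hq 0
    rw [extremalVec_zero, h_zero_vacuum, ← extremalVec_zero] at this
    exact (smul_eq_zero.1 this.symm).resolve_right (hne 0)
  rw [hq]
  congr 1
  induction m using Int.induction_on with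
  | zero => simp [h0]
  | succ i ih =>
    have := hstep (i + 1)
    rw [add_sub_cancel_right, ih] at this
    push_cast at this ⊢
    linear_combination -this
  | pred i ih =>
    rw [hstep, ih]
    push_cast
    ring

/-- Moving a current past a creation operator only adds a multiple of another current of the same
type, which reduces the claim to the level vector. -/
theorem current_polyAct_mem {t s : Bool} (hts : t ≠ s) {b b' : Bool → ℤ} (hs : b' s = b s - 1)
    (ht : b' t = b t + 1) (n : ℤ) (g : MvPolynomial ℕ ℂ) :
    current t s n (polyAct g (levelVec b)) ∈ LinearMap.range (polyActOn (levelVec b')) := by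
  induction g using MvPolynomial.induction_on generalizing n with
  | C a =>
    obtain ⟨g, hg⟩ := current_levelVec_mem hts hs ht n
    rw [polyAct_C, LinearMap.smul_apply, Module.End.one_apply, map_smul, hg]
    exact Submodule.smul_mem _ _ ⟨g, rfl⟩
  | add p q hp hq =>
    rw [map_add, LinearMap.add_apply, map_add]
    exact Submodule.add_mem _ (hp n) (hq n)
  | mul_X p j hp =>
    have h1 := congrArg (fun T : Module.End ℂ Fock => T (polyAct p (levelVec b)))
      (lie_h_current' hts (-((j : ℤ) + 1)) n)
    simp only [Ring.lie_def, LinearMap.sub_apply, Module.End.mul_apply, LinearMap.smul_apply] at h1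
    rw [mul_comm, map_mul, polyAct_X, Module.End.mul_apply]
    rw [sub_eq_iff_eq_add, ← sub_eq_iff_eq_add'] at h1
    rw [← h1]
    obtain ⟨g, hg⟩ := hp n
    refine Submodule.sub_mem _ ⟨MvPolynomial.X j * g, ?_⟩ (Submodule.smul_mem _ _ (hp _))
    rw [polyActOn_apply, map_mul, polyAct_X, Module.End.mul_apply, ← polyActOn_apply, hg]

theorem h_polyAct_mem (m n : ℤ) (g : MvPolynomial ℕ ℂ) :
    h n (polyAct g (extremalVec m)) ∈ LinearMap.range (polyActOn (extremalVec m)) := by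
  rcases lt_trichotomy n 0 with hn | rfl | hn
  · obtain ⟨i, rfl⟩ : ∃ i : ℕ, n = -((i : ℤ) + 1) := ⟨(-n - 1).toNat, by omega⟩
    exact ⟨MvPolynomial.X i * g, by
      rw [polyActOn_apply, map_mul, polyAct_X, Module.End.mul_apply]⟩
  · rw [← Module.End.mul_apply, h_zero_polyAct, Module.End.mul_apply, h_zero_extremalVec, map_smul]
    exact Submodule.smul_mem _ _ ⟨g, rfl⟩
  · obtain ⟨i, rfl⟩ : ∃ i : ℕ, n = (i : ℤ) + 1 := ⟨(n - 1).toNat, by omega⟩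
    rw [h_polyAct_apply (y := extremalVec m) (fun r hr => h_levelVec hr _)]
    exact Submodule.smul_mem _ _ ⟨_, rfl⟩

theorem generated_le {A : Set (Module.End ℂ Fock)} {x : Fock} {W : Submodule ℂ Fock} (hx : x ∈ W)
    (hA : ∀ T ∈ A, ∀ y ∈ W, T y ∈ W) : generated A x ≤ W :=
  sInf_le ⟨hx, hA⟩

theorem mem_generated (A : Set (Module.End ℂ Fock)) (x : Fock) : x ∈ generated A x :=
  Submodule.mem_sInf.2 fun _ hW => hW.1

theorem apply_mem_generated {A : Set (Module.End ℂ Fock)} {x y : Fock} {T : Module.End ℂ Fock}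
    (hT : T ∈ A) (hy : y ∈ generated A x) : T y ∈ generated A x :=
  Submodule.mem_sInf.2 fun W hW => hW.2 T hT y (Submodule.mem_sInf.1 hy W hW)

theorem map_mem_iSup {ι : Type*} {W : ι → Submodule ℂ Fock} {T : Module.End ℂ Fock}
    (hT : ∀ i, ∀ y ∈ W i, T y ∈ ⨆ j, W j) {y : Fock} (hy : y ∈ ⨆ j, W j) : T y ∈ ⨆ j, W j := by
  have : (⨆ j, W j) ≤ (⨆ j, W j).comap T := iSup_le fun i y hy => hT i y hy
  exact this hy

/-- The sum is stable: `e` sends the summand `m` to `m - 1`, `f` to `m + 1`, and `h` preserves it.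
-/
theorem basicModule_le :
    basicModule ≤ ⨆ m : ℤ, LinearMap.range (polyActOn (extremalVec m)) := by
  refine generated_le ?_ ?_
  · refine Submodule.mem_iSup_of_mem 0 ⟨1, ?_⟩
    rw [polyActOn_apply, map_one, Module.End.one_apply, extremalVec_zero]
  · rintro T ((⟨n, rfl⟩ | ⟨n, rfl⟩) | ⟨n, rfl⟩) y hy
    · refine map_mem_iSup ?_ hy
      rintro m _ ⟨g, rfl⟩
      rw [e_eq_current]
      exact Submodule.mem_iSup_of_mem (m - 1) (current_polyAct_mem (t := false) (s := true)
        (by simp) (by simp [extremalLevel]) (by simp [extremalLevel]; ring) n g)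
    · refine map_mem_iSup ?_ hy
      rintro m _ ⟨g, rfl⟩
      rw [f_eq_current]
      exact Submodule.mem_iSup_of_mem (m + 1) (current_polyAct_mem (t := true) (s := false)
        (by simp) (by simp [extremalLevel]; ring) (by simp [extremalLevel]) n g)
    · refine map_mem_iSup ?_ hy
      rintro m _ ⟨g, rfl⟩
      exact Submodule.mem_iSup_of_mem m (h_polyAct_mem m n g)

theorem polyAct_mem_basicModule (g : MvPolynomial ℕ ℂ) : polyAct g vacuum ∈ basicModule := by
  induction g using MvPolynomial.induction_on with
  | C a =>
    rw [polyAct_C, LinearMap.smul_apply, Module.End.one_apply]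
    exact Submodule.smul_mem _ _ (mem_generated _ _)
  | add p q hp hq =>
    rw [map_add, LinearMap.add_apply]
    exact Submodule.add_mem _ hp hq
  | mul_X p j hp =>
    rw [mul_comm, map_mul, polyAct_X, Module.End.mul_apply]
    exact apply_mem_generated (Or.inr ⟨_, rfl⟩) hp

/-- `h 0` acts on the summand `m` by `-2 m`, so its kernel in the sum is the summand of the vacuum.
-/
theorem chargeZero_eq : chargeZero = LinearMap.range (polyActOn vacuum) := by
  refine le_antisymm ?_ ?_
  · rintro x ⟨hx, hx0⟩
    rw [← extremalVec_zero]
    refine mem_of_mem_iSup_of_eigenvector (T := h 0) (c := fun m : ℤ => (-2 * m : ℂ))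
      (W := fun m : ℤ => LinearMap.range (polyActOn (extremalVec m))) ?_ ?_ (basicModule_le hx) ?_
    · intro m n hmn
      have : (m : ℂ) = n := by
        simp only at hmn
        linear_combination (-1 / 2 : ℂ) * hmn
      exact_mod_cast this
    · rintro m _ ⟨g, rfl⟩
      rw [polyActOn_apply, ← Module.End.mul_apply, h_zero_polyAct, Module.End.mul_apply,
        h_zero_extremalVec, map_smul]
    · rw [LinearMap.mem_ker.1 hx0]; simp
  · rintro _ ⟨g, rfl⟩
    refine ⟨polyAct_mem_basicModule g, ?_⟩
    change h 0 (polyAct g vacuum) = 0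
    rw [← Module.End.mul_apply, h_zero_polyAct, Module.End.mul_apply, h_zero_vacuum, map_zero]

/-- A creation operator is adjoint to one that kills the vacuum, so only the constant term has a
vacuum component. -/
theorem polyAct_vacuum_apply (g : MvPolynomial ℕ ℂ) :
    polyAct g vacuum vacuumState = MvPolynomial.coeff 0 g := by
  induction g using MvPolynomial.induction_on with
  | C a => rw [polyAct_C]; simp [vacuum]
  | add p q hp hq => rw [map_add, LinearMap.add_apply, Finsupp.add_apply, hp, hq,
      MvPolynomial.coeff_add]
  | mul_X p j hp =>
    have h1 : ∀ y : Fock, y vacuumState = form vacuum y := fun y => by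
      rw [vacuum, form_single_left]; simp
    rw [mul_comm, map_mul, polyAct_X, Module.End.mul_apply, h1, ← conj_form,
      form_h_left (by omega), neg_neg, h_vacuum (by omega)]
    simp [MvPolynomial.coeff_X_mul']

/-- The annihilation operators act as multiples of the partial derivatives. They bring any
coefficient, up to a nonzero factor, to the constant term, which the vacuum coefficient reads off.
-/
theorem polyActOn_vacuum_injective : Function.Injective (polyActOn vacuum) := by
  rw [injective_iff_map_eq_zero]
  suffices hcoeff : ∀ (n : ℕ) (g : MvPolynomial ℕ ℂ), polyAct g vacuum = 0 →
      ∀ d : ℕ →₀ ℕ, d.degree = n → g.coeff d = 0 by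
    intro g hg
    ext d
    simpa using hcoeff _ g hg d rfl
  intro n
  induction n with
  | zero =>
    intro g hg d hd
    rw [Finsupp.degree_eq_zero_iff] at hd
    rw [hd, ← polyAct_vacuum_apply, hg]; rfl
  | succ n ih =>
    intro g hg d hd
    have hd0 : d ≠ 0 := by
      rintro rfl
      simp at hd
    obtain ⟨i, hi⟩ := Finsupp.support_nonempty_iff.2 hd0
    rw [Finsupp.mem_support_iff] at hi
    have hder : polyAct (MvPolynomial.pderiv i g) vacuum = 0 := by
      have h1 := h_polyAct_apply (fun r hr => h_vacuum hr) i g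
      rw [hg, map_zero] at h1
      refine (smul_eq_zero.1 h1.symm).resolve_left ?_
      exact_mod_cast (by omega : 2 * (i + 1) ≠ 0)
    have hle : Finsupp.single i 1 ≤ d := by
      rw [Finsupp.single_le_iff]; omega
    have h2 := ih _ hder (d - Finsupp.single i 1) (by
      have := congrArg Finsupp.degree (tsub_add_cancel_of_le hle)
      rw [map_add, Finsupp.degree_single] at this
      omega)
    rw [MvPolynomial.coeff_pderiv, tsub_add_cancel_of_le hle] at h2
    refine (mul_eq_zero.1 h2).resolve_right ?_
    simp only [Finsupp.coe_tsub, Pi.sub_apply, Finsupp.single_eq_same]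
    exact_mod_cast (by omega : d i - 1 + 1 ≠ 0)

/-! ### The extremal vectors `Om k` -/

theorem shift_levelState (k : ℤ) :
    (levelState (extremalLevel k)).shift = levelState (extremalLevel (k + 1)) := by
  apply State.eq_of_occ_eq
  ext a
  obtain ⟨s, i, rfl⟩ := exists_lab a
  rw [lab_mem_levelState]
  have hu : ∀ i, u i = lab true i := fun _ => rfl
  have hv : ∀ i, v i = lab false i := fun _ => rfl
  simp only [State.shift, Set.mem_ofPred_eq, hu, hv, lab_mem_levelState, lab_inj]
  cases s
  · simp only [extremalLevel, Bool.false_eq_true, false_and, exists_false, true_and, false_or,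
      if_false]
    constructor
    · rintro ⟨j, rfl, hj⟩
      omega
    · intro hi
      exact ⟨i + 1, by omega, by omega⟩
  · simp only [extremalLevel, Bool.true_eq_false, false_and, exists_false, true_and, or_false,
      if_true]
    constructor
    · rintro ⟨j, rfl, hj⟩
      omega
    · intro hi
      exact ⟨i - 1, by omega, by omega⟩

/-- If `v_j` is filled then `j < -k`, so `u_{j-1}` and `u_{j-2}` are filled as well. No
transposition counts, and only the overall sign of `V` remains. -/
theorem V_extremalVec (k : ℕ) : V (extremalVec k) = -extremalVec (k + 1) := by
  have hset : {j : ℤ | v j ∈ (levelState (extremalLevel k)).occ ∧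
      ¬(u (j - 1) ∈ (levelState (extremalLevel k)).occ ↔
        u (j - 2) ∈ (levelState (extremalLevel k)).occ)} = ∅ := by
    have hu : ∀ i, u i = lab true i := fun _ => rfl
    have hv : ∀ i, v i = lab false i := fun _ => rfl
    ext j
    simp only [hu, hv, lab_mem_levelState, extremalLevel, Set.mem_ofPred_eq, Set.mem_empty_iff_false,
      iff_false, Bool.false_eq_true, if_false, if_true]
    omega
  rw [extremalVec, levelVec, V, opOfBasis_single, one_smul, hset, shift_levelState, extremalVec,
    levelVec]
  simp

theorem Om_eq (k : ℕ) : Om k = (-1 : ℂ) ^ k • extremalVec k := by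
  induction k with
  | zero => simp [Om, extremalVec_zero]
  | succ k ih =>
    have : Om (k + 1) = V (Om k) := by rw [Om, pow_succ', Module.End.mul_apply, Om]
    rw [this, ih, map_smul, V_extremalVec, pow_succ]
    push_cast
    rw [smul_neg, mul_neg_one, neg_smul]

/-- The factor moved is the topmost one, so removing it costs no sign. Its new place `v_{-k-1}` lies
below the remaining `u_i` with `-k-1 ≤ i < k`, an odd number `2k + 1`. -/
theorem movedSign_extremal (k : ℕ) :
    movedSign (extremalLevel ((k : ℤ) + 1)) false true (1 - 2 * ((k : ℤ) + 1)) k = -1 := by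
  have h1 : {a : ℤ | a ∈ (levelState (extremalLevel ((k : ℤ) + 1))).occ ∧ lab true k < a} = ∅ := by
    ext a
    obtain ⟨s, i, rfl⟩ := exists_lab a
    simp only [Set.mem_ofPred_eq, lab_mem_levelState, Set.mem_empty_iff_false, iff_false]
    cases s <;> simp [extremalLevel, lab, u, v] <;> omega
  have h2 : {a : ℤ | a ∈ ((levelState (extremalLevel ((k : ℤ) + 1))).erase (lab true k)).occ ∧
      lab false (k + (1 - 2 * ((k : ℤ) + 1))) < a} =
      (fun i => 2 * i + 1) '' (Finset.Ico (-(k : ℤ) - 1) k : Set ℤ) := by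
    ext a
    obtain ⟨s, i, rfl⟩ := exists_lab a
    simp only [Set.mem_ofPred_eq, lab_mem_levelState, State.mem_erase, Ne, lab_inj, Set.mem_image,
      Finset.coe_Ico, Set.mem_Ico]
    cases s
    · simp [extremalLevel, lab, v]; omega
    · simp [extremalLevel, lab, u, v]; omega
  rw [movedSign, wedgeSign, wedgeSign, h1, h2, Set.ncard_empty, pow_zero, one_mul,
    Set.ncard_image_of_injective _ (fun i j hij => by simpa using hij), Set.ncard_coe_finset,
    Int.card_Ico]
  have : ((k : ℤ) - (-(k : ℤ) - 1)).toNat = 2 * k + 1 := by omega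
  rw [this]
  simp [pow_succ]

/-- The sign of the move cancels the one in `V`; for `n = 0` this is the normalization of the
extremal vectors. -/
theorem e_Om (k : ℕ) (n : ℤ) :
    e (n - 2 * k - 1) (Om (k + 1)) = polyAct (hpolyInt n) (Om k) := by
  rw [Om_eq, Om_eq, map_smul, map_smul]
  rcases lt_or_ge n 0 with hn | hn
  · rw [hpolyInt_of_neg hn, e_eq_current]
    push_cast
    rw [extremalVec, current_levelVec_eq_zero (by simp)]
    · simp
    · simp [extremalLevel]; omega
  · obtain ⟨m, rfl⟩ : ∃ m : ℕ, n = m := ⟨n.toNat, by omega⟩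
    have h1 := e_extremalVec ((k : ℤ) + 1) m
    rw [add_sub_cancel_right, movedSign_extremal,
      show 1 - 2 * ((k : ℤ) + 1) + m = m - 2 * k - 1 by ring] at h1
    push_cast
    rw [h1, smul_smul, pow_succ]
    simp

theorem Om_zero : Om 0 = vacuum := by simp [Om]

theorem h_zero_Om (k : ℕ) : h 0 (Om k) = (-2 * k : ℂ) • Om k := by
  rw [Om_eq, map_smul, h_zero_extremalVec, smul_comm]
  push_cast
  rfl

end FockSL2
end

noncomputable section
namespace FockSL2
attribute [local instance] endRing

/-! ### The vertex operator form of products of the `e_n` -/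

theorem sum_range_second_difference {M : Type*} [AddCommGroup M] (T : ℕ → M) (N : ℕ) :
    ∑ i ∈ Finset.range N, (T (i + 1) - (2 : ℤ) • T (i + 2) + T (i + 3)) =
      T 1 - T 2 - T (N + 1) + T (N + 2) := by
  induction N with
  | zero => simp
  | succ N ih =>
    rw [Finset.sum_range_succ, ih]
    abel

theorem e_mul_h_neg (m : ℤ) (i : ℕ) :
    e m * h (-((i : ℤ) + 1)) = h (-((i : ℤ) + 1)) * e m - (2 : ℂ) • e (m + (i + 1)) := by
  have h1 := lie_h_e (-((i : ℤ) + 1)) m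
  rw [Ring.lie_def, sub_neg_eq_add] at h1
  rw [← h1]; abel

/-- The coefficients `1, -2, 1` are those of `(1 - y)^2`, where `y` lowers the degree of the
complete homogeneous polynomial and raises the index of `e` by one. The proof multiplies by the
degree and applies Newton's recursion; the extra terms from moving `e` past the power sums
telescope. -/
theorem e_mul_hpoly (m n : ℤ) : e m * polyAct (hpolyInt n) =
    polyAct (hpolyInt n) * e m - (2 : ℂ) • (polyAct (hpolyInt (n - 1)) * e (m + 1)) +
      polyAct (hpolyInt (n - 2)) * e (m + 2) := by
  have hnonpos : ∀ m n : ℤ, n ≤ 0 → e m * polyAct (hpolyInt n) =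
      polyAct (hpolyInt n) * e m - (2 : ℂ) • (polyAct (hpolyInt (n - 1)) * e (m + 1)) +
      polyAct (hpolyInt (n - 2)) * e (m + 2) := by
    intro m n hn
    rw [hpolyInt_of_neg (by omega : n - 1 < 0), hpolyInt_of_neg (by omega : n - 2 < 0)]
    rcases hn.eq_or_lt with rfl | hn
    · simp
    · rw [hpolyInt_of_neg hn]; simp
  rcases le_or_gt n 0 with hn | hn
  · exact hnonpos m n hn
  obtain ⟨k, rfl⟩ : ∃ k : ℕ, n = k := ⟨n.toNat, by omega⟩
  induction k using Nat.strong_induction_on generalizing m with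
  | _ k ih =>
    have ih' : ∀ (m : ℤ) (i : ℕ), e m * polyAct (hpolyInt ((k : ℤ) - 1 - i)) =
        polyAct (hpolyInt ((k : ℤ) - 1 - i)) * e m -
          (2 : ℂ) • (polyAct (hpolyInt ((k : ℤ) - 1 - 1 - i)) * e (m + 1)) +
          polyAct (hpolyInt ((k : ℤ) - 2 - 1 - i)) * e (m + 2) := by
      intro m i
      rw [show (k : ℤ) - 1 - 1 - i = (k : ℤ) - 1 - i - 1 by ring,
        show (k : ℤ) - 2 - 1 - i = (k : ℤ) - 1 - i - 2 by ring]
      rcases le_or_gt ((k : ℤ) - 1 - i) 0 with h0 | h0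
      · exact hnonpos _ _ h0
      · have := ih (k - 1 - i) (by omega) m (by omega)
        rwa [show (((k - 1 - i : ℕ)) : ℤ) = (k : ℤ) - 1 - i by omega] at this
    have hrec : ∀ c : ℤ, 0 ≤ c → ∑ i ∈ Finset.range k, h (-((i : ℤ) + 1)) *
        polyAct (hpolyInt ((k : ℤ) - c - 1 - i)) =
          ((k : ℂ) - c) • polyAct (hpolyInt ((k : ℤ) - c)) := by
      intro c hc
      have h1 := smul_hpolyInt ((k : ℤ) - c) k (by omega)
      have h2 := congrArg polyAct h1
      rw [map_smul, map_sum] at h2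
      push_cast at h2
      rw [h2]
      exact Finset.sum_congr rfl fun i _ => by rw [map_mul, polyAct_X]
    have hk : (k : ℂ) ≠ 0 := by exact_mod_cast hn.ne'
    refine smul_right_injective _ hk ?_
    set T : ℕ → Module.End ℂ Fock := fun r => polyAct (hpolyInt ((k : ℤ) - r)) * e (m + r) with hT
    have hsum : (k : ℂ) • (e m * polyAct (hpolyInt (k : ℤ))) =
        ∑ i ∈ Finset.range k, (h (-((i : ℤ) + 1)) * polyAct (hpolyInt ((k : ℤ) - 1 - i)) * e m
          - (2 : ℂ) • (h (-((i : ℤ) + 1)) * polyAct (hpolyInt ((k : ℤ) - 1 - 1 - i)) * e (m + 1))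
          + h (-((i : ℤ) + 1)) * polyAct (hpolyInt ((k : ℤ) - 2 - 1 - i)) * e (m + 2)
          - (2 : ℂ) • (T (i + 1) - (2 : ℤ) • T (i + 2) + T (i + 3))) := by
      have h1 := hrec 0 le_rfl
      simp only [sub_zero, Int.cast_zero] at h1
      rw [← mul_smul_comm, ← h1, Finset.mul_sum]
      refine Finset.sum_congr rfl fun i _ => ?_
      have h2 : (2 : ℤ) • T (i + 2) = (2 : ℂ) • T (i + 2) := by
        rw [two_smul, two_smul]
      rw [← mul_assoc, e_mul_h_neg, sub_mul, mul_assoc, ih', smul_mul_assoc, ih', h2]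
      simp only [hT]
      rw [show ((i + 1 : ℕ) : ℤ) = i + 1 by push_cast; ring,
        show ((i + 2 : ℕ) : ℤ) = i + 2 by push_cast; ring,
        show ((i + 3 : ℕ) : ℤ) = i + 3 by push_cast; ring,
        show (k : ℤ) - 1 - i = k - (i + 1) by ring,
        show (k : ℤ) - 1 - 1 - i = k - (i + 2) by ring,
        show (k : ℤ) - 2 - 1 - i = k - (i + 3) by ring,
        show m + ((i : ℤ) + 1) + 1 = m + (i + 2) by ring,
        show m + ((i : ℤ) + 1) + 2 = m + (i + 3) by ring]
      rw [mul_add, mul_sub, mul_smul_comm, mul_assoc, mul_assoc, mul_assoc]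
    have hr0 := hrec 0 le_rfl
    have hr1 := hrec 1 zero_le_one
    have hr2 := hrec 2 zero_le_two
    simp only [sub_zero, Int.cast_zero] at hr0
    change (k : ℂ) • _ = (k : ℂ) • _
    rw [hsum, Finset.sum_sub_distrib, Finset.sum_add_distrib, Finset.sum_sub_distrib,
      ← Finset.sum_mul, ← Finset.smul_sum, ← Finset.sum_mul, ← Finset.sum_mul, hr0, hr1, hr2,
      ← Finset.smul_sum, sum_range_second_difference]
    -- The upper end of the telescoping sum has negative degree. The lower end completes the weights
    -- `k - 1` and `k - 2` of the last two terms to `k`.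
    have hz1 : T (k + 1) = 0 := by
      simp only [hT]
      rw [hpolyInt_of_neg (by push_cast; omega), map_zero, zero_mul]
    have hz2 : T (k + 2) = 0 := by
      simp only [hT]
      rw [hpolyInt_of_neg (by push_cast; omega), map_zero, zero_mul]
    rw [hz1, hz2, smul_mul_assoc, smul_mul_assoc, smul_mul_assoc]
    simp only [hT, Nat.cast_one, Nat.cast_ofNat, Int.cast_one, Int.cast_ofNat]
    module

/-! ### Generating functions of words in the `e_n` -/

/-- Laurent polynomials in `k` variables. -/
abbrev Laurent (k : ℕ) : Type := AddMonoidAlgebra ℂ (Fin k → ℤ)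

/-- The Laurent monomial `z^b`. -/
def mono {k : ℕ} (b : Fin k → ℤ) : Laurent k := AddMonoidAlgebra.single b 1

theorem mono_zero {k : ℕ} : mono (0 : Fin k → ℤ) = 1 := rfl

theorem mono_add {k : ℕ} (a b : Fin k → ℤ) : mono (a + b) = mono a * mono b := by
  simp [mono]

theorem mono_nsmul {k : ℕ} (n : ℕ) (b : Fin k → ℤ) : mono (n • b) = mono b ^ n := by
  simp [mono]

theorem mono_sum {k : ℕ} {ι : Type*} (s : Finset ι) (b : ι → Fin k → ℤ) :
    mono (∑ i ∈ s, b i) = ∏ i ∈ s, mono (b i) := by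
  classical
  induction s using Finset.induction_on with
  | empty => simp [mono_zero]
  | insert i s hi ih => rw [Finset.sum_insert hi, Finset.prod_insert hi, mono_add, ih]

theorem laurent_induction {k : ℕ} {motive : Laurent k → Prop} (g : Laurent k)
    (mono : ∀ b, motive (mono b)) (add : ∀ x y, motive x → motive y → motive (x + y))
    (smul : ∀ (c : ℂ) x, motive x → motive (c • x)) : motive g := by
  refine AddMonoidAlgebra.induction_linear g ?_ add ?_
  · simpa using smul 0 _ (mono 0)
  · intro b c
    have : AddMonoidAlgebra.single b c = c • FockSL2.mono b := by simp [FockSL2.mono]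
    rw [this]
    exact smul _ _ (mono b)

/-- The linear map with prescribed values on the Laurent monomials. -/
def laurentLift {k : ℕ} {M : Type*} [AddCommGroup M] [Module ℂ M] (F : (Fin k → ℤ) → M) :
    Laurent k →ₗ[ℂ] M :=
  (Finsupp.linearCombination ℂ F).comp (AddMonoidAlgebra.coeffLinearEquiv ℂ).toLinearMap

@[simp] theorem laurentLift_mono {k : ℕ} {M : Type*} [AddCommGroup M] [Module ℂ M]
    (F : (Fin k → ℤ) → M) (b : Fin k → ℤ) : laurentLift F (mono b) = F b := by
  simp [laurentLift, mono]

/-- The linear map `z^b ↦ ∏ H_{b_i}`. -/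
def hprod (k : ℕ) : Laurent k →ₗ[ℂ] MvPolynomial ℕ ℂ := laurentLift fun b => ∏ i, hpolyInt (b i)

@[simp] theorem hprod_mono {k : ℕ} (b : Fin k → ℤ) : hprod k (mono b) = ∏ i, hpolyInt (b i) :=
  laurentLift_mono _ _

/-- The coefficients of `(1 - y)^2`. -/
def sqCoeff : Fin 3 → ℂ := ![1, -2, 1]

theorem one_sub_sq {R : Type*} [CommRing R] [Algebra ℂ R] (y : R) :
    (1 - y) ^ 2 = ∑ c : Fin 3, sqCoeff c • y ^ (c : ℕ) := by
  rw [Fin.sum_univ_three]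
  simp [sqCoeff, two_smul]
  ring

/-- Passing each factor offers three choices; `c i` is the number of units transferred from the
factor `i` to the index of `e`, which finally meets the extremal vector. -/
theorem e_polyAct_prod (r : ℕ) (b : Fin r → ℤ) (m : ℤ) (s : ℕ) :
    e m (polyAct (∏ i, hpolyInt (b i)) (Om (s + 1))) =
      ∑ c : Fin r → Fin 3, (∏ i, sqCoeff (c i)) •
        polyAct (hpolyInt (m + 2 * s + 1 + ∑ i, ((c i : ℕ) : ℤ)) *
          ∏ i, hpolyInt (b i - ((c i : ℕ) : ℤ))) (Om s) := by
  induction r generalizing m with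
  | zero =>
    have := e_Om s (m + 2 * s + 1)
    rw [show m + 2 * (s : ℤ) + 1 - 2 * s - 1 = m by ring] at this
    simp [this]
  | succ r ih =>
    rw [Fin.prod_univ_succ, map_mul, Module.End.mul_apply]
    have h1 := congrArg (fun T : Module.End ℂ Fock =>
      T (polyAct (∏ i : Fin r, hpolyInt (b i.succ)) (Om (s + 1)))) (e_mul_hpoly m (b 0))
    simp only [Module.End.mul_apply, LinearMap.add_apply, LinearMap.sub_apply,
      LinearMap.smul_apply] at h1
    have hterm : ∀ (x : Fin 3) (d : ℤ), d = ((x : ℕ) : ℤ) →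
        polyAct (hpolyInt (b 0 - d)) (∑ c : Fin r → Fin 3, (∏ i, sqCoeff (c i)) •
          polyAct (hpolyInt (m + d + 2 * s + 1 + ∑ i, ((c i : ℕ) : ℤ)) *
            ∏ i : Fin r, hpolyInt (b i.succ - ((c i : ℕ) : ℤ))) (Om s)) =
        ∑ c : Fin r → Fin 3, (∏ i, sqCoeff (c i)) •
          polyAct (hpolyInt (m + 2 * s + 1 + (((x : ℕ) : ℤ) + ∑ i, ((c i : ℕ) : ℤ))) *
            (hpolyInt (b 0 - ((x : ℕ) : ℤ)) *
              ∏ i : Fin r, hpolyInt (b i.succ - ((c i : ℕ) : ℤ)))) (Om s) := by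
      rintro x _ rfl
      rw [map_sum]
      refine Finset.sum_congr rfl fun c _ => ?_
      rw [map_smul, ← Module.End.mul_apply, ← map_mul, mul_left_comm,
        show m + ((x : ℕ) : ℤ) + 2 * s + 1 + ∑ i, ((c i : ℕ) : ℤ) =
          m + 2 * s + 1 + (((x : ℕ) : ℤ) + ∑ i, ((c i : ℕ) : ℤ)) by ring]
    have h0 := hterm 0 0 rfl
    rw [sub_zero, add_zero] at h0
    rw [h1, ih, ih, ih, h0, hterm 1 1 rfl, hterm 2 2 rfl, ← (Fin.consEquiv fun _ => Fin 3).sum_comp,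
      Fintype.sum_prod_type, Fin.sum_univ_three]
    simp only [Fin.consEquiv_apply, Fin.prod_univ_succ, Fin.sum_univ_succ, Fin.cons_zero,
      Fin.cons_succ, mul_smul, ← Finset.smul_sum]
    rw [show sqCoeff 0 = 1 from rfl, show sqCoeff 1 = -2 from rfl, show sqCoeff 2 = 1 from rfl,
      one_smul, one_smul, neg_smul, ← sub_eq_add_neg]

/-- The embedding of the Laurent polynomials in `z_1, …, z_k` into those in `z_0, …, z_k`. -/
def laurentSucc (k : ℕ) : Laurent k →ₐ[ℂ] Laurent (k + 1) :=
  AddMonoidAlgebra.mapDomainAlgHom ℂ ℂ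
    { toFun := fun b => Fin.cons 0 b
      map_zero' := by funext i; refine Fin.cases ?_ (fun i => ?_) i <;> simp
      map_add' := fun a b => by funext i; refine Fin.cases ?_ (fun i => ?_) i <;> simp }

@[simp] theorem laurentSucc_mono {k : ℕ} (b : Fin k → ℤ) :
    laurentSucc k (mono b) = mono (Fin.cons 0 b) := by
  simp [laurentSucc, mono]

/-- The exponent `ε_i` of the variable `z_i`. -/
def unitExp {k : ℕ} (i : Fin k) : Fin k → ℤ := Pi.single i 1

theorem cons_unitExp {k : ℕ} (i : Fin k) :
    (Fin.cons 0 (unitExp i) : Fin (k + 1) → ℤ) = unitExp i.succ := by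
  funext j
  refine Fin.cases ?_ (fun j => ?_) j
  · simp [unitExp]
  · simp [unitExp, Pi.single_apply]

theorem cons_sub {k : ℕ} (a b : Fin k → ℤ) :
    (Fin.cons 0 (a - b) : Fin (k + 1) → ℤ) = Fin.cons 0 a - Fin.cons 0 b := by
  funext j
  refine Fin.cases ?_ (fun j => ?_) j <;> simp

/-- The new variable `z_0` belongs to the factor that `e` creates, and passing the factor of `z_i`
multiplies by `(1 - z_0 / z_i)^2`. -/
theorem e_polyAct_hprod (r : ℕ) (g : Laurent r) (m : ℤ) (s : ℕ) :
    e m (polyAct (hprod r g) (Om (s + 1))) =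
      polyAct (hprod (r + 1) (mono (Fin.cons (m + 2 * s + 1) 0) * laurentSucc r g *
        ∏ i : Fin r, (1 - mono (unitExp 0 - unitExp i.succ)) ^ 2)) (Om s) := by
  induction g using laurent_induction with
  | add x y hx hy =>
    simp only [map_add, LinearMap.add_apply, mul_add, add_mul, hx, hy]
  | smul c x hx =>
    simp only [map_smul, LinearMap.smul_apply, mul_smul_comm, smul_mul_assoc, hx]
  | mono b =>
    rw [hprod_mono, e_polyAct_prod]
    simp only [one_sub_sq]
    rw [Finset.prod_univ_sum, Fintype.piFinset_univ, Finset.mul_sum, map_sum, map_sum,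
      LinearMap.sum_apply]
    refine Finset.sum_congr rfl fun c _ => ?_
    rw [Finset.prod_smul, mul_smul_comm, map_smul, map_smul, LinearMap.smul_apply]
    congr 3
    simp only [← mono_nsmul]
    rw [← mono_sum, laurentSucc_mono, ← mono_add, ← mono_add, hprod_mono, Fin.prod_univ_succ]
    congr 1
    · congr 1
      simp [unitExp, Finset.sum_apply, Fin.succ_ne_zero]
    · refine Finset.prod_congr rfl fun i _ => ?_
      congr 1
      simp [unitExp, Finset.sum_apply, Pi.single_apply, Fin.succ_ne_zero, sub_eq_add_neg]

/-- The operator number `i` takes `Om (t + i + 1)` to the module over `Om (t + i)`, hence the shift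
`2 (t + i) + 1`. It passes the factors created before by the operators `j > i`, hence the squares.
-/
theorem list_e_prod_Om (r : ℕ) (n : Fin r → ℤ) (t : ℕ) :
    (List.ofFn fun i => e (n i)).prod (Om (r + t)) =
      polyAct (hprod r (mono (fun i => n i + 2 * (t + i) + 1) *
        ∏ i : Fin r, ∏ j ∈ Finset.Ioi i, (1 - mono (unitExp i - unitExp j)) ^ 2)) (Om t) := by
  induction r generalizing t with
  | zero =>
    simp only [List.ofFn_zero, List.prod_nil, Module.End.one_apply, Finset.univ_eq_empty,
      Finset.prod_empty, mul_one, zero_add, hprod_mono, map_one]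
  | succ r ih =>
    rw [List.ofFn_succ, List.prod_cons, Module.End.mul_apply,
      show r + 1 + t = r + (t + 1) by ring, ih, e_polyAct_hprod]
    congr 3
    rw [map_mul, laurentSucc_mono, ← mul_assoc, ← mono_add, map_prod, mul_assoc,
      Fin.prod_univ_succ, Fin.prod_Ioi_zero, mul_comm (∏ i : Fin r, _)]
    congr 1
    · congr 1
      funext i
      refine Fin.cases ?_ (fun i => ?_) i
      · simp
      · simp; ring
    · congr 1
      refine Finset.prod_congr rfl fun i _ => ?_
      rw [Fin.prod_Ioi_succ, map_prod]
      refine Finset.prod_congr rfl fun j _ => ?_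
      rw [map_pow, map_sub, map_one, laurentSucc_mono, cons_sub, cons_unitExp, cons_unitExp]

/-! ### The product of the two Vandermonde determinants -/

/-- The Vandermonde determinant in `z_i`. -/
def vdm (k : ℕ) : Laurent k := (Matrix.vandermonde fun i => mono (unitExp i)).det

/-- The Vandermonde determinant in `z_i⁻¹`. -/
def vdmInv (k : ℕ) : Laurent k := (Matrix.vandermonde fun i => mono (-unitExp i)).det

theorem sum_unitExp_sub (k : ℕ) : ∑ i : Fin k, ∑ j ∈ Finset.Ioi i, (unitExp j - unitExp i) =
    fun l : Fin k => 2 * ((l : ℕ) : ℤ) + 1 - k := by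
  funext l
  simp only [Finset.sum_apply, Pi.sub_apply, Finset.sum_sub_distrib]
  have h1 : ∑ i : Fin k, ∑ j ∈ Finset.Ioi i, unitExp j l = ((l : ℕ) : ℤ) := by
    simp only [unitExp, Pi.single_apply, Finset.sum_ite_eq, Finset.mem_Ioi]
    rw [Finset.sum_boole, Finset.filter_gt_eq_Iio, Fin.card_Iio]
  have h2 : ∑ i : Fin k, ∑ j ∈ Finset.Ioi i, unitExp i l = (k : ℤ) - 1 - ((l : ℕ) : ℤ) := by
    rw [Finset.sum_eq_single l]
    · have := l.2
      simp [unitExp]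
      omega
    · intro i _ hi
      simp [unitExp, hi.symm]
    · simp
  rw [h1, h2]
  ring

/-- For each pair, `(z_j / z_i) (1 - z_i / z_j)^2 = -(z_j - z_i) (z_j⁻¹ - z_i⁻¹)`. The monomial in
front is the product of all `z_j / z_i`, `i < j`, and the `k (k - 1) / 2` pairs give the sign. -/
theorem mono_mul_prod_sq (k : ℕ) : mono (fun l : Fin k => 2 * ((l : ℕ) : ℤ) + 1 - k) *
    ∏ i : Fin k, ∏ j ∈ Finset.Ioi i, (1 - mono (unitExp i - unitExp j)) ^ 2 =
      (-1 : Laurent k) ^ (k * (k - 1) / 2) * (vdm k * vdmInv k) := by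
  have hsign : (-1 : Laurent k) ^ (k * (k - 1) / 2) = ∏ i : Fin k, ∏ j ∈ Finset.Ioi i, (-1) := by
    simp only [Finset.prod_const, Fin.card_Ioi]
    rw [Finset.prod_pow_eq_pow_sum, Fin.sum_univ_eq_sum_range (fun i => k - 1 - i),
      Finset.sum_range_reflect (fun i => i), Finset.sum_range_id]
  rw [← sum_unitExp_sub, vdm, vdmInv, Matrix.det_vandermonde, Matrix.det_vandermonde, hsign,
    mono_sum, ← Finset.prod_mul_distrib, ← Finset.prod_mul_distrib, ← Finset.prod_mul_distrib]
  refine Finset.prod_congr rfl fun i _ => ?_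
  rw [mono_sum, ← Finset.prod_mul_distrib, ← Finset.prod_mul_distrib, ← Finset.prod_mul_distrib]
  refine Finset.prod_congr rfl fun j _ => ?_
  have hi : mono (unitExp i) * mono (-unitExp i) = 1 := by
    rw [← mono_add, add_neg_cancel, mono_zero]
  have hj : mono (unitExp j) * mono (-unitExp j) = 1 := by
    rw [← mono_add, add_neg_cancel, mono_zero]
  rw [sub_eq_add_neg, sub_eq_add_neg (unitExp i), mono_add, mono_add]
  linear_combination (-2 * mono (unitExp j) * mono (-unitExp j)
    + mono (unitExp i) * mono (-unitExp j) * (mono (unitExp j) * mono (-unitExp j)) + 1) * hi +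
    (-1 + mono (unitExp i) * mono (-unitExp j)) * hj

/-- The vectors `e_{a_1 - k} ⋯ e_{a_k - k} Ω_{-2k}`. -/
def eProd (k : ℕ) (a : Fin k → ℤ) : Fock := (List.ofFn fun i => e (a i - k)).prod (Om k)

/-- With the indices shifted by `k`, the surplus exponents are `2 i + 1 - k`, exactly those absorbed
by the two Vandermonde determinants. -/
theorem eProd_eq (k : ℕ) (a : Fin k → ℤ) : eProd k a = (-1 : ℂ) ^ (k * (k - 1) / 2) •
    polyAct (hprod k (mono a * (vdm k * vdmInv k))) vacuum := by
  have h1 := list_e_prod_Om k (fun i => a i - k) 0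
  rw [add_zero, Om_zero] at h1
  rw [eProd, h1, ← LinearMap.smul_apply, ← map_smul, ← map_smul, ← mul_smul_comm]
  congr 3
  have h2 : (-1 : ℂ) ^ (k * (k - 1) / 2) • (vdm k * vdmInv k) =
      (-1 : Laurent k) ^ (k * (k - 1) / 2) * (vdm k * vdmInv k) := by
    rw [Algebra.smul_def, map_pow, map_neg, map_one]
  rw [h2, ← mono_mul_prod_sq, ← mul_assoc, ← mono_add]
  congr 2
  funext i
  simp only [Pi.add_apply, Nat.cast_zero]
  ring

end FockSL2
end

noncomputable section
namespace FockSL2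

/-! ### Complete homogeneous symmetric polynomials and the Jacobi–Trudi determinant -/

section Algebra

variable {R : Type*} [CommRing R]

/-- The geometric series `∑ t^n X^n`. -/
def geomSeries (t : R) : PowerSeries R := PowerSeries.mk fun n => t ^ n

theorem geomSeries_mul (t : R) : geomSeries t * (1 - PowerSeries.C t * PowerSeries.X) = 1 := by
  ext n
  rw [mul_sub, mul_one, ← mul_assoc, map_sub, PowerSeries.coeff_one]
  cases n with
  | zero => simp [geomSeries]
  | succ n =>
    rw [PowerSeries.coeff_succ_mul_X, mul_comm, PowerSeries.coeff_C_mul]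
    simp [geomSeries, pow_succ']

/-- The generating series of the complete homogeneous polynomials in `x_0, …, x_{n-1}`. -/
def hgen (x : ℕ → R) (n : ℕ) : PowerSeries R := ∏ i ∈ Finset.range n, geomSeries (x i)

/-- The complete homogeneous polynomial of degree `m` in `x_0, …, x_{n-1}`. -/
def hcomp (x : ℕ → R) (n : ℕ) (m : ℤ) : R :=
  if 0 ≤ m then PowerSeries.coeff m.toNat (hgen x n) else 0

theorem hcomp_of_neg (x : ℕ → R) (n : ℕ) {m : ℤ} (hm : m < 0) : hcomp x n m = 0 :=
  if_neg (not_le.2 hm)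

@[simp] theorem hcomp_natCast (x : ℕ → R) (n m : ℕ) :
    hcomp x n m = PowerSeries.coeff m (hgen x n) := by
  simp [hcomp]

theorem hcomp_zero_left (x : ℕ → R) (m : ℤ) : hcomp x 0 m = if m = 0 then 1 else 0 := by
  rcases lt_or_ge m 0 with hm | hm
  · rw [hcomp_of_neg x 0 hm, if_neg hm.ne]
  · obtain ⟨k, rfl⟩ : ∃ k : ℕ, m = k := ⟨m.toNat, by omega⟩
    simp [hgen, PowerSeries.coeff_one]

theorem hcomp_zero_right (x : ℕ → R) (n : ℕ) : hcomp x n 0 = 1 := by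
  have := hcomp_natCast x n 0
  rw [Nat.cast_zero] at this
  rw [this, PowerSeries.coeff_zero_eq_constantCoeff_apply, hgen, map_prod]
  exact Finset.prod_eq_one fun i _ => by
    rw [← PowerSeries.coeff_zero_eq_constantCoeff_apply]; simp [geomSeries]

theorem hcomp_succ (x : ℕ → R) (n : ℕ) (m : ℤ) :
    hcomp x (n + 1) m = hcomp x n m + x n * hcomp x (n + 1) (m - 1) := by
  have h1 : hgen x (n + 1) * (1 - PowerSeries.C (x n) * PowerSeries.X) = hgen x n := by
    rw [hgen, Finset.prod_range_succ, mul_assoc, geomSeries_mul, mul_one, hgen]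
  rcases lt_trichotomy m 0 with hm | rfl | hm
  · rw [hcomp_of_neg _ _ hm, hcomp_of_neg _ _ hm, hcomp_of_neg _ _ (by omega)]; simp
  · rw [hcomp_zero_right, hcomp_zero_right, hcomp_of_neg _ _ (by omega)]; simp
  · obtain ⟨k, rfl⟩ : ∃ k : ℕ, m = (k : ℤ) + 1 := ⟨(m - 1).toNat, by omega⟩
    have h2 := congrArg (PowerSeries.coeff (k + 1)) h1
    rw [mul_sub, mul_one, ← mul_assoc, map_sub, PowerSeries.coeff_succ_mul_X, mul_comm (hgen _ _),
      PowerSeries.coeff_C_mul] at h2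
    rw [add_sub_cancel_right, show (k : ℤ) + 1 = ((k + 1 : ℕ) : ℤ) by push_cast; ring,
      hcomp_natCast, hcomp_natCast, hcomp_natCast, ← h2]
    ring

/-- Telescopes by `hcomp_succ`. When `a` is the preceding part, the boundary term is a multiple of
an entry of the preceding row of the Jacobi–Trudi matrix in `n + 1` variables. -/
theorem sum_Icc_hcomp (x : ℕ → R) (n a b : ℕ) (hab : a ≤ b) (d : ℤ) :
    ∑ l ∈ Finset.Icc a b, x n ^ (b - l) * hcomp x n (l + d) =
      hcomp x (n + 1) (b + d) - x n ^ (b - a + 1) * hcomp x (n + 1) (a - 1 + d) := by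
  induction b, hab using Nat.le_induction with
  | base =>
    have := hcomp_succ x n ((a : ℤ) + d)
    rw [show (a : ℤ) + d - 1 = a - 1 + d by ring] at this
    simp [this]
  | succ b hab ih =>
    have h1 : ∀ l ∈ Finset.Icc a b, x n ^ (b + 1 - l) * hcomp x n (l + d) =
        x n * (x n ^ (b - l) * hcomp x n (l + d)) := by
      intro l hl
      rw [Finset.mem_Icc] at hl
      rw [Nat.succ_sub hl.2, pow_succ]; ring
    rw [← Finset.insert_Icc_right_eq_Icc_add_one (by omega), Finset.sum_insert (by simp),
      Finset.sum_congr rfl h1, ← Finset.mul_sum, ih, Nat.succ_sub hab,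
      hcomp_succ x n (((b + 1 : ℕ) : ℤ) + d)]
    rw [show ((b + 1 : ℕ) : ℤ) + d - 1 = b + d by push_cast; ring]
    simp only [Nat.sub_self, pow_zero, one_mul, Nat.succ_eq_add_one]
    ring

/-- The part preceding `ν_i` in the increasing sequence `ν`. -/
def prevPart {k : ℕ} (ν : Fin k → ℕ) (i : Fin k) : ℕ :=
  if (i : ℕ) = 0 then 0 else ν ⟨i - 1, by omega⟩

/-- The partitions `λ` (as increasing sequences) for which `ν / λ` is a horizontal strip. -/
def strips {k : ℕ} (ν : Fin k → ℕ) : Finset (Fin k → ℕ) :=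
  Fintype.piFinset fun i => Finset.Icc (prevPart ν i) (ν i)

/-- The Schur polynomial in `x_0, …, x_{n-1}`, defined by the branching rule. -/
def branchSchur {k : ℕ} (x : ℕ → R) : ℕ → (Fin k → ℕ) → R
  | 0, ν => if ν = 0 then 1 else 0
  | n + 1, ν => ∑ μ ∈ strips ν, x n ^ (∑ i, ν i - ∑ i, μ i) * branchSchur x n μ

theorem mem_strips {k : ℕ} {ν μ : Fin k → ℕ} :
    μ ∈ strips ν ↔ ∀ i, prevPart ν i ≤ μ i ∧ μ i ≤ ν i := by
  simp [strips, Fintype.mem_piFinset]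

theorem monotone_of_mem_strips {k : ℕ} {ν μ : Fin k → ℕ} (hν : Monotone ν) (hμ : μ ∈ strips ν) :
    Monotone μ := by
  rw [mem_strips] at hμ
  intro i j hij
  rcases hij.eq_or_lt with rfl | hlt
  · exact le_rfl
  · refine (hμ i).2.trans (le_trans ?_ (hμ j).1)
    have h0 : (j : ℕ) ≠ 0 := by
      have : (i : ℕ) < j := hlt
      omega
    rw [prevPart, if_neg h0]
    refine hν ?_
    rw [Fin.le_def]
    have : (i : ℕ) < j := hlt
    simp only
    omega

/-- The Jacobi–Trudi formula, for partitions written as increasing sequences. -/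
theorem branchSchur_eq_det {k : ℕ} (x : ℕ → R) (n : ℕ) {ν : Fin k → ℕ} (hν : Monotone ν) :
    branchSchur x n ν =
      (Matrix.of fun i j : Fin k => hcomp x n ((ν i : ℤ) + (i : ℕ) - (j : ℕ))).det := by
  induction n generalizing ν with
  | zero =>
    rw [branchSchur]
    split_ifs with h0
    · subst h0
      have : (Matrix.of fun i j : Fin k =>
          hcomp x 0 (((0 : Fin k → ℕ) i : ℤ) + (i : ℕ) - (j : ℕ))) = 1 := by
        ext i j
        rw [Matrix.of_apply, hcomp_zero_left, Matrix.one_apply]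
        congr 1
        rw [Fin.ext_iff]
        simp
        omega
      rw [this, Matrix.det_one]
    · obtain ⟨i, hi⟩ := Function.ne_iff.1 h0
      have hk : 0 < k := lt_of_le_of_lt (Nat.zero_le _) i.2
      symm
      -- Without variables only degree `0` survives, and the last row, that of the largest part, has
      -- positive degrees throughout.
      refine Matrix.det_eq_zero_of_row_eq_zero ⟨k - 1, by omega⟩ fun j => ?_
      have h1 : ν i ≤ ν ⟨k - 1, by omega⟩ := hν (by rw [Fin.le_def]; simp only; omega)
      rw [Matrix.of_apply, hcomp_zero_left, if_neg]
      simp only [Pi.zero_apply] at hi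
      simp only
      omega
  | succ n ih =>
    have h1 : ∀ μ ∈ strips ν, x n ^ (∑ i, ν i - ∑ i, μ i) * branchSchur x n μ =
        (Matrix.of fun i j : Fin k => x n ^ (ν i - μ i) *
          hcomp x n ((μ i : ℤ) + ((i : ℕ) - (j : ℕ)))).det := by
      intro μ hμ
      have h2 : ∑ i, ν i - ∑ i, μ i = ∑ i, (ν i - μ i) :=
        (Finset.sum_tsub_distrib _ fun i _ => ((mem_strips.1 hμ) i).2).symm
      rw [ih (monotone_of_mem_strips hν hμ), h2, ← Finset.prod_pow_eq_pow_sum,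
        ← Matrix.det_mul_column]
      congr 1
      ext i j
      simp only [Matrix.of_apply, add_sub_assoc]
    -- The strips form a product of intervals, one for each row, so multilinearity turns the sum of
    -- determinants into the determinant of the row sums.
    have h3 : ∑ μ ∈ strips ν, (Matrix.of fun i j : Fin k => x n ^ (ν i - μ i) *
        hcomp x n ((μ i : ℤ) + ((i : ℕ) - (j : ℕ)))).det =
        (Matrix.of fun i j : Fin k => ∑ l ∈ Finset.Icc (prevPart ν i) (ν i), x n ^ (ν i - l) *
          hcomp x n ((l : ℤ) + ((i : ℕ) - (j : ℕ)))).det := by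
      have h4 := (Matrix.detRowAlternating (n := Fin k) (R := R)).toMultilinearMap.map_sum_finset
        (fun (i : Fin k) (l : ℕ) (j : Fin k) => x n ^ (ν i - l) *
          hcomp x n ((l : ℤ) + ((i : ℕ) - (j : ℕ))))
        (fun i => Finset.Icc (prevPart ν i) (ν i))
      refine Eq.trans (Eq.symm h4) (congrArg Matrix.det ?_)
      ext i j
      exact Finset.sum_apply j _ _
    have hprev : ∀ i, prevPart ν i ≤ ν i := by
      intro i
      rw [prevPart]
      split_ifs
      · exact Nat.zero_le _
      · exact hν (by rw [Fin.le_def]; simp only; omega)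
    rw [branchSchur, Finset.sum_congr rfl h1, h3]
    cases k with
    | zero => simp
    | succ k =>
      symm
      -- By `sum_Icc_hcomp` each row sum is the desired row minus a multiple of the preceding
      -- desired row, so the determinants agree.
      refine Matrix.det_eq_of_forall_row_eq_smul_add_pred
        (fun i => x n ^ (ν i.succ - ν i.castSucc + 1)) (fun j => ?_) (fun i j => ?_)
      · rw [Matrix.of_apply, Matrix.of_apply, sum_Icc_hcomp x n _ _ (hprev 0),
          hcomp_of_neg x (n + 1) (m := ((prevPart ν 0 : ℕ) : ℤ) - 1 + _) (by
            simp [prevPart]; omega)]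
        simp [sub_eq_add_neg]
      · rw [Matrix.of_apply, Matrix.of_apply, Matrix.of_apply, sum_Icc_hcomp x n _ _ (hprev _)]
        have hp : prevPart ν i.succ = ν i.castSucc := by
          simp [prevPart]; rfl
        rw [hp, show ((ν i.castSucc : ℕ) : ℤ) - 1 + ((i.succ : ℕ) - (j : ℕ)) =
          (ν i.castSucc : ℤ) + (i.castSucc : ℕ) - (j : ℕ) by simp; ring, add_sub_assoc]
        ring

theorem map_hcomp {R' : Type*} [CommRing R'] (φ : R →+* R') (x : ℕ → R) (n : ℕ) (m : ℤ) :
    φ (hcomp x n m) = hcomp (fun i => φ (x i)) n m := by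
  rw [hcomp, hcomp]
  split_ifs
  · rw [← PowerSeries.coeff_map, hgen, map_prod (PowerSeries.map φ), hgen]
    refine congrArg _ (Finset.prod_congr rfl fun i _ => ?_)
    ext l
    simp [geomSeries]
  · exact map_zero φ

theorem map_branchSchur {R' : Type*} [CommRing R'] (φ : R →+* R') {k : ℕ} (x : ℕ → R) (n : ℕ)
    (ν : Fin k → ℕ) : φ (branchSchur x n ν) = branchSchur (fun i => φ (x i)) n ν := by
  induction n generalizing ν with
  | zero =>
    rw [branchSchur, branchSchur]
    split_ifs <;> simp
  | succ n ih =>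
    rw [branchSchur, branchSchur, map_sum]
    refine Finset.sum_congr rfl fun μ _ => ?_
    rw [map_mul, map_pow, ih]

theorem coeff_prod_one_sub_eq_zero {ι : Type*} (s : Finset ι) (z : ι → R) {j : ℕ}
    (hj : s.card < j) :
    PowerSeries.coeff j (∏ m ∈ s, (1 - PowerSeries.C (z m) * PowerSeries.X)) = 0 := by
  have h1 : (∏ m ∈ s, (1 - PowerSeries.C (z m) * PowerSeries.X) : PowerSeries R) =
      ((∏ m ∈ s, (1 - Polynomial.C (z m) * Polynomial.X) : Polynomial R) : PowerSeries R) := by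
    rw [← Polynomial.coeToPowerSeries.ringHom_apply, map_prod]
    refine Finset.prod_congr rfl fun m _ => ?_
    simp
  rw [h1, Polynomial.coeff_coe, Polynomial.coeff_eq_zero_of_natDegree_lt]
  refine lt_of_le_of_lt (Polynomial.natDegree_prod_le _ _) (lt_of_le_of_lt ?_ hj)
  rw [Finset.card_eq_sum_ones]
  refine Finset.sum_le_sum fun m _ => ?_
  refine (Polynomial.natDegree_sub_le _ _).trans ?_
  simp only [Polynomial.natDegree_one, zero_le, sup_of_le_right]
  exact (Polynomial.natDegree_C_mul_le _ _).trans Polynomial.natDegree_X_le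

/-- The bialternant formula: an alternant is the product of the Vandermonde determinant and a
determinant of complete homogeneous polynomials. -/
theorem alternant_eq {k : ℕ} (x : ℕ → R) (c : Fin k → ℕ) :
    (Matrix.of fun l i : Fin k => x l ^ c i).det =
      (Matrix.vandermonde fun l : Fin k => x l).det *
        (Matrix.of fun i j : Fin k => hcomp x k ((c i : ℤ) - (j : ℕ))).det := by
  classical
  -- `E l` generates the signed elementary symmetric polynomials without `x_l`; multiplied by `hgen`
  -- it leaves the geometric series of `x_l`. Comparing coefficients factors the alternant through a
  -- matrix `M` that does not depend on `c`.
  set E : Fin k → PowerSeries R := fun l => ∏ m ∈ Finset.univ.erase l,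
    (1 - PowerSeries.C (x (m : ℕ)) * PowerSeries.X) with hE
  set M : Matrix (Fin k) (Fin k) R := Matrix.of fun l j => PowerSeries.coeff (j : ℕ) (E l) with hM
  have hgeom : ∀ l : Fin k, E l * hgen x k = geomSeries (x l) := by
    intro l
    have h1 : hgen x k = ∏ m : Fin k, geomSeries (x m) := by
      rw [hgen, ← Fin.prod_univ_eq_prod_range]
    rw [h1, ← Finset.mul_prod_erase _ _ (Finset.mem_univ l), mul_left_comm,
      ← Finset.prod_mul_distrib, Finset.prod_eq_one, mul_one]
    intro m _
    rw [mul_comm, geomSeries_mul]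
  have key : ∀ c : Fin k → ℕ, (Matrix.of fun l i : Fin k => x l ^ c i) =
      M * (Matrix.of fun i j : Fin k => hcomp x k ((c i : ℤ) - (j : ℕ))).transpose := by
    intro c
    ext l i
    rw [Matrix.of_apply, Matrix.mul_apply]
    simp only [Matrix.transpose_apply, Matrix.of_apply, hM]
    have h1 := congrArg (PowerSeries.coeff (c i)) (hgeom l)
    rw [PowerSeries.coeff_mul] at h1
    have h2 : PowerSeries.coeff (c i) (geomSeries (x l)) = x l ^ c i := by simp [geomSeries]
    rw [← h2, ← h1, Finset.Nat.sum_antidiagonal_eq_sum_range_succ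
      (fun a b => PowerSeries.coeff a (E l) * PowerSeries.coeff b (hgen x k)),
      Fin.sum_univ_eq_sum_range (fun j : ℕ =>
        PowerSeries.coeff j (E l) * hcomp x k ((c i : ℤ) - (j : ℤ)))]
    have h3 : ∀ j ∈ Finset.range (c i + 1),
        PowerSeries.coeff j (E l) * PowerSeries.coeff (c i - j) (hgen x k) =
        PowerSeries.coeff j (E l) * hcomp x k ((c i : ℤ) - (j : ℤ)) := by
      intro j hj
      rw [Finset.mem_range] at hj
      rw [← hcomp_natCast, Nat.cast_sub (by omega)]
    rw [Finset.sum_congr rfl h3]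
    have hzero : ∀ j : ℕ, k ≤ j → PowerSeries.coeff j (E l) = 0 := by
      intro j hj
      refine coeff_prod_one_sub_eq_zero _ _ ?_
      rw [Finset.card_erase_of_mem (Finset.mem_univ l), Finset.card_univ, Fintype.card_fin]
      have := l.2
      omega
    rcases le_total k (c i + 1) with hk | hk
    · symm
      refine Finset.sum_subset (Finset.range_subset_range.2 hk) fun j _ hj => ?_
      rw [Finset.mem_range, not_lt] at hj
      rw [hzero j hj, zero_mul]
    · refine Finset.sum_subset (Finset.range_subset_range.2 hk) fun j _ hj => ?_
      rw [Finset.mem_range, not_lt] at hj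
      rw [hcomp_of_neg _ _ (by omega), mul_zero]
  -- For the exponents `0, …, k - 1` the second factor is unitriangular, which identifies `det M`
  -- with the Vandermonde determinant.
  have hdet1 : (Matrix.of fun i j : Fin k =>
      hcomp x k (((fun i : Fin k => (i : ℕ)) i : ℤ) - (j : ℕ))).det = 1 := by
    rw [Matrix.det_of_isLowerTriangular]
    · exact Finset.prod_eq_one fun i _ => by
        rw [Matrix.of_apply, sub_self, hcomp_zero_right]
    · intro i j hij
      have : (i : ℕ) < j := hij
      rw [Matrix.of_apply, hcomp_of_neg]
      simp only
      omega
  have hvdm : (Matrix.vandermonde fun l : Fin k => x l).det = M.det := by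
    have := congrArg Matrix.det (key fun i => (i : ℕ))
    rw [Matrix.det_mul, Matrix.det_transpose, hdet1, mul_one] at this
    exact this
  rw [key c, Matrix.det_mul, Matrix.det_transpose, hvdm]

end Algebra

end FockSL2
end

noncomputable section
namespace FockSL2

/-! ### Tableaux and the branching rule -/

section Tableaux

variable {k : ℕ}

/-- The `i`-th row length of the diagram whose row lengths, in increasing order, are `ν`. -/
def descRow (ν : Fin k → ℕ) (i : ℕ) : ℕ := if hi : i < k then ν ⟨k - 1 - i, by omega⟩ else 0

/-- The diagram whose row lengths, in increasing order, are `ν`. -/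
def ofAsc (ν : Fin k → ℕ) : YoungDiagram where
  cells := Finset.univ.biUnion fun l : Fin k => Finset.range (k - l) ×ˢ Finset.range (ν l)
  isLowerSet := by
    rintro ⟨i, j⟩ ⟨i', j'⟩ ⟨h1, h2⟩ h
    simp only [Finset.coe_biUnion, Set.mem_iUnion, Finset.mem_coe, Finset.mem_product,
      Finset.mem_range] at h ⊢
    obtain ⟨l, hl, hi, hj⟩ := h
    exact ⟨l, hl, lt_of_le_of_lt h1 hi, lt_of_le_of_lt h2 hj⟩

/-- The `k` row lengths of a diagram in increasing order. -/
def ascRows (k : ℕ) (D : YoungDiagram) (i : Fin k) : ℕ := D.rowLen (k - 1 - i)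

theorem descRow_rev (ν : Fin k → ℕ) (i : Fin k) : descRow ν (k - 1 - i) = ν i := by
  rw [descRow, dif_pos (by omega)]
  congr 1
  ext
  simp only
  omega

theorem mem_ofAsc {ν : Fin k → ℕ} (hν : Monotone ν) (i j : ℕ) :
    (i, j) ∈ ofAsc ν ↔ j < descRow ν i := by
  rw [← YoungDiagram.mem_cells]
  simp only [ofAsc, Finset.mem_biUnion, Finset.mem_univ, true_and, Finset.mem_product,
    Finset.mem_range]
  constructor
  · rintro ⟨l, hi, hj⟩
    rw [descRow, dif_pos (by omega)]
    refine lt_of_lt_of_le hj (hν ?_)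
    rw [Fin.le_def]
    simp only
    omega
  · intro h
    rw [descRow] at h
    split_ifs at h with hi
    · exact ⟨_, by simp only; omega, h⟩
    · omega

theorem rowLen_ofAsc {ν : Fin k → ℕ} (hν : Monotone ν) (i : ℕ) :
    (ofAsc ν).rowLen i = descRow ν i := by
  refine eq_of_forall_lt_iff fun j => ?_
  rw [← YoungDiagram.mem_iff_lt_rowLen, mem_ofAsc hν]

theorem ascRows_ofAsc {ν : Fin k → ℕ} (hν : Monotone ν) : ascRows k (ofAsc ν) = ν := by
  ext i
  rw [ascRows, rowLen_ofAsc hν, descRow_rev]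

theorem monotone_ascRows (k : ℕ) (D : YoungDiagram) : Monotone (ascRows k D) := by
  intro i j hij
  refine D.rowLen_anti _ _ ?_
  rw [Fin.le_def] at hij
  omega

theorem descRow_ascRows {D : YoungDiagram} (hD : ∀ c ∈ D, c.1 < k) (i : ℕ) :
    descRow (ascRows k D) i = D.rowLen i := by
  rw [descRow]
  split_ifs with hi
  · rw [ascRows]
    congr 1
    simp only
    omega
  · by_contra h
    have h0 : (i, 0) ∈ D := YoungDiagram.mem_iff_lt_rowLen.2 (by omega)
    exact hi (hD _ h0)

theorem ofAsc_ascRows {D : YoungDiagram} (hD : ∀ c ∈ D, c.1 < k) : ofAsc (ascRows k D) = D := by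
  refine YoungDiagram.ext ?_
  ext ⟨i, j⟩
  rw [YoungDiagram.mem_cells, YoungDiagram.mem_cells, mem_ofAsc (monotone_ascRows k D),
    descRow_ascRows hD, YoungDiagram.mem_iff_lt_rowLen]

theorem fst_lt_of_mem_ofAsc {ν : Fin k → ℕ} (hν : Monotone ν) : ∀ c ∈ ofAsc ν, c.1 < k := by
  rintro ⟨i, j⟩ h
  rw [mem_ofAsc hν, descRow] at h
  split_ifs at h with hi
  · exact hi
  · omega

theorem card_ofAsc {ν : Fin k → ℕ} (hν : Monotone ν) : (ofAsc ν).card = ∑ i, ν i := by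
  have h1 : (ofAsc ν).cells = Finset.univ.biUnion fun l : Fin k =>
      ({k - 1 - (l : ℕ)} : Finset ℕ) ×ˢ Finset.range (ν l) := by
    ext ⟨i, j⟩
    rw [YoungDiagram.mem_cells, mem_ofAsc hν]
    simp only [Finset.mem_biUnion, Finset.mem_univ, true_and, Finset.mem_product,
      Finset.mem_singleton, Finset.mem_range]
    constructor
    · intro h
      rw [descRow] at h
      split_ifs at h with hi
      · exact ⟨_, by simp only; omega, h⟩
      · omega
    · rintro ⟨l, rfl, h⟩
      rwa [descRow_rev]
  rw [YoungDiagram.card, h1, Finset.card_biUnion]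
  · simp
  · intro l _ m _ hlm
    rw [Function.onFun, Finset.disjoint_left]
    rintro ⟨i, j⟩ h2 h3
    simp only [Finset.mem_product, Finset.mem_singleton] at h2 h3
    apply hlm
    ext
    have := l.2
    have := m.2
    omega

theorem descRow_le_of_mem_strips {ν μ : Fin k → ℕ} (hμ : μ ∈ strips ν) (i : ℕ) :
    descRow μ i ≤ descRow ν i := by
  rw [descRow, descRow]
  split_ifs with hi
  · exact ((mem_strips.1 hμ) _).2
  · exact le_rfl

theorem descRow_succ_le_of_mem_strips {ν μ : Fin k → ℕ} (hμ : μ ∈ strips ν) (i : ℕ) :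
    descRow ν (i + 1) ≤ descRow μ i := by
  rw [descRow]
  split_ifs with hi
  · rw [descRow, dif_pos (by omega)]
    refine le_trans ?_ ((mem_strips.1 hμ) _).1
    rw [prevPart, if_neg (by simp only; omega)]
    refine le_of_eq (congrArg ν ?_)
    ext
    simp only
    omega
  · exact Nat.zero_le _

theorem mem_strips_of_descRow {ν μ : Fin k → ℕ} (h1 : ∀ i, descRow μ i ≤ descRow ν i)
    (h2 : ∀ i, descRow ν (i + 1) ≤ descRow μ i) : μ ∈ strips ν := by
  rw [mem_strips]
  intro i
  rw [← descRow_rev μ i, ← descRow_rev ν i]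
  refine ⟨?_, h1 _⟩
  rw [prevPart]
  split_ifs with hi
  · exact Nat.zero_le _
  · refine le_trans (le_of_eq ?_) (h2 _)
    rw [descRow, dif_pos (by omega)]
    congr 1
    ext
    simp only
    omega

theorem ofAsc_le_of_mem_strips {ν μ : Fin k → ℕ} (hν : Monotone ν) (hμ : μ ∈ strips ν) {i j : ℕ}
    (h : (i, j) ∈ ofAsc μ) : (i, j) ∈ ofAsc ν := by
  rw [mem_ofAsc (monotone_of_mem_strips hν hμ)] at h
  rw [mem_ofAsc hν]
  exact lt_of_lt_of_le h (descRow_le_of_mem_strips hμ i)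

/-- The semistandard tableaux of shape `D` and content `a`. -/
abbrev TableauOf (D : YoungDiagram) (a : ℕ → ℕ) : Type :=
  {T : SemistandardYoungTableau D // ∀ i, (D.cells.filter fun c => T c.1 c.2 = i).card = a i}

theorem TableauOf.ne_zero {D : YoungDiagram} {a : ℕ → ℕ} (T : TableauOf D a) {i j : ℕ}
    (h : (i, j) ∈ D) : a (T.1 i j) ≠ 0 := by
  rw [← T.2, Finset.card_ne_zero]
  exact ⟨(i, j), by simp [h]⟩

theorem TableauOf.lt {D : YoungDiagram} {a : ℕ → ℕ} {n : ℕ} (ha : ∀ i, n ≤ i → a i = 0)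
    (T : TableauOf D a) {i j : ℕ} (h : (i, j) ∈ D) : T.1 i j < n := by
  by_contra hn
  exact T.ne_zero h (ha _ (not_lt.1 hn))

/-- Extension of a tableau by the entries `n` in a horizontal strip. -/
def extendTableau {ν μ : Fin k → ℕ} (hν : Monotone ν) (hμ : μ ∈ strips ν) {n : ℕ} {a : ℕ → ℕ}
    (ha : ∀ i, n < i → a i = 0) (hn : (∑ i, ν i) = (∑ i, μ i) + a n)
    (T : TableauOf (ofAsc μ) (Function.update a n 0)) : TableauOf (ofAsc ν) a := by
  classical
  have hμ' := monotone_of_mem_strips hν hμ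
  have hT : ∀ {i j : ℕ}, (i, j) ∈ ofAsc μ → T.1 i j < n := by
    refine T.lt fun i hi => ?_
    rcases hi.eq_or_lt with rfl | hi
    · simp
    · rw [Function.update_of_ne hi.ne', ha i hi]
  have hval : ∀ c : ℕ × ℕ, c ∈ ofAsc ν →
      (if c ∈ ofAsc μ then T.1 c.1 c.2 else if c ∈ ofAsc ν then n else 0) =
        if c ∈ ofAsc μ then T.1 c.1 c.2 else n := by
    intro c hc
    rw [if_pos hc]
  refine ⟨{ entry := fun i j =>
              if (i, j) ∈ ofAsc μ then T.1 i j else if (i, j) ∈ ofAsc ν then n else 0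
            row_weak' := ?_
            col_strict' := ?_
            zeros' := ?_ }, ?_⟩
  · intro i j1 j2 hj h2
    have h1 : (i, j1) ∈ ofAsc ν := (ofAsc ν).up_left_mem le_rfl hj.le h2
    rw [if_pos h1, if_pos h2]
    by_cases h3 : (i, j2) ∈ ofAsc μ
    · have h4 : (i, j1) ∈ ofAsc μ := (ofAsc μ).up_left_mem le_rfl hj.le h3
      rw [if_pos h3, if_pos h4]
      exact T.1.row_weak hj h3
    · rw [if_neg h3]
      split_ifs with h4
      · exact (hT h4).le
      · exact le_rfl
  · intro i1 i2 j hi h2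
    -- Horizontal strip: row `i1 + 1` of the outer shape is no longer than row `i1` of the inner
    -- one, so a cell with another below it carries an old entry.
    have h1 : (i1, j) ∈ ofAsc μ := by
      rw [mem_ofAsc hμ']
      rw [mem_ofAsc hν] at h2
      have h3 : (i1 + 1, j) ∈ ofAsc ν :=
        (ofAsc ν).up_left_mem (Nat.succ_le_of_lt hi) le_rfl ((mem_ofAsc hν _ _).2 h2)
      rw [mem_ofAsc hν] at h3
      exact lt_of_lt_of_le h3 (descRow_succ_le_of_mem_strips hμ i1)
    rw [if_pos h1, if_pos h2]
    split_ifs with h3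
    · exact T.1.col_strict hi h3
    · exact hT h1
  · intro i j h
    rw [if_neg fun h' => h (ofAsc_le_of_mem_strips hν hμ h'), if_neg h]
  · intro l
    change ((ofAsc ν).cells.filter fun c =>
      (if c ∈ ofAsc μ then T.1 c.1 c.2 else if c ∈ ofAsc ν then n else 0) = l).card = a l
    by_cases hl : l = n
    · subst hl
      have h1 : ((ofAsc ν).cells.filter fun c =>
          (if c ∈ ofAsc μ then T.1 c.1 c.2 else if c ∈ ofAsc ν then l else 0) = l) =
          (ofAsc ν).cells \ (ofAsc μ).cells := by
        ext c
        rw [Finset.mem_filter, Finset.mem_sdiff, YoungDiagram.mem_cells, YoungDiagram.mem_cells]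
        refine and_congr_right fun hc => ?_
        rw [hval c hc]
        by_cases h2 : c ∈ ofAsc μ
        · simp [h2, (hT (i := c.1) (j := c.2) h2).ne]
        · simp [h2]
      rw [h1, Finset.card_sdiff_of_subset fun c hc => ?_]
      · change (ofAsc ν).card - (ofAsc μ).card = _
        rw [card_ofAsc hν, card_ofAsc hμ', hn]
        omega
      · exact ofAsc_le_of_mem_strips hν hμ hc
    · rw [← Function.update_of_ne hl 0 a, ← T.2 l]
      congr 1
      ext c
      rw [Finset.mem_filter, Finset.mem_filter, YoungDiagram.mem_cells, YoungDiagram.mem_cells]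
      constructor
      · rintro ⟨hc, h2⟩
        rw [hval c hc] at h2
        split_ifs at h2 with h3
        · exact ⟨h3, h2⟩
        · exact absurd h2.symm hl
      · rintro ⟨hc, h2⟩
        exact ⟨ofAsc_le_of_mem_strips hν hμ hc, by rw [if_pos hc, h2]⟩

open Classical in
theorem extendTableau_apply {ν μ : Fin k → ℕ} (hν : Monotone ν) (hμ : μ ∈ strips ν) {n : ℕ}
    {a : ℕ → ℕ} (ha : ∀ i, n < i → a i = 0) (hn : (∑ i, ν i) = (∑ i, μ i) + a n)
    (T : TableauOf (ofAsc μ) (Function.update a n 0)) (i j : ℕ) :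
    (extendTableau hν hμ ha hn T).1 i j =
      if (i, j) ∈ ofAsc μ then T.1 i j else if (i, j) ∈ ofAsc ν then n else 0 := by
  rw [extendTableau]
  rfl

/-- The inner shape is recovered from the extended tableau as the cells with entries below `n`; this
gives injectivity of the extension. -/
theorem extendTableau_lt_iff {ν μ : Fin k → ℕ} (hν : Monotone ν) (hμ : μ ∈ strips ν) {n : ℕ}
    {a : ℕ → ℕ} (ha : ∀ i, n < i → a i = 0) (hn : (∑ i, ν i) = (∑ i, μ i) + a n)
    (T : TableauOf (ofAsc μ) (Function.update a n 0)) (i j : ℕ) :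
    (i, j) ∈ ofAsc μ ↔ (i, j) ∈ ofAsc ν ∧ (extendTableau hν hμ ha hn T).1 i j < n := by
  rw [extendTableau_apply]
  constructor
  · intro h
    refine ⟨ofAsc_le_of_mem_strips hν hμ h, ?_⟩
    rw [if_pos h]
    refine T.lt (fun i hi => ?_) h
    rcases hi.eq_or_lt with rfl | hi
    · simp
    · rw [Function.update_of_ne hi.ne', ha i hi]
  · rintro ⟨h1, h2⟩
    by_contra h3
    rw [if_neg h3, if_pos h1] at h2
    exact lt_irrefl _ h2

/-- Since entries do not decrease along rows and columns, the cells with entries below `n` form a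
diagram. Strictness in the columns makes its complement, filled with `n`, a horizontal strip. -/
theorem extendTableau_surjective {ν : Fin k → ℕ} (hν : Monotone ν) {n : ℕ} {a : ℕ → ℕ}
    (ha : ∀ i, n < i → a i = 0) (T : TableauOf (ofAsc ν) a) :
    ∃ (μ : Fin k → ℕ) (hμ : μ ∈ strips ν) (hn : (∑ i, ν i) = (∑ i, μ i) + a n)
      (T' : TableauOf (ofAsc μ) (Function.update a n 0)), extendTableau hν hμ ha hn T' = T := by
  classical
  have hT : ∀ {i j : ℕ}, (i, j) ∈ ofAsc ν → T.1 i j < n + 1 := T.lt fun i hi => ha i hi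
  let D : YoungDiagram :=
    { cells := (ofAsc ν).cells.filter fun c => T.1 c.1 c.2 < n
      isLowerSet := by
        rintro ⟨i, j⟩ ⟨i', j'⟩ ⟨h1, h2⟩ h
        simp only [Finset.coe_filter, Set.mem_ofPred_eq, YoungDiagram.mem_cells] at h ⊢
        have h3 : (i', j) ∈ ofAsc ν := (ofAsc ν).up_left_mem h1 le_rfl h.1
        refine ⟨(ofAsc ν).up_left_mem h1 h2 h.1, lt_of_le_of_lt ?_ h.2⟩
        exact (T.1.row_weak_of_le h2 h3).trans (T.1.col_weak h1 h.1) }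
  have hD : ∀ c, c ∈ D ↔ c ∈ ofAsc ν ∧ T.1 c.1 c.2 < n := by
    intro c
    rw [← YoungDiagram.mem_cells, Finset.mem_filter, YoungDiagram.mem_cells]
  have hDk : ∀ c ∈ D, c.1 < k := fun c hc => fst_lt_of_mem_ofAsc hν c ((hD c).1 hc).1
  have hDe := ofAsc_ascRows hDk
  have hμm := monotone_ascRows k D
  have hμ : ascRows k D ∈ strips ν := by
    refine mem_strips_of_descRow (fun i => ?_) (fun i => ?_)
    · refine le_of_forall_lt fun j hj => ?_
      rw [← mem_ofAsc hμm, hDe, hD] at hj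
      exact (mem_ofAsc hν _ _).1 hj.1
    · refine le_of_forall_lt fun j hj => ?_
      rw [← mem_ofAsc hν] at hj
      rw [← mem_ofAsc hμm, hDe, hD]
      refine ⟨(ofAsc ν).up_left_mem (Nat.le_succ i) le_rfl hj, ?_⟩
      have h1 := T.1.col_strict (show i < i + 1 by omega) hj
      have h2 := hT hj
      simp only
      omega
  have hsub : D.cells ⊆ (ofAsc ν).cells := Finset.filter_subset _ _
  have hn : (∑ i, ν i) = (∑ i, ascRows k D i) + a n := by
    rw [← card_ofAsc hν, ← card_ofAsc hμm, hDe, ← T.2 n]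
    have h1 : ((ofAsc ν).cells.filter fun c => T.1 c.1 c.2 = n) =
        (ofAsc ν).cells \ D.cells := by
      ext c
      rw [Finset.mem_filter, Finset.mem_sdiff, YoungDiagram.mem_cells, YoungDiagram.mem_cells, hD]
      refine and_congr_right fun hc => ?_
      have := hT (i := c.1) (j := c.2) hc
      simp only [hc, true_and]
      omega
    rw [h1, Finset.card_sdiff_of_subset hsub]
    have := Finset.card_le_card hsub
    change (ofAsc ν).cells.card = D.cells.card + _
    omega
  have hmem : ∀ c, c ∈ ofAsc (ascRows k D) ↔ c ∈ ofAsc ν ∧ T.1 c.1 c.2 < n := by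
    intro c; rw [hDe, hD]
  refine ⟨ascRows k D, hμ, hn, ⟨{ entry := fun i j => if (i, j) ∈ ofAsc (ascRows k D) then T.1 i j else 0
                                  row_weak' := ?_
                                  col_strict' := ?_
                                  zeros' := ?_ }, ?_⟩, ?_⟩
  · intro i j1 j2 hj h2
    rw [if_pos h2, if_pos ((ofAsc _).up_left_mem le_rfl hj.le h2)]
    exact T.1.row_weak hj ((hmem _).1 h2).1
  · intro i1 i2 j hi h2
    rw [if_pos h2, if_pos ((ofAsc _).up_left_mem hi.le le_rfl h2)]
    exact T.1.col_strict hi ((hmem _).1 h2).1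
  · intro i j h
    rw [if_neg h]
  · intro l
    change ((ofAsc (ascRows k D)).cells.filter fun c =>
      (if c ∈ ofAsc (ascRows k D) then T.1 c.1 c.2 else 0) = l).card = _
    by_cases hl : l = n
    · subst hl
      rw [Function.update_self, Finset.card_eq_zero, Finset.filter_eq_empty_iff]
      intro c hc
      rw [YoungDiagram.mem_cells] at hc
      rw [if_pos hc]
      exact ((hmem c).1 hc).2.ne
    · rw [Function.update_of_ne hl, ← T.2 l]
      congr 1
      ext c
      rw [Finset.mem_filter, Finset.mem_filter, YoungDiagram.mem_cells, YoungDiagram.mem_cells]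
      constructor
      · rintro ⟨h1, h2⟩
        rw [if_pos h1] at h2
        exact ⟨((hmem c).1 h1).1, h2⟩
      · rintro ⟨h1, h2⟩
        have h3 := hT (i := c.1) (j := c.2) h1
        have h4 : c ∈ ofAsc (ascRows k D) := (hmem c).2 ⟨h1, by omega⟩
        exact ⟨h4, by rw [if_pos h4, h2]⟩
  · refine Subtype.ext (SemistandardYoungTableau.ext fun i j => ?_)
    rw [extendTableau_apply]
    split_ifs with h1 h2
    · exact if_pos h1
    · have h3 := hT h2
      have h4 : ¬ T.1 i j < n := fun h => h1 ((hmem _).2 ⟨h2, h⟩)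
      omega
    · exact (T.1.zeros h2).symm

/-- The index set of the branching rule. -/
abbrev Strip (ν : Fin k → ℕ) (p : ℕ) : Type :=
  {μ : Fin k → ℕ // μ ∈ (strips ν).filter fun μ => (∑ i, ν i) = (∑ i, μ i) + p}

theorem Strip.mem {ν : Fin k → ℕ} {p : ℕ} (μ : Strip ν p) : μ.1 ∈ strips ν :=
  (Finset.mem_filter.1 μ.2).1

theorem Strip.sum_eq {ν : Fin k → ℕ} {p : ℕ} (μ : Strip ν p) :
    (∑ i, ν i) = (∑ i, μ.1 i) + p := (Finset.mem_filter.1 μ.2).2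

theorem extendTableau_bijective {ν : Fin k → ℕ} (hν : Monotone ν) {n : ℕ} {a : ℕ → ℕ}
    (ha : ∀ i, n < i → a i = 0) :
    Function.Bijective fun p : (Σ μ : Strip ν (a n),
      TableauOf (ofAsc μ.1) (Function.update a n 0)) =>
        extendTableau hν p.1.mem ha p.1.sum_eq p.2 := by
  constructor
  · rintro ⟨⟨μ, hμ⟩, T⟩ ⟨⟨μ', hμ'⟩, T'⟩ h
    have hh := Finset.mem_filter.1 hμ
    have hh' := Finset.mem_filter.1 hμ'
    simp only at h
    have hm : μ = μ' := by
      have h1 : ofAsc μ = ofAsc μ' := by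
        refine YoungDiagram.ext ?_
        ext ⟨i, j⟩
        rw [YoungDiagram.mem_cells, YoungDiagram.mem_cells,
          extendTableau_lt_iff hν hh.1 ha hh.2 T, extendTableau_lt_iff hν hh'.1 ha hh'.2 T', h]
      rw [← ascRows_ofAsc (monotone_of_mem_strips hν hh.1), h1,
        ascRows_ofAsc (monotone_of_mem_strips hν hh'.1)]
    subst hm
    have hT : T = T' := by
      refine Subtype.ext (SemistandardYoungTableau.ext fun i j => ?_)
      have h2 := congrArg (fun S : TableauOf (ofAsc ν) a => S.1 i j) h
      simp only [extendTableau_apply] at h2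
      by_cases h3 : (i, j) ∈ ofAsc μ
      · simpa [h3] using h2
      · rw [T.1.zeros h3, T'.1.zeros h3]
    rw [hT]
  · intro T
    obtain ⟨μ, hμ, hn, T', h⟩ := extendTableau_surjective hν ha T
    exact ⟨⟨⟨μ, Finset.mem_filter.2 ⟨hμ, hn⟩⟩, T'⟩, h⟩

theorem tableauOf_zero_isEmpty {ν : Fin k → ℕ} (h0 : ν ≠ 0) (hν : Monotone ν) {a : ℕ → ℕ}
    (ha : ∀ i, a i = 0) : IsEmpty (TableauOf (ofAsc ν) a) := by
  refine ⟨fun T => ?_⟩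
  obtain ⟨i, hi⟩ := Function.ne_iff.1 h0
  have h1 : (k - 1 - (i : ℕ), 0) ∈ ofAsc ν := by
    rw [mem_ofAsc hν, descRow_rev]
    exact Nat.pos_of_ne_zero hi
  exact T.ne_zero h1 (ha _)

theorem ofAsc_zero : ofAsc (0 : Fin k → ℕ) = ⊥ := by
  refine YoungDiagram.ext ?_
  ext ⟨i, j⟩
  rw [YoungDiagram.mem_cells, mem_ofAsc (show Monotone (0 : Fin k → ℕ) from fun _ _ _ => le_rfl)]
  simp [descRow]

theorem card_tableauOf_bot {a : ℕ → ℕ} (ha : ∀ i, a i = 0) :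
    Nonempty (Unique (TableauOf ⊥ a)) := by
  refine ⟨⟨⟨⟨⟨fun _ _ => 0, ?_, ?_, ?_⟩, ?_⟩⟩, ?_⟩⟩
  · intro i j1 j2 _ h
    exact absurd h (YoungDiagram.notMem_bot _)
  · intro i j1 j2 _ h
    exact absurd h (YoungDiagram.notMem_bot _)
  · intro i j _
    rfl
  · intro i
    simp [ha]
  · intro T
    refine Subtype.ext (SemistandardYoungTableau.ext fun i j => ?_)
    rw [T.1.zeros (YoungDiagram.notMem_bot _)]
    rfl

/-- Needed so that `Nat.card` of the disjoint union in the branching rule is the sum of the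
cardinalities. -/
theorem finite_tableauOf {ν : Fin k → ℕ} (hν : Monotone ν) (n : ℕ) {a : ℕ → ℕ}
    (ha : ∀ i, n ≤ i → a i = 0) : Finite (TableauOf (ofAsc ν) a) := by
  induction n generalizing ν a with
  | zero =>
    by_cases h0 : ν = 0
    · subst h0
      rw [ofAsc_zero]
      obtain ⟨h⟩ := card_tableauOf_bot (a := a) fun i => ha i (Nat.zero_le i)
      infer_instance
    · have := tableauOf_zero_isEmpty h0 hν fun i => ha i (Nat.zero_le i)
      infer_instance
  | succ n ih =>
    have h1 : ∀ μ : Strip ν (a n), Finite (TableauOf (ofAsc μ.1) (Function.update a n 0)) := by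
      intro μ
      refine ih (monotone_of_mem_strips hν μ.mem) fun i hi => ?_
      rcases hi.eq_or_lt with rfl | hi
      · simp
      · rw [Function.update_of_ne hi.ne', ha i hi]
    exact Finite.of_surjective _ (extendTableau_bijective hν fun i hi => ha i hi).2

/-- The branching rule for Kostka numbers. -/
theorem kostka_ofAsc_succ {ν : Fin k → ℕ} (hν : Monotone ν) (n : ℕ) {a : ℕ → ℕ}
    (ha : ∀ i, n < i → a i = 0) :
    kostka (ofAsc ν) a = ∑ μ ∈ (strips ν).filter fun μ => (∑ i, ν i) = (∑ i, μ i) + a n,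
      kostka (ofAsc μ) (Function.update a n 0) := by
  have h1 : ∀ μ : Strip ν (a n), Finite (TableauOf (ofAsc μ.1) (Function.update a n 0)) := by
    intro μ
    refine finite_tableauOf (monotone_of_mem_strips hν μ.mem) n fun i hi => ?_
    rcases hi.eq_or_lt with rfl | hi
    · simp
    · rw [Function.update_of_ne hi.ne', ha i hi]
  have h2 := Nat.card_congr (Equiv.ofBijective _ (extendTableau_bijective hν ha))
  rw [Nat.card_sigma] at h2
  rw [← Finset.sum_coe_sort]
  exact h2.symm

open MvPolynomial in
/-- The coefficients of a Schur polynomial are the Kostka numbers. -/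
theorem coeff_branchSchur {ν : Fin k → ℕ} (hν : Monotone ν) (n : ℕ) (d : ℕ →₀ ℕ) :
    coeff d (branchSchur (X : ℕ → MvPolynomial ℕ ℂ) n ν) =
      if d.support ⊆ Finset.range n then (kostka (ofAsc ν) d : ℂ) else 0 := by
  induction n generalizing ν d with
  | zero =>
    have hs : d.support ⊆ Finset.range 0 ↔ d = 0 := by simp
    simp only [branchSchur, hs]
    by_cases hd : d = 0
    · rw [if_pos hd]
      subst hd
      by_cases h0 : ν = 0
      · rw [if_pos h0, h0, ofAsc_zero, coeff_zero_one]
        obtain ⟨h⟩ := card_tableauOf_bot (a := (0 : ℕ →₀ ℕ)) fun i => rfl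
        have : kostka ⊥ (0 : ℕ →₀ ℕ) = 1 := Nat.card_unique
        rw [this, Nat.cast_one]
      · have h1 := tableauOf_zero_isEmpty h0 hν (a := (0 : ℕ →₀ ℕ)) fun i => rfl
        have : kostka (ofAsc ν) (0 : ℕ →₀ ℕ) = 0 := Nat.card_of_isEmpty
        rw [if_neg h0, this, coeff_zero, Nat.cast_zero]
    · rw [if_neg hd]
      split_ifs
      · rw [coeff_one, if_neg (Ne.symm hd)]
      · exact coeff_zero _
  | succ n ih =>
    rw [branchSchur, coeff_sum]
    have h1 : ∀ μ ∈ strips ν, coeff d (X n ^ (∑ i, ν i - ∑ i, μ i) *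
        branchSchur (X : ℕ → MvPolynomial ℕ ℂ) n μ) =
        if (∑ i, ν i) = (∑ i, μ i) + d n then
          (if d.support ⊆ Finset.range (n + 1) then
            (kostka (ofAsc μ) (Function.update d n 0) : ℂ) else 0) else 0 := by
      intro μ hμ
      have hle : ∑ i, μ i ≤ ∑ i, ν i := Finset.sum_le_sum fun i _ => ((mem_strips.1 hμ) i).2
      set p := ∑ i, ν i - ∑ i, μ i with hp
      rw [X_pow_eq_monomial, coeff_monomial_mul', one_mul,
        ih (monotone_of_mem_strips hν hμ)]
      by_cases hpd : d n = p
      · have h2 : d - Finsupp.single n p = d.erase n := by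
          ext i
          rw [Finsupp.tsub_apply]
          by_cases hi : i = n
          · subst hi; simp [hpd]
          · rw [Finsupp.erase_ne hi, Finsupp.single_eq_of_ne hi, Nat.sub_zero]
        have h3 : (d.erase n).support ⊆ Finset.range n ↔ d.support ⊆ Finset.range (n + 1) := by
          rw [Finsupp.support_erase, Finset.range_add_one, Finset.subset_insert_iff]
        rw [if_pos (show Finsupp.single n p ≤ d by rw [Finsupp.single_le_iff, hpd]),
          if_pos (show (∑ i, ν i) = (∑ i, μ i) + d n by omega), h2]
        simp only [h3]
        congr 3
        ext i
        simp [Finsupp.erase_apply, Function.update_apply]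
      -- If the strip is larger than `d n`, the power of `X n` does not divide the monomial; if it
      -- is smaller, a factor `X n` is left over, which does not occur in the remaining polynomial.
      · rw [if_neg (show ¬ ((∑ i, ν i) = (∑ i, μ i) + d n) by omega)]
        split_ifs with h4 h5
        · rw [Finsupp.single_le_iff] at h4
          have h6 : n ∈ (d - Finsupp.single n p).support := by
            rw [Finsupp.mem_support_iff, Finsupp.tsub_apply, Finsupp.single_eq_same]
            omega
          have := h5 h6
          simp at this
        · rfl
        · rfl
    rw [Finset.sum_congr rfl h1, ← Finset.sum_filter]
    split_ifs with hd
    · rw [kostka_ofAsc_succ hν n (a := d) fun i hi => ?_, Nat.cast_sum]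
      by_contra h
      have := hd (Finsupp.mem_support_iff.2 h)
      rw [Finset.mem_range] at this
      omega
    · simp

end Tableaux

end FockSL2
end

noncomputable section
namespace FockSL2

/-! ### The power sums generate the symmetric functions freely -/

section PowerSums

open MvPolynomial (X C)

/-- Restriction of a power series to the variables `x_0, …, x_{n-1}`. -/
def restrictVars (n : ℕ) : MvPowerSeries ℕ ℂ →ₐ[ℂ] MvPowerSeries (Fin n) ℂ :=
  MvPowerSeries.killCompl Fin.valEmbedding

theorem coeff_restrictVars (n : ℕ) (g : MvPowerSeries ℕ ℂ) (d : Fin n →₀ ℕ) :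
    MvPowerSeries.coeff d (restrictVars n g) =
      MvPowerSeries.coeff (Finsupp.embDomain Fin.valEmbedding d) g :=
  MvPowerSeries.coeff_killCompl _ _

theorem exists_embDomain_of_support_subset {n : ℕ} {d : ℕ →₀ ℕ}
    (hd : d.support ⊆ Finset.range n) :
    ∃ d' : Fin n →₀ ℕ, d = Finsupp.embDomain Fin.valEmbedding d' := by
  have h1 : d ∈ Set.range (Finsupp.embDomain (M := ℕ) (Fin.valEmbedding (n := n))) := by
    rw [Finsupp.mem_range_embDomain_iff]
    intro i hi
    exact ⟨⟨i, Finset.mem_range.1 (hd hi)⟩, rfl⟩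
  obtain ⟨d', h⟩ := h1
  exact ⟨d', h.symm⟩

theorem symFun_coeff_embDomain (g : SymFun) (σ : Equiv.Perm ℕ) (d : ℕ →₀ ℕ) :
    MvPowerSeries.coeff (Finsupp.embDomain σ.toEmbedding d) (g : MvPowerSeries ℕ ℂ) =
      MvPowerSeries.coeff d (g : MvPowerSeries ℕ ℂ) := by
  conv_lhs => rw [← g.2.2 σ, MvPowerSeries.renameEquiv_apply]
  exact MvPowerSeries.coeff_embDomain_rename σ.toEmbedding _ d

theorem mem_symFun_of_coeff {g : MvPowerSeries ℕ ℂ} (N : ℕ)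
    (h1 : ∀ d : ℕ →₀ ℕ, N < d.degree → MvPowerSeries.coeff d g = 0)
    (h2 : ∀ (σ : Equiv.Perm ℕ) (d : ℕ →₀ ℕ),
      MvPowerSeries.coeff (Finsupp.embDomain σ.toEmbedding d) g = MvPowerSeries.coeff d g) :
    g ∈ SymFun := by
  refine ⟨⟨N, h1⟩, fun σ => ?_⟩
  ext d
  obtain ⟨d, rfl⟩ : ∃ d', d = Finsupp.embDomain σ.toEmbedding d' :=
    ⟨d.mapDomain σ.symm, by
      rw [Finsupp.embDomain_eq_mapDomain, ← Finsupp.mapDomain_comp]; simp⟩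
  rw [MvPowerSeries.renameEquiv_apply, h2]
  exact MvPowerSeries.coeff_embDomain_rename σ.toEmbedding g d

/-- The homomorphism that sends the variable `X i` to the power sum `p_{i+1}`. -/
def powerHom : MvPolynomial ℕ ℂ →ₐ[ℂ] SymFun := MvPolynomial.aeval fun i => psum (i + 1)

theorem powerHom_X (i : ℕ) : powerHom (X i) = psum (i + 1) := MvPolynomial.aeval_X _ _

theorem restrictVars_psumSeries (n : ℕ) {r : ℕ} (hr : 0 < r) :
    restrictVars n (psumSeries r) = (MvPolynomial.psum (Fin n) ℂ r : MvPowerSeries (Fin n) ℂ) := by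
  classical
  ext d
  rw [coeff_restrictVars, MvPolynomial.coeff_coe, MvPolynomial.psum, MvPolynomial.coeff_sum]
  simp only [MvPolynomial.coeff_X_pow]
  change (if ∃ i, Finsupp.embDomain Fin.valEmbedding d = Finsupp.single i r then (1 : ℂ) else 0) = _
  split_ifs with h
  · obtain ⟨i, hi⟩ := h
    have hin : i < n := by
      have : i ∈ (Finsupp.embDomain (Fin.valEmbedding (n := n)) d).support := by
        rw [hi, Finsupp.mem_support_iff, Finsupp.single_eq_same]; omega
      rw [Finsupp.support_embDomain, Finset.mem_map] at this
      obtain ⟨j, _, rfl⟩ := this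
      exact j.2
    have hd : Finsupp.single ⟨i, hin⟩ r = d := by
      refine Finsupp.embDomain_injective (Fin.valEmbedding (n := n)) ?_
      rw [hi, Finsupp.embDomain_single]
      rfl
    subst hd
    rw [Finset.sum_eq_single ⟨i, hin⟩]
    · simp
    · intro j _ hj
      rw [if_neg]
      intro h
      rcases (Finsupp.single_eq_single_iff _ _ _ _).1 h with h | h
      · exact hj h.1
      · omega
    · simp
  · symm
    refine Finset.sum_eq_zero fun i _ => if_neg ?_
    rintro rfl
    exact h ⟨i, by rw [Finsupp.embDomain_single]; rfl⟩

/-- The power sums in `n` variables, as a homomorphism. -/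
def powerHomFin (n : ℕ) : MvPolynomial ℕ ℂ →ₐ[ℂ] MvPolynomial (Fin n) ℂ :=
  MvPolynomial.aeval fun i => MvPolynomial.psum (Fin n) ℂ (i + 1)

theorem restrictVars_powerHom (n : ℕ) (g : MvPolynomial ℕ ℂ) :
    restrictVars n (powerHom g : MvPowerSeries ℕ ℂ) =
      (powerHomFin n g : MvPowerSeries (Fin n) ℂ) := by
  have h : ((restrictVars n).comp (SymFun.val.comp powerHom)) =
      (MvPolynomial.coeToMvPowerSeries.algHom ℂ).comp (powerHomFin n) := by
    refine MvPolynomial.algHom_ext fun i => ?_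
    simp only [AlgHom.comp_apply, powerHom_X, powerHomFin, MvPolynomial.aeval_X]
    rw [MvPolynomial.coeToMvPowerSeries.algHom_apply]
    exact restrictVars_psumSeries n (Nat.succ_pos i)
  have h2 := DFunLike.congr_fun h g
  simp only [AlgHom.comp_apply, MvPolynomial.coeToMvPowerSeries.algHom_apply] at h2
  exact h2

/-- The power sums `p_1, …, p_n` in `n` variables, as a homomorphism. -/
def psumHom (n : ℕ) : MvPolynomial (Fin n) ℂ →ₐ[ℂ] MvPolynomial (Fin n) ℂ :=
  MvPolynomial.aeval fun i => MvPolynomial.psum (Fin n) ℂ ((i : ℕ) + 1)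

theorem powerHomFin_rename (n : ℕ) (g : MvPolynomial (Fin n) ℂ) :
    powerHomFin n (MvPolynomial.rename Fin.val g) = psumHom n g := by
  rw [powerHomFin, MvPolynomial.aeval_rename]
  rfl

/-- Newton's identities solved for the elementary polynomial, which requires dividing by `m`. -/
theorem esymm_mem_range_psumHom (n m : ℕ) (hm : m ≤ n) :
    MvPolynomial.esymm (Fin n) ℂ m ∈ (psumHom n).range := by
  induction m using Nat.strong_induction_on with
  | _ m ih =>
    rcases Nat.eq_zero_or_pos m with rfl | hpos
    · rw [MvPolynomial.esymm_zero]
      exact one_mem _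
    · have h1 := MvPolynomial.mul_esymm_eq_sum (Fin n) ℂ m
      have h2 : MvPolynomial.esymm (Fin n) ℂ m =
          ((m : ℂ)⁻¹) • ((m : MvPolynomial (Fin n) ℂ) * MvPolynomial.esymm (Fin n) ℂ m) := by
        have hm0 : (m : ℂ) ≠ 0 := by exact_mod_cast hpos.ne'
        rw [← nsmul_eq_mul, ← Nat.cast_smul_eq_nsmul ℂ, smul_smul, inv_mul_cancel₀ hm0, one_smul]
      rw [h2, h1]
      refine Subalgebra.smul_mem _ (mul_mem (pow_mem (neg_mem (one_mem _)) _)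
        (sum_mem fun a ha => ?_)) _
      rw [Finset.mem_filter, Finset.HasAntidiagonal.mem_antidiagonal] at ha
      refine mul_mem (mul_mem (pow_mem (neg_mem (one_mem _)) _) (ih _ ha.2 (by omega))) ?_
      refine ⟨X ⟨a.2 - 1, by omega⟩, ?_⟩
      change psumHom n _ = _
      rw [psumHom, MvPolynomial.aeval_X]
      congr 1
      simp only
      omega

theorem mem_range_psumHom_of_isSymmetric (n : ℕ) {P : MvPolynomial (Fin n) ℂ}
    (hP : P.IsSymmetric) : P ∈ (psumHom n).range := by
  obtain ⟨Q, hQ⟩ := (MvPolynomial.esymmAlgHom_surjective (σ := Fin n) ℂ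
    (le_of_eq (Fintype.card_fin n))) ⟨P, hP⟩
  have h1 := MvPolynomial.esymmAlgHom_apply (σ := Fin n) (R := ℂ) Q
  rw [hQ] at h1
  change P = _ at h1
  rw [h1]
  have h2 : (MvPolynomial.aeval (R := ℂ)
      (fun i : Fin n => MvPolynomial.esymm (Fin n) ℂ ((i : ℕ) + 1))).range ≤ (psumHom n).range := by
    rw [← Algebra.adjoin_range_eq_range_aeval]
    refine Algebra.adjoin_le ?_
    rintro _ ⟨i, rfl⟩
    exact esymm_mem_range_psumHom n _ (by omega)
  exact h2 ⟨Q, rfl⟩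

/-- The kernels of the iterates stabilize at some `n`. Writing a kernel element as `f^n y` puts `y`
into the kernel of `f^(n+1)`, hence of `f^n`. -/
theorem injective_of_surjective_endomorphism {R : Type*} [CommRing R] [IsNoetherianRing R]
    (f : R →+* R) (hf : Function.Surjective f) : Function.Injective f := by
  rw [injective_iff_map_eq_zero]
  intro x hx
  let c : ℕ →o Ideal R := ⟨fun n => RingHom.ker (f ^ n), monotone_nat_of_le_succ fun n y hy => by
    rw [RingHom.mem_ker] at hy ⊢
    rw [pow_succ', RingHom.mul_def, RingHom.comp_apply, hy, map_zero]⟩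
  obtain ⟨n, hn⟩ := (monotone_stabilizes_iff_noetherian (R := R) (M := R)).2 inferInstance c
  have hsurj : Function.Surjective (f ^ n) := by
    rw [RingHom.coe_pow]
    exact hf.iterate n
  obtain ⟨y, rfl⟩ := hsurj x
  have h1 : y ∈ c (n + 1) := by
    change y ∈ RingHom.ker (f ^ (n + 1))
    rw [RingHom.mem_ker, pow_succ', RingHom.mul_def, RingHom.comp_apply, hx]
  rw [← hn (n + 1) (Nat.le_succ n)] at h1
  exact h1

/-- In terms of the elementary polynomials, which are free generators, the power sums define an
endomorphism of a polynomial ring. It is surjective by `esymm_mem_range_psumHom`, hence injective by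
noetherianity. -/
theorem psumHom_injective (n : ℕ) : Function.Injective (psumHom n) := by
  let E := MvPolynomial.esymmAlgEquiv (σ := Fin n) ℂ (Fintype.card_fin n)
  let ps : Fin n → MvPolynomial.symmetricSubalgebra (Fin n) ℂ := fun i =>
    ⟨MvPolynomial.psum (Fin n) ℂ ((i : ℕ) + 1), MvPolynomial.psum_isSymmetric (Fin n) ℂ _⟩
  let θ : MvPolynomial (Fin n) ℂ →ₐ[ℂ] MvPolynomial (Fin n) ℂ :=
    MvPolynomial.aeval fun i => E.symm (ps i)
  have hθ : ∀ g, ((E (θ g) : MvPolynomial.symmetricSubalgebra (Fin n) ℂ) :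
      MvPolynomial (Fin n) ℂ) = psumHom n g := by
    intro g
    have : ((MvPolynomial.symmetricSubalgebra (Fin n) ℂ).val.comp (E.toAlgHom.comp θ)) =
        psumHom n := by
      refine MvPolynomial.algHom_ext fun i => ?_
      simp [θ, ps, psumHom]
    exact DFunLike.congr_fun this g
  have hsurj : Function.Surjective θ := by
    rw [← AlgHom.range_eq_top, eq_top_iff, ← MvPolynomial.adjoin_range_X]
    refine Algebra.adjoin_le ?_
    rintro _ ⟨i, rfl⟩
    obtain ⟨r, hr⟩ := esymm_mem_range_psumHom n ((i : ℕ) + 1) (by omega)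
    refine ⟨r, E.injective (Subtype.ext ?_)⟩
    refine (hθ r).trans (hr.trans ?_)
    have h1 := MvPolynomial.esymmAlgHom_apply (σ := Fin n) (R := ℂ) (X i)
    rw [MvPolynomial.aeval_X] at h1
    exact h1.symm
  have hinj := injective_of_surjective_endomorphism θ.toRingHom hsurj
  intro g g' h
  rw [← hθ, ← hθ] at h
  exact hinj (E.injective (Subtype.ext h))

/-- A relation involves only `p_1, …, p_n` for some `n`, and these are already independent in `n`
variables. -/
theorem powerHom_injective : Function.Injective powerHom := by
  rw [injective_iff_map_eq_zero]
  intro g hg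
  obtain ⟨n, hn⟩ : ∃ n, g.vars ⊆ Finset.range n :=
    ⟨g.vars.sup id + 1, fun i hi => Finset.mem_range.2
      (Nat.lt_succ_of_le (Finset.le_sup (f := id) hi))⟩
  obtain ⟨q, rfl⟩ := MvPolynomial.exists_rename_eq_of_vars_subset_range g (Fin.val : Fin n → ℕ)
    Fin.val_injective fun i hi => ⟨⟨i, Finset.mem_range.1 (hn hi)⟩, rfl⟩
  have h1 := restrictVars_powerHom n (MvPolynomial.rename Fin.val q)
  rw [hg, powerHomFin_rename, ZeroMemClass.coe_zero, map_zero] at h1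
  have h2 : psumHom n q = 0 := by
    refine MvPolynomial.coe_injective (Fin n) ℂ ?_
    rw [← h1, MvPolynomial.coe_zero]
  rw [(injective_iff_map_eq_zero _).1 (psumHom_injective n) q h2, map_zero]

theorem isHomogeneous_psumSeries (n : ℕ) : MvPowerSeries.IsHomogeneous (psumSeries n) n := by
  classical
  intro d hd
  change (if _ then (1 : ℂ) else 0) ≠ 0 at hd
  have h1 : ∃ i, d = Finsupp.single i n := by
    by_contra h
    exact hd (if_neg h)
  obtain ⟨i, rfl⟩ := h1
  rw [Finsupp.weight_single]
  simp

theorem isHomogeneous_one : MvPowerSeries.IsHomogeneous (1 : MvPowerSeries ℕ ℂ) 0 := by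
  classical
  intro d hd
  rw [MvPowerSeries.coeff_one] at hd
  have h1 : d = 0 := by
    by_contra h
    exact hd (if_neg h)
  rw [h1, map_zero]

theorem exists_isHomogeneous_powerHom_monomial (m : ℕ →₀ ℕ) :
    ∃ w, MvPowerSeries.IsHomogeneous
      (powerHom (MvPolynomial.monomial m 1) : MvPowerSeries ℕ ℂ) w := by
  induction m using Finsupp.induction_linear with
  | zero => exact ⟨0, by rw [← MvPolynomial.one_def, map_one]; exact isHomogeneous_one⟩
  | add f g hf hg =>
    obtain ⟨a, ha⟩ := hf
    obtain ⟨b, hb⟩ := hg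
    refine ⟨a + b, ?_⟩
    have h1 : MvPolynomial.monomial (f + g) (1 : ℂ) =
        MvPolynomial.monomial f 1 * MvPolynomial.monomial g 1 := by
      rw [MvPolynomial.monomial_mul, mul_one]
    rw [h1, map_mul, MulMemClass.coe_mul]
    intro d
    exact ha.mul hb
  | single i n =>
    rw [← MvPolynomial.X_pow_eq_monomial, map_pow, powerHom_X]
    induction n with
    | zero => exact ⟨0, by rw [pow_zero]; exact isHomogeneous_one⟩
    | succ n ih =>
      obtain ⟨a, ha⟩ := ih
      refine ⟨a + (i + 1), ?_⟩
      rw [pow_succ, MulMemClass.coe_mul]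
      exact ha.mul (isHomogeneous_psumSeries (i + 1))

/-- A preimage found in `N` variables may have parts of degree above `N`, about which the
restriction says nothing useful; they are cut off monomial by monomial, each being homogeneous. -/
theorem exists_powerHom_truncation (N : ℕ) (g : MvPolynomial ℕ ℂ) :
    ∃ g' : MvPolynomial ℕ ℂ, ∀ d : ℕ →₀ ℕ,
      MvPowerSeries.coeff d (powerHom g' : MvPowerSeries ℕ ℂ) =
        if d.degree ≤ N then MvPowerSeries.coeff d (powerHom g : MvPowerSeries ℕ ℂ) else 0 := by
  induction g using MvPolynomial.induction_on' with
  | monomial m c =>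
    obtain ⟨w, hw⟩ := exists_isHomogeneous_powerHom_monomial m
    have hm : MvPolynomial.monomial m c = c • MvPolynomial.monomial m (1 : ℂ) := by
      rw [MvPolynomial.smul_monomial, smul_eq_mul, mul_one]
    have hz : ∀ d : ℕ →₀ ℕ, d.degree ≠ w → MvPowerSeries.coeff d
        (powerHom (MvPolynomial.monomial m c) : MvPowerSeries ℕ ℂ) = 0 := by
      intro d hd
      rw [hm, map_smul, SetLike.val_smul, map_smul, hw.coeff_eq_zero hd, smul_zero]
    by_cases hwN : w ≤ N
    · refine ⟨MvPolynomial.monomial m c, fun d => ?_⟩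
      split_ifs with hd
      · rfl
      · exact hz d (by omega)
    · refine ⟨0, fun d => ?_⟩
      rw [map_zero, ZeroMemClass.coe_zero, map_zero]
      split_ifs with hd
      · exact (hz d (by omega)).symm
      · rfl
  | add p q hp hq =>
    obtain ⟨p', hp⟩ := hp
    obtain ⟨q', hq⟩ := hq
    refine ⟨p' + q', fun d => ?_⟩
    rw [map_add, map_add, AddMemClass.coe_add, AddMemClass.coe_add, map_add, map_add, hp, hq]
    split_ifs <;> simp

theorem exists_perm_support_subset (d : ℕ →₀ ℕ) {N : ℕ} (hd : d.support.card ≤ N) :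
    ∃ σ : Equiv.Perm ℕ, (Finsupp.embDomain σ.toEmbedding d).support ⊆ Finset.range N := by
  obtain ⟨g, hg⟩ := (Equiv.Perm.isMultiplyPretransitive ℕ d.support.card).exists_smul_eq
    (d.support.orderEmbOfFin rfl).toEmbedding (Fin.valEmbedding (n := d.support.card))
  refine ⟨g, fun i hi => ?_⟩
  rw [Finsupp.support_embDomain, Finset.mem_map] at hi
  obtain ⟨j, hj, rfl⟩ := hi
  have hj' : j ∈ Set.range (d.support.orderEmbOfFin rfl) := by
    rw [Finset.range_orderEmbOfFin]; exact hj
  obtain ⟨l, rfl⟩ := hj'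
  have h1 := DFunLike.congr_fun hg l
  change g (d.support.orderEmbOfFin rfl l) = (l : ℕ) at h1
  rw [Finset.mem_range]
  change g _ < N
  rw [h1]
  exact lt_of_lt_of_le l.2 hd

theorem card_support_le_degree (d : ℕ →₀ ℕ) : d.support.card ≤ d.degree := by
  rw [Finsupp.degree_apply, Finset.card_eq_sum_ones]
  exact Finset.sum_le_sum fun i hi => Nat.one_le_iff_ne_zero.2 (Finsupp.mem_support_iff.1 hi)

theorem degree_embDomain {α β : Type*} (f : α ↪ β) (d : α →₀ ℕ) :
    (Finsupp.embDomain f d).degree = d.degree := by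
  rw [Finsupp.degree_apply, Finsupp.degree_apply, Finsupp.support_embDomain, Finset.sum_map]
  simp

/-- A symmetric function is determined by its restriction to as many variables as its degree. -/
theorem symFun_ext_of_restrictVars {N : ℕ} {g g' : SymFun}
    (hg : ∀ d : ℕ →₀ ℕ, N < d.degree → MvPowerSeries.coeff d (g : MvPowerSeries ℕ ℂ) = 0)
    (hg' : ∀ d : ℕ →₀ ℕ, N < d.degree → MvPowerSeries.coeff d (g' : MvPowerSeries ℕ ℂ) = 0)
    (h : ∀ d : ℕ →₀ ℕ, d.degree ≤ N → d.support ⊆ Finset.range N →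
      MvPowerSeries.coeff d (g : MvPowerSeries ℕ ℂ) =
        MvPowerSeries.coeff d (g' : MvPowerSeries ℕ ℂ)) : g = g' := by
  refine Subtype.ext (MvPowerSeries.ext fun d => ?_)
  by_cases hd : d.degree ≤ N
  · obtain ⟨σ, hσ⟩ := exists_perm_support_subset d ((card_support_le_degree d).trans hd)
    rw [← symFun_coeff_embDomain g σ, ← symFun_coeff_embDomain g' σ]
    exact h _ (by rwa [degree_embDomain]) hσ
  · rw [hg d (by omega), hg' d (by omega)]

theorem powerHom_surjective : Function.Surjective powerHom := by
  intro g
  obtain ⟨N, hN⟩ := g.2.1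
  -- Total degrees up to `N` are kept and no others occur in `g`, so `P` is the whole restriction,
  -- now as a polynomial.
  let P : MvPolynomial (Fin N) ℂ :=
    MvPowerSeries.truncTotal (N + 1) (restrictVars N (g : MvPowerSeries ℕ ℂ))
  have hP : ∀ d : Fin N →₀ ℕ, MvPolynomial.coeff d P =
      MvPowerSeries.coeff (Finsupp.embDomain Fin.valEmbedding d) (g : MvPowerSeries ℕ ℂ) := by
    intro d
    by_cases hd : d.degree < N + 1
    · exact (MvPowerSeries.coeff_truncTotal _ hd).trans (coeff_restrictVars _ _ _)
    · refine (MvPowerSeries.coeff_truncTotal_eq_zero _ (not_lt.1 hd)).trans (hN _ ?_).symm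
      rw [degree_embDomain]
      omega
  have hsymm : P.IsSymmetric := by
    intro σ
    ext d
    obtain ⟨d, rfl⟩ : ∃ d', d = Finsupp.mapDomain σ d' :=
      ⟨d.mapDomain σ.symm, by rw [← Finsupp.mapDomain_comp]; simp⟩
    rw [MvPolynomial.coeff_rename_mapDomain _ σ.injective, hP, hP,
      ← symFun_coeff_embDomain g (σ.viaEmbedding Fin.valEmbedding)]
    congr 2
    rw [Finsupp.embDomain_eq_mapDomain, Finsupp.embDomain_eq_mapDomain,
      Finsupp.embDomain_eq_mapDomain, ← Finsupp.mapDomain_comp, ← Finsupp.mapDomain_comp]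
    congr 1
    ext i
    exact Equiv.Perm.viaEmbedding_apply σ Fin.valEmbedding i
  obtain ⟨r, hr⟩ := mem_range_psumHom_of_isSymmetric N hsymm
  obtain ⟨q, hq⟩ := exists_powerHom_truncation N (MvPolynomial.rename Fin.val r)
  refine ⟨q, symFun_ext_of_restrictVars (N := N) (fun d hd => ?_) hN fun d hd hs => ?_⟩
  · rw [hq, if_neg (by omega)]
  · obtain ⟨d', rfl⟩ := exists_embDomain_of_support_subset hs
    rw [hq, if_pos hd, ← coeff_restrictVars, restrictVars_powerHom, powerHomFin_rename,
      MvPolynomial.coeff_coe]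
    change psumHom N r = P at hr
    rw [hr, hP]

/-- The algebra of symmetric functions is the polynomial algebra in the power sums. -/
def powerEquiv : MvPolynomial ℕ ℂ ≃ₐ[ℂ] SymFun :=
  AlgEquiv.ofBijective powerHom ⟨powerHom_injective, powerHom_surjective⟩

theorem powerEquiv_apply (g : MvPolynomial ℕ ℂ) : powerEquiv g = powerHom g := rfl

end PowerSums

end FockSL2
end

noncomputable section
namespace FockSL2

/-! ### Schur functions -/

section SchurFunctions

open MvPolynomial (X)

/-- The complete homogeneous symmetric function of degree `m` as a power series. -/
def hseries (m : ℤ) : MvPowerSeries ℕ ℂ := fun d => if (d.degree : ℤ) = m then 1 else 0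

theorem coeff_hseries (m : ℤ) (d : ℕ →₀ ℕ) :
    MvPowerSeries.coeff d (hseries m) = if (d.degree : ℤ) = m then 1 else 0 := rfl

/-- The complete homogeneous symmetric function of degree `m`. -/
def hsym (m : ℤ) : SymFun :=
  ⟨hseries m, by
    refine mem_symFun_of_coeff m.toNat (fun d hd => ?_) fun σ d => ?_
    · rw [coeff_hseries, if_neg (by omega)]
    · rw [coeff_hseries, coeff_hseries, degree_embDomain]⟩

theorem hsym_of_neg {m : ℤ} (hm : m < 0) : hsym m = 0 := by
  refine Subtype.ext (MvPowerSeries.ext fun d => ?_)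
  change MvPowerSeries.coeff d (hseries m) = 0
  rw [coeff_hseries, if_neg (by omega)]

theorem hsym_zero : hsym 0 = 1 := by
  classical
  refine Subtype.ext (MvPowerSeries.ext fun d => ?_)
  change MvPowerSeries.coeff d (hseries 0) = MvPowerSeries.coeff d 1
  rw [coeff_hseries, MvPowerSeries.coeff_one]
  congr 1
  rw [Nat.cast_eq_zero, Finsupp.degree_eq_zero_iff]

theorem support_subset_range_succ_iff {d : ℕ →₀ ℕ} {n : ℕ} :
    d.support ⊆ Finset.range (n + 1) ∧ d n = 0 ↔ d.support ⊆ Finset.range n := by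
  constructor
  · rintro ⟨h1, h2⟩ i hi
    have h3 := Finset.mem_range.1 (h1 hi)
    rw [Finset.mem_range]
    rcases (Nat.lt_succ_iff.1 h3).eq_or_lt with rfl | h4
    · exact absurd h2 (Finsupp.mem_support_iff.1 hi)
    · exact h4
  · intro h
    refine ⟨h.trans (Finset.range_subset_range.2 (Nat.le_succ n)), ?_⟩
    by_contra h2
    simpa using h (Finsupp.mem_support_iff.2 h2)

theorem coeff_hcomp (n : ℕ) (m : ℤ) (d : ℕ →₀ ℕ) :
    MvPolynomial.coeff d (hcomp (X : ℕ → MvPolynomial ℕ ℂ) n m) =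
      if d.support ⊆ Finset.range n ∧ (d.degree : ℤ) = m then 1 else 0 := by
  induction n generalizing m d with
  | zero =>
    rw [hcomp_zero_left]
    have h1 : (d.support ⊆ Finset.range 0 ∧ (d.degree : ℤ) = m) ↔ d = 0 ∧ m = 0 := by
      rw [Finset.range_zero, Finset.subset_empty, Finsupp.support_eq_empty]
      refine and_congr_right fun h => ?_
      subst h
      rw [map_zero, Nat.cast_zero, eq_comm]
    simp only [h1]
    by_cases hm : m = 0
    · rw [if_pos hm, MvPolynomial.coeff_one]
      simp [hm, eq_comm]
    · simp [hm]
  | succ n ih =>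
    rcases lt_or_ge m 0 with hm | hm
    · rw [hcomp_of_neg _ _ hm, MvPolynomial.coeff_zero, if_neg]
      rintro ⟨_, h⟩
      omega
    · obtain ⟨m, rfl⟩ := Int.eq_ofNat_of_zero_le hm
      induction m generalizing d with
      | zero =>
        rw [Nat.cast_zero, hcomp_zero_right, MvPolynomial.coeff_one]
        by_cases hd : d = 0
        · subst hd; simp
        · rw [if_neg (Ne.symm hd), if_neg]
          rintro ⟨_, h⟩
          rw [Nat.cast_eq_zero, Finsupp.degree_eq_zero_iff] at h
          exact hd h
      | succ m ihm =>
        rw [hcomp_succ, MvPolynomial.coeff_add, ih, MvPolynomial.coeff_X_mul', Nat.cast_succ,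
          add_sub_cancel_right, ihm _ (by omega)]
        by_cases hdn : d n = 0
        · rw [if_neg (show n ∉ d.support by simpa using hdn), add_zero]
          simp only [← support_subset_range_succ_iff (d := d) (n := n), hdn, and_true]
        · have h0 : ¬ (d.support ⊆ Finset.range n ∧ (d.degree : ℤ) = m + 1) := by
            rintro ⟨h, _⟩
            exact hdn (support_subset_range_succ_iff.2 h).2
          rw [if_neg h0, if_pos (show n ∈ d.support by simpa using hdn), zero_add]
          have h1 : d - Finsupp.single n 1 + Finsupp.single n 1 = d :=
            tsub_add_cancel_of_le (by rw [Finsupp.single_le_iff]; omega)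
          have h2 : (d.degree : ℤ) = (d - Finsupp.single n 1).degree + 1 := by
            conv_lhs => rw [← h1, map_add]
            simp
          have h3 : (d - Finsupp.single n 1).support ⊆ Finset.range (n + 1) ↔
              d.support ⊆ Finset.range (n + 1) := by
            constructor
            · intro h i hi
              by_cases hin : i = n
              · simp [hin]
              · refine h ?_
                rw [Finsupp.mem_support_iff, Finsupp.tsub_apply, Finsupp.single_eq_of_ne hin]
                simpa using hi
            · exact fun h => (Finsupp.support_mono tsub_le_self).trans h
          simp only [h3, h2, add_left_inj]

theorem support_embDomain_val_subset {n : ℕ} (d : Fin n →₀ ℕ) :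
    (Finsupp.embDomain Fin.valEmbedding d).support ⊆ Finset.range n := by
  intro i hi
  rw [Finsupp.support_embDomain, Finset.mem_map] at hi
  obtain ⟨j, _, rfl⟩ := hi
  exact Finset.mem_range.2 j.2

/-- Restriction of symmetric functions to `n` variables. -/
def symRestrict (n : ℕ) : SymFun →ₐ[ℂ] MvPowerSeries (Fin n) ℂ :=
  (restrictVars n).comp SymFun.val

theorem coeff_symRestrict (n : ℕ) (g : SymFun) (d : Fin n →₀ ℕ) :
    MvPowerSeries.coeff d (symRestrict n g) =
      MvPowerSeries.coeff (Finsupp.embDomain Fin.valEmbedding d) (g : MvPowerSeries ℕ ℂ) :=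
  coeff_restrictVars n _ d

/-- Restriction of polynomials to `n` variables. -/
def polyRestrict (n : ℕ) : MvPolynomial ℕ ℂ →ₐ[ℂ] MvPowerSeries (Fin n) ℂ :=
  (restrictVars n).comp (MvPolynomial.coeToMvPowerSeries.algHom ℂ)

theorem coeff_polyRestrict (n : ℕ) (g : MvPolynomial ℕ ℂ) (d : Fin n →₀ ℕ) :
    MvPowerSeries.coeff d (polyRestrict n g) =
      MvPolynomial.coeff (Finsupp.embDomain Fin.valEmbedding d) g := by
  refine (coeff_restrictVars n _ d).trans ?_
  change MvPowerSeries.coeff _ (MvPowerSeries.map (algebraMap ℂ ℂ) (g : MvPowerSeries ℕ ℂ)) = _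
  rw [MvPowerSeries.coeff_map, MvPolynomial.coeff_coe]
  rfl

theorem polyRestrict_X (n : ℕ) (i : Fin n) : polyRestrict n (X (i : ℕ)) = MvPowerSeries.X i := by
  refine Eq.trans ?_ (MvPowerSeries.killCompl_X (R := ℂ) (e := Fin.valEmbedding) i)
  simp [polyRestrict, restrictVars]

theorem symRestrict_hsym (n : ℕ) (m : ℤ) :
    symRestrict n (hsym m) = polyRestrict n (hcomp X n m) := by
  ext d
  rw [coeff_symRestrict, coeff_polyRestrict, coeff_hcomp]
  change MvPowerSeries.coeff _ (hseries m) = _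
  rw [coeff_hseries]
  simp only [support_embDomain_val_subset d, true_and]

theorem symRestrict_det_hsym {k : ℕ} (n : ℕ) (c : Fin k → ℤ) :
    symRestrict n (Matrix.of fun i j : Fin k => hsym (c i - (j : ℕ))).det =
      polyRestrict n (Matrix.of fun i j : Fin k => hcomp X n (c i - (j : ℕ))).det := by
  rw [AlgHom.map_det, AlgHom.map_det]
  congr 1
  refine Matrix.ext fun i j => ?_
  exact symRestrict_hsym n _

/-- The Jacobi–Trudi formula for Schur functions. -/
theorem coe_det_hsym {k : ℕ} {ν : Fin k → ℕ} (hν : Monotone ν) :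
    ((Matrix.of fun i j : Fin k => hsym (((ν i : ℤ) + (i : ℕ)) - (j : ℕ))).det :
      MvPowerSeries ℕ ℂ) = schur (ofAsc ν) := by
  ext d
  -- One coefficient involves finitely many variables, so it can be compared in `n` variables; the
  -- size `k` of the determinant does not depend on `n`.
  obtain ⟨n, hn⟩ : ∃ n, d.support ⊆ Finset.range n :=
    ⟨d.support.sup id + 1, fun i hi => Finset.mem_range.2
      (Nat.lt_succ_of_le (Finset.le_sup (f := id) hi))⟩
  have h1 : MvPowerSeries.coeff d (schur (ofAsc ν)) = (kostka (ofAsc ν) d : ℂ) := rfl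
  have h2 := coeff_branchSchur hν n d
  rw [if_pos hn, branchSchur_eq_det _ _ hν] at h2
  rw [h1, ← h2]
  obtain ⟨d, rfl⟩ := exists_embDomain_of_support_subset hn
  rw [← coeff_symRestrict, ← coeff_polyRestrict, symRestrict_det_hsym]

/-- The coefficient counts the variables whose `r`-th power divides the monomial. -/
theorem coeff_psumSeries_mul_hseries {r : ℕ} (hr : 0 < r) (m : ℤ) (d : ℕ →₀ ℕ) :
    MvPowerSeries.coeff d (psumSeries r * hseries m) =
      if (d.degree : ℤ) = r + m then (((d.support.filter fun i => r ≤ d i).card : ℕ) : ℂ)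
        else 0 := by
  classical
  have h1 : ∀ p ∈ Finset.HasAntidiagonal.antidiagonal d,
      MvPowerSeries.coeff p.1 (psumSeries r) * MvPowerSeries.coeff p.2 (hseries m) =
      if (d.degree : ℤ) = r + m then
        (if ∃ i, p.1 = Finsupp.single i r then (1 : ℂ) else 0) else 0 := by
    intro p hp
    rw [Finset.HasAntidiagonal.mem_antidiagonal] at hp
    have h2 : MvPowerSeries.coeff p.1 (psumSeries r) =
        if ∃ i, p.1 = Finsupp.single i r then (1 : ℂ) else 0 := rfl
    rw [h2, coeff_hseries]
    by_cases h3 : ∃ i, p.1 = Finsupp.single i r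
    · rw [if_pos h3, one_mul]
      congr 1
      obtain ⟨i, hi⟩ := h3
      rw [← hp, hi, map_add]
      simp
    · rw [if_neg h3, zero_mul, ite_self]
  rw [MvPowerSeries.coeff_mul, Finset.sum_congr rfl h1]
  split_ifs with hd
  · rw [Finset.sum_boole]
    congr 1
    symm
    refine Finset.card_bij (fun i _ => (Finsupp.single i r, d - Finsupp.single i r)) ?_ ?_ ?_
    · intro i hi
      rw [Finset.mem_filter] at hi
      rw [Finset.mem_filter, Finset.HasAntidiagonal.mem_antidiagonal]
      exact ⟨add_tsub_cancel_of_le (by rw [Finsupp.single_le_iff]; exact hi.2), i, rfl⟩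
    · intro i _ j _ hij
      rw [Prod.mk.injEq] at hij
      rcases (Finsupp.single_eq_single_iff _ _ _ _).1 hij.1 with h | h
      · exact h.1
      · omega
    · rintro ⟨p, q⟩ hp
      rw [Finset.mem_filter, Finset.HasAntidiagonal.mem_antidiagonal] at hp
      obtain ⟨hpq, i, hi⟩ := hp
      simp only at hpq hi
      have hri : r ≤ d i := by
        rw [← hpq, hi, Finsupp.add_apply, Finsupp.single_eq_same]; omega
      refine ⟨i, ?_, ?_⟩
      · rw [Finset.mem_filter, Finsupp.mem_support_iff]
        omega
      · rw [← hpq, hi, add_tsub_cancel_left]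
  · exact Finset.sum_const_zero

/-- Newton's identity for power sums and complete homogeneous symmetric functions. -/
theorem smul_hsym (m : ℤ) (N : ℕ) (hN : m ≤ N) :
    (m : ℂ) • hsym m = ∑ i ∈ Finset.range N, psum (i + 1) * hsym (m - 1 - i) := by
  classical
  refine Subtype.ext (MvPowerSeries.ext fun d => ?_)
  have h1 : ((∑ i ∈ Finset.range N, psum (i + 1) * hsym (m - 1 - i) : SymFun) :
      MvPowerSeries ℕ ℂ) = ∑ i ∈ Finset.range N, psumSeries (i + 1) * hseries (m - 1 - i) := by
    rw [← SymFun.val_apply, map_sum]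
    rfl
  rw [h1, map_sum]
  change MvPowerSeries.coeff d ((m : ℂ) • hseries m) = _
  rw [map_smul, coeff_hseries]
  have h2 : ∀ i ∈ Finset.range N,
      MvPowerSeries.coeff d (psumSeries (i + 1) * hseries (m - 1 - i)) =
      if (d.degree : ℤ) = m then (((d.support.filter fun j => i < d j).card : ℕ) : ℂ)
        else 0 := by
    intro i _
    rw [coeff_psumSeries_mul_hseries (Nat.succ_pos i)]
    congr 1
    rw [Nat.cast_succ]
    ring_nf
  rw [Finset.sum_congr rfl h2]
  split_ifs with hd
  · rw [← Nat.cast_sum, smul_eq_mul, mul_one, ← hd, Int.cast_natCast]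
    congr 1
    -- Double counting: the variable `j` is counted once for each `i < d j`, which adds up to the
    -- degree.
    simp only [Finset.card_filter]
    rw [Finset.sum_comm, Finsupp.degree_apply]
    refine Finset.sum_congr rfl fun j hj => ?_
    have h3 : d j ≤ N := by
      have := Finsupp.le_degree j d
      omega
    rw [← Finset.card_filter]
    have h4 : (Finset.range N).filter (fun i => i < d j) = Finset.range (d j) := by
      ext i
      simp only [Finset.mem_filter, Finset.mem_range]
      omega
    rw [h4, Finset.card_range]
  · simp

/-- Both sides satisfy Newton's recursion, which determines them because the degree is invertible.
-/
theorem powerHom_hpolyInt (m : ℤ) : powerHom (hpolyInt m) = hsym m := by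
  rcases lt_or_ge m 0 with hm | hm
  · rw [hpolyInt_of_neg hm, hsym_of_neg hm, map_zero]
  · obtain ⟨m, rfl⟩ := Int.eq_ofNat_of_zero_le hm
    induction m using Nat.strong_induction_on with
    | _ m ih =>
      rcases Nat.eq_zero_or_pos m with rfl | hpos
      · rw [Nat.cast_zero, hpolyInt_zero, hsym_zero, map_one]
      · have hm0 : ((m : ℤ) : ℂ) ≠ 0 := by
          rw [Int.cast_natCast]; exact_mod_cast hpos.ne'
        have h1 : ((m : ℤ) : ℂ) • powerHom (hpolyInt m) = ((m : ℤ) : ℂ) • hsym m := by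
          rw [← map_smul, smul_hpolyInt m m le_rfl, smul_hsym m m le_rfl, map_sum]
          refine Finset.sum_congr rfl fun i hi => ?_
          rw [Finset.mem_range] at hi
          rw [map_mul, powerHom_X, show (m : ℤ) - 1 - i = ((m - 1 - i : ℕ) : ℤ) by omega,
            ih _ (by omega) (by omega)]
        have h2 := congrArg (fun y => ((m : ℤ) : ℂ)⁻¹ • y) h1
        simpa only [smul_smul, inv_mul_cancel₀ hm0, one_smul] using h2

/-- The determinant of the polynomials `hpolyInt (c i - j)`. -/
def jtPoly {k : ℕ} (c : Fin k → ℤ) : MvPolynomial ℕ ℂ :=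
  (Matrix.of fun i j : Fin k => hpolyInt (c i - (j : ℕ))).det

theorem powerHom_jtPoly {k : ℕ} (c : Fin k → ℤ) :
    powerHom (jtPoly c) = (Matrix.of fun i j : Fin k => hsym (c i - (j : ℕ))).det := by
  rw [jtPoly, AlgHom.map_det]
  congr 1
  refine Matrix.ext fun i j => ?_
  exact powerHom_hpolyInt _

theorem coe_powerHom_jtPoly {k : ℕ} {ν : YoungDiagram} (hν : ∀ c ∈ ν, c.1 < k) :
    (powerHom (jtPoly fun i : Fin k => (ascRows k ν i : ℤ) + (i : ℕ)) : MvPowerSeries ℕ ℂ) =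
      schur ν := by
  rw [powerHom_jtPoly, coe_det_hsym (monotone_ascRows k ν), ofAsc_ascRows hν]

/-- Symmetry of the Kostka numbers in the content: by Jacobi–Trudi they are the coefficients of a
symmetric function. -/
theorem kostka_embDomain {k : ℕ} {ν : YoungDiagram} (hν : ∀ c ∈ ν, c.1 < k) (σ : Equiv.Perm ℕ)
    (d : ℕ →₀ ℕ) : kostka ν (Finsupp.embDomain σ.toEmbedding d) = kostka ν d := by
  have h1 := symFun_coeff_embDomain (powerHom (jtPoly fun i : Fin k => (ascRows k ν i : ℤ) + (i : ℕ))) σ d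
  rw [coe_powerHom_jtPoly hν] at h1
  have h2 : ((kostka ν (Finsupp.embDomain σ.toEmbedding d) : ℕ) : ℂ) = (kostka ν d : ℕ) := h1
  exact_mod_cast h2

/-- A permutation carrying one strictly increasing exponent sequence to another forces the two to be
equal, and then it is the identity. -/
theorem coeff_alternant {k : ℕ} {c c' : Fin k → ℕ} (hc : StrictMono c) (hc' : StrictMono c') :
    MvPolynomial.coeff (Finsupp.equivFunOnFinite.symm c')
      (Matrix.of fun l i : Fin k => (X l : MvPolynomial (Fin k) ℂ) ^ c i).det =
        if c = c' then 1 else 0 := by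
  have h1 : ∀ σ : Equiv.Perm (Fin k), ∏ i, (X (σ i) : MvPolynomial (Fin k) ℂ) ^ c i =
      MvPolynomial.monomial (Finsupp.equivFunOnFinite.symm (c ∘ σ.symm)) 1 := by
    intro σ
    rw [MvPolynomial.monomial_eq, map_one, one_mul, Finsupp.prod_fintype _ _ (by simp)]
    refine Fintype.prod_equiv σ _ _ fun i => ?_
    simp
  rw [Matrix.det_apply', MvPolynomial.coeff_sum]
  simp only [Matrix.of_apply, h1]
  have h2 : ∀ σ : Equiv.Perm (Fin k), c ∘ σ.symm = c' → c = c' := by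
    intro σ h
    refine (hc.range_inj hc').1 ?_
    rw [← h, Set.range_comp, Set.range_eq_univ.2 σ.symm.surjective, Set.image_univ]
  have h3 : ∀ σ : Equiv.Perm (Fin k), MvPolynomial.coeff (Finsupp.equivFunOnFinite.symm c')
      ((((Equiv.Perm.sign σ : ℤ) : MvPolynomial (Fin k) ℂ)) *
        MvPolynomial.monomial (Finsupp.equivFunOnFinite.symm (c ∘ σ.symm)) 1) =
      if c ∘ σ.symm = c' then ((Equiv.Perm.sign σ : ℤ) : ℂ) else 0 := by
    intro σ
    rw [show ((Equiv.Perm.sign σ : ℤ) : MvPolynomial (Fin k) ℂ) =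
      MvPolynomial.C ((Equiv.Perm.sign σ : ℤ) : ℂ) by simp, MvPolynomial.coeff_C_mul,
      MvPolynomial.coeff_monomial]
    simp
  simp only [h3]
  split_ifs with hcc
  · subst hcc
    rw [Finset.sum_eq_single 1]
    · rw [if_pos (show c ∘ (1 : Equiv.Perm (Fin k)).symm = c from rfl)]
      simp
    · intro σ _ hσ
      rw [if_neg]
      intro h
      apply hσ
      ext i
      have := hc.injective (congrFun h (σ i))
      simp at this
      rw [← this]; rfl
    · simp
  · exact Finset.sum_eq_zero fun σ _ => if_neg fun h => hcc (h2 σ h)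

/-- In `k` variables, multiplication by the Vandermonde determinant turns the determinants into
alternants. Their coefficients at strictly increasing exponents are dual functionals. -/
theorem linearIndependent_jtPoly (k : ℕ) : LinearIndependent ℂ
    fun c : {c : Fin k → ℕ // StrictMono c} => jtPoly fun i => (c.1 i : ℤ) := by
  set W : MvPowerSeries (Fin k) ℂ := (Matrix.vandermonde fun l : Fin k =>
    polyRestrict k (X (l : ℕ))).det with hW
  let L : {c : Fin k → ℕ // StrictMono c} → MvPolynomial ℕ ℂ →ₗ[ℂ] ℂ := fun c =>
    (MvPowerSeries.coeff (Finsupp.equivFunOnFinite.symm c.1)).comp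
      ((LinearMap.mulLeft ℂ W).comp ((symRestrict k).toLinearMap.comp powerHom.toLinearMap))
  have hL : ∀ c c' : {c : Fin k → ℕ // StrictMono c},
      L c' (jtPoly fun i => (c.1 i : ℤ)) = if c = c' then 1 else 0 := by
    intro c c'
    change MvPowerSeries.coeff _ (W * symRestrict k (powerHom (jtPoly _))) = _
    rw [powerHom_jtPoly, symRestrict_det_hsym, AlgHom.map_det]
    have h1 := alternant_eq (k := k) (fun i => polyRestrict k (X i)) c.1
    have h2 : (polyRestrict k).mapMatrix (Matrix.of fun i j : Fin k =>
        hcomp X k ((c.1 i : ℤ) - (j : ℕ))) =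
        Matrix.of fun i j : Fin k => hcomp (fun i => polyRestrict k (X i)) k
          ((c.1 i : ℤ) - (j : ℕ)) := by
      refine Matrix.ext fun i j => ?_
      exact map_hcomp (polyRestrict k : MvPolynomial ℕ ℂ →+* MvPowerSeries (Fin k) ℂ) _ _ _
    rw [h2, hW, ← h1]
    have h3 : (Matrix.of fun l i : Fin k => polyRestrict k (X (l : ℕ)) ^ c.1 i).det =
        (((Matrix.of fun l i : Fin k => (X l : MvPolynomial (Fin k) ℂ) ^ c.1 i).det :
          MvPolynomial (Fin k) ℂ) : MvPowerSeries (Fin k) ℂ) := by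
      rw [← MvPolynomial.coeToMvPowerSeries.ringHom_apply, RingHom.map_det]
      congr 1
      refine Matrix.ext fun i j => ?_
      simp [polyRestrict_X]
    rw [h3, MvPolynomial.coeff_coe, coeff_alternant c.2 c'.2]
    simp only [Subtype.ext_iff]
  rw [linearIndependent_iff']
  intro s g hg c hc
  have h1 := congrArg (L c) hg
  rw [map_sum, map_zero] at h1
  simp only [map_smul, hL] at h1
  simpa [hc] using h1

end SchurFunctions

end FockSL2
end

noncomputable section
namespace FockSL2

/-! ### Symmetrization of Laurent polynomials and Schur functions -/

section Symmetrization

variable {k : ℕ}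

theorem sum_smul_unitExp (n : Fin k → ℕ) :
    ∑ i, n i • unitExp i = fun i => ((n i : ℕ) : ℤ) := by
  funext l
  rw [Finset.sum_apply, Finset.sum_eq_single l]
  · simp [unitExp]
  · intro i _ hi
    simp [unitExp, Ne.symm hi]
  · simp

theorem prod_mono_unitExp_pow (n : Fin k → ℕ) :
    ∏ i, mono (unitExp i) ^ n i = mono fun i => ((n i : ℕ) : ℤ) := by
  rw [← sum_smul_unitExp, mono_sum]
  exact Finset.prod_congr rfl fun i _ => (mono_nsmul _ _).symm

theorem prod_mono_neg_unitExp_pow (n : Fin k → ℕ) :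
    ∏ i, mono (-unitExp i) ^ n i = mono fun i => -((n i : ℕ) : ℤ) := by
  have h1 : (fun i => -((n i : ℕ) : ℤ)) = ∑ i, n i • -unitExp i := by
    simp only [smul_neg, Finset.sum_neg_distrib]
    rw [sum_smul_unitExp]
    rfl
  rw [h1, mono_sum]
  exact Finset.prod_congr rfl fun i _ => (mono_nsmul _ _).symm

theorem sign_mul_eq_smul {R : Type*} [Ring R] [Algebra ℂ R] (σ : Equiv.Perm (Fin k)) (y : R) :
    (((Equiv.Perm.sign σ : ℤ)) : R) * y = ((Equiv.Perm.sign σ : ℤ) : ℂ) • y := by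
  rw [Algebra.smul_def, map_intCast]

theorem vdmInv_eq (k : ℕ) : vdmInv k = ∑ τ : Equiv.Perm (Fin k),
    ((Equiv.Perm.sign τ : ℤ) : ℂ) • mono fun i => -(((τ i : Fin k) : ℕ) : ℤ) := by
  rw [vdmInv, ← Matrix.det_transpose, Matrix.det_apply']
  refine Finset.sum_congr rfl fun τ _ => ?_
  rw [sign_mul_eq_smul, ← prod_mono_neg_unitExp_pow]
  rfl

theorem vdm_eq (k : ℕ) : vdm k = ∑ τ : Equiv.Perm (Fin k),
    ((Equiv.Perm.sign τ : ℤ) : ℂ) • mono fun i => (((τ i : Fin k) : ℕ) : ℤ) := by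
  rw [vdm, ← Matrix.det_transpose, Matrix.det_apply']
  refine Finset.sum_congr rfl fun τ _ => ?_
  rw [sign_mul_eq_smul, ← prod_mono_unitExp_pow]
  rfl

/-- Expanding the Vandermonde determinant in `z⁻¹` gives the signed sum of the products `∏ H_{b_i -
τ(i)}`. -/
theorem hprod_mono_mul_vdmInv (b : Fin k → ℤ) : hprod k (mono b * vdmInv k) = jtPoly b := by
  rw [vdmInv_eq, Finset.mul_sum, map_sum, jtPoly, ← Matrix.det_transpose, Matrix.det_apply']
  refine Finset.sum_congr rfl fun τ _ => ?_
  rw [sign_mul_eq_smul, mul_smul_comm, map_smul, ← mono_add, hprod_mono]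
  rfl

/-- The constant term of `z^a` against the product of the Vandermonde determinants in `z` and
`z⁻¹`. -/
def weylSum (a : Fin k → ℤ) : MvPolynomial ℕ ℂ := hprod k (mono a * (vdm k * vdmInv k))

theorem weylSum_eq (a : Fin k → ℤ) : weylSum a = ∑ σ : Equiv.Perm (Fin k),
    ((Equiv.Perm.sign σ : ℤ) : ℂ) • jtPoly fun i => a i + (((σ i : Fin k) : ℕ) : ℤ) := by
  rw [weylSum, vdm_eq, ← mul_assoc, Finset.mul_sum, Finset.sum_mul, map_sum]
  refine Finset.sum_congr rfl fun σ _ => ?_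
  rw [mul_smul_comm, smul_mul_assoc, map_smul, ← mono_add, hprod_mono_mul_vdmInv]
  rfl

theorem jtPoly_comp_perm (c : Fin k → ℤ) (σ : Equiv.Perm (Fin k)) :
    jtPoly (fun i => c (σ i)) = ((Equiv.Perm.sign σ : ℤ) : ℂ) • jtPoly c := by
  rw [← sign_mul_eq_smul, jtPoly, jtPoly, ← Matrix.det_permute]
  rfl

theorem sign_mul_self_cast (σ : Equiv.Perm (Fin k)) :
    ((Equiv.Perm.sign σ : ℤ) : ℂ) * ((Equiv.Perm.sign σ : ℤ) : ℂ) = 1 := by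
  rw [← Int.cast_mul, ← Units.val_mul, Int.units_mul_self, Units.val_one, Int.cast_one]

/-- Permuting the rows of each determinant costs the sign of `σ`, which is absorbed by the
substitution `τ ↦ τ σ⁻¹`. -/
theorem weylSum_comp_perm (a : Fin k → ℤ) (σ : Equiv.Perm (Fin k)) :
    weylSum (fun i => a (σ i)) = weylSum a := by
  rw [weylSum_eq, weylSum_eq]
  refine Fintype.sum_equiv (Equiv.mulRight σ⁻¹) _ _ fun τ => ?_
  have h1 := jtPoly_comp_perm (fun i => a i + ((((τ * σ⁻¹) i : Fin k) : ℕ) : ℤ)) σ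
  have h2 : ∀ i, σ⁻¹ (σ i) = i := fun i => σ.symm_apply_apply i
  simp only [Equiv.Perm.mul_apply, h2] at h1
  rw [h1, smul_smul, Equiv.coe_mulRight, map_mul, Equiv.Perm.sign_inv, Units.val_mul, Int.cast_mul]
  simp only [Equiv.Perm.mul_apply]

/-- The alternant in the Laurent monomials. -/
def laurentAlternant (c : Fin k → ℕ) : Laurent k :=
  (Matrix.of fun l i : Fin k => mono (unitExp l) ^ c i).det

/-- All `k!` terms of the alternant contribute equally: the sign of the term and that of the row
permutation cancel. -/
theorem hprod_laurentAlternant (c : Fin k → ℕ) :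
    hprod k (laurentAlternant c * vdmInv k) = (k.factorial : ℂ) • jtPoly fun i => (c i : ℤ) := by
  have h1 : laurentAlternant c = ∑ σ : Equiv.Perm (Fin k),
      ((Equiv.Perm.sign σ : ℤ) : ℂ) • mono fun i => ((c (σ i) : ℕ) : ℤ) := by
    rw [laurentAlternant, ← Matrix.det_transpose, Matrix.det_apply']
    refine Finset.sum_congr rfl fun τ _ => ?_
    rw [sign_mul_eq_smul, ← prod_mono_unitExp_pow]
    rfl
  have h2 : ∀ σ ∈ (Finset.univ : Finset (Equiv.Perm (Fin k))),
      hprod k ((((Equiv.Perm.sign σ : ℤ) : ℂ) • mono fun i => ((c (σ i) : ℕ) : ℤ)) * vdmInv k) =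
        jtPoly fun i => (c i : ℤ) := by
    intro σ _
    rw [smul_mul_assoc, map_smul, hprod_mono_mul_vdmInv,
      jtPoly_comp_perm (fun i => (c i : ℤ)) σ, smul_smul, sign_mul_self_cast, one_smul]
  rw [h1, Finset.sum_mul, map_sum, Finset.sum_congr rfl h2, Finset.sum_const, Finset.card_univ,
    Fintype.card_perm, Fintype.card_fin, Nat.cast_smul_eq_nsmul]

/-- The Laurent monomials `z_i` as a sequence, continued by zeros. -/
def laurentVar (k : ℕ) (i : ℕ) : Laurent k := if hi : i < k then mono (unitExp ⟨i, hi⟩) else 0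

theorem laurentVar_val (i : Fin k) : laurentVar k i = mono (unitExp i) := dif_pos i.2

theorem branchSchur_mul_vdm {ν : Fin k → ℕ} (hν : Monotone ν) :
    branchSchur (laurentVar k) k ν * vdm k = laurentAlternant fun i => ν i + i := by
  have h1 := alternant_eq (laurentVar k) (fun i : Fin k => ν i + i)
  simp only [laurentVar_val, Nat.cast_add] at h1
  rw [branchSchur_eq_det _ _ hν, laurentAlternant, h1, mul_comm, vdm]

/-- The exponents of a monomial in `k` variables as exponents of a monomial in all variables. -/
def expOf (a : Fin k → ℕ) : ℕ →₀ ℕ :=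
  Finsupp.embDomain Fin.valEmbedding (Finsupp.equivFunOnFinite.symm a)

theorem expOf_apply (a : Fin k → ℕ) (i : ℕ) : expOf a i = if hi : i < k then a ⟨i, hi⟩ else 0 := by
  rw [expOf]
  split_ifs with hi
  · exact Finsupp.embDomain_apply_self _ _ (⟨i, hi⟩ : Fin k)
  · refine Finsupp.embDomain_of_notMem_range _ _ _ ?_
    rintro ⟨j, rfl⟩
    exact hi j.2

theorem expOf_injective : Function.Injective (expOf (k := k)) := by
  intro a b h
  exact Finsupp.equivFunOnFinite.symm.injective (Finsupp.embDomain_injective _ h)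

theorem support_expOf_subset (a : Fin k → ℕ) : (expOf a).support ⊆ Finset.range k :=
  support_embDomain_val_subset _

theorem exists_expOf_of_support_subset {d : ℕ →₀ ℕ} (hd : d.support ⊆ Finset.range k) :
    ∃ a : Fin k → ℕ, d = expOf a := by
  obtain ⟨d', rfl⟩ := exists_embDomain_of_support_subset hd
  exact ⟨d', by simp [expOf]⟩

theorem kostka_expOf_comp_perm {ν : YoungDiagram} (hν : ∀ c ∈ ν, c.1 < k) (a : Fin k → ℕ)
    (σ : Equiv.Perm (Fin k)) : kostka ν (expOf (a ∘ σ)) = kostka ν (expOf a) := by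
  have h1 : expOf a = Finsupp.embDomain (σ.viaEmbedding Fin.valEmbedding).toEmbedding
      (expOf (a ∘ σ)) := by
    have h2 : Finsupp.equivFunOnFinite.symm a =
        Finsupp.mapDomain σ (Finsupp.equivFunOnFinite.symm (a ∘ σ)) := by
      ext i
      rw [Finsupp.mapDomain_equiv_apply]
      simp
    rw [expOf, expOf, Finsupp.embDomain_eq_mapDomain, Finsupp.embDomain_eq_mapDomain,
      Finsupp.embDomain_eq_mapDomain, h2, ← Finsupp.mapDomain_comp, ← Finsupp.mapDomain_comp]
    congr 1
    ext i
    exact (Equiv.Perm.viaEmbedding_apply σ Fin.valEmbedding i).symm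
  rw [h1, kostka_embDomain hν]

/-- By strictness an entry occurs at most once in each of the at most `k` columns. This is why
exponents up to `k` suffice below. -/
theorem kostka_eq_zero_of_lt {ν : YoungDiagram} (hν : ∀ c ∈ ν, c.2 < k) {a : ℕ → ℕ} {i : ℕ}
    (hi : k < a i) : kostka ν a = 0 := by
  have : IsEmpty (TableauOf ν a) := by
    refine ⟨fun T => ?_⟩
    have h1 : (ν.cells.filter fun c => T.1 c.1 c.2 = i).card ≤ (Finset.range k).card := by
      refine Finset.card_le_card_of_injOn Prod.snd (fun c hc => ?_) fun c hc c' hc' h => ?_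
      · rw [Finset.mem_coe, Finset.mem_filter] at hc
        exact Finset.mem_coe.2 (Finset.mem_range.2 (hν c hc.1))
      · rw [Finset.mem_coe, Finset.mem_filter] at hc hc'
        obtain ⟨c1, c2⟩ := c
        obtain ⟨c1', c2'⟩ := c'
        simp only at h hc hc'
        subst h
        rcases lt_trichotomy c1 c1' with h | h | h
        · have := T.1.col_strict h hc'.1
          omega
        · rw [h]
        · have := T.1.col_strict h hc.1
          omega
    rw [T.2, Finset.card_range] at h1
    omega
  exact Nat.card_of_isEmpty

/-- The exponents of a monomial of degree at most `k` in each variable. -/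
def valExp (a : Fin k → Fin (k + 1)) : Fin k → ℕ := fun i => (a i : ℕ)

theorem branchSchur_X_eq_sum {ν : YoungDiagram} (hν : InSquare k ν) :
    branchSchur (MvPolynomial.X : ℕ → MvPolynomial ℕ ℂ) k (ascRows k ν) =
      ∑ a : Fin k → Fin (k + 1),
        MvPolynomial.monomial (expOf (valExp a)) (kostka ν (expOf (valExp a)) : ℂ) := by
  ext d
  rw [coeff_branchSchur (monotone_ascRows k ν), ofAsc_ascRows fun c hc => (hν c hc).1,
    MvPolynomial.coeff_sum]
  simp only [MvPolynomial.coeff_monomial]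
  by_cases hd : ∃ a : Fin k → Fin (k + 1), expOf (valExp a) = d
  · obtain ⟨a, rfl⟩ := hd
    rw [if_pos (support_expOf_subset _), Finset.sum_eq_single a]
    · rw [if_pos rfl]
    · intro b _ hb
      rw [if_neg]
      intro h
      apply hb
      have := expOf_injective h
      funext i
      exact Fin.ext (congrFun this i)
    · simp
  · have h0 : ∑ a : Fin k → Fin (k + 1), (if expOf (valExp a) = d then
        (kostka ν (expOf (valExp a)) : ℂ) else 0) = 0 :=
      Finset.sum_eq_zero fun a _ => if_neg fun h => hd ⟨a, h⟩
    rw [h0]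
    split_ifs with hs
    · obtain ⟨a, rfl⟩ := exists_expOf_of_support_subset hs
      have h1 : ∃ i, k < a i := by
        by_contra hcon
        push Not at hcon
        exact hd ⟨fun i => ⟨a i, Nat.lt_succ_of_le (hcon i)⟩, rfl⟩
      obtain ⟨i, hi⟩ := h1
      rw [kostka_eq_zero_of_lt (fun c hc => (hν c hc).2) (i := (i : ℕ)), Nat.cast_zero]
      rw [expOf_apply, dif_pos i.2]
      exact hi
    · rfl

theorem branchSchur_laurentVar_eq_sum {ν : YoungDiagram} (hν : InSquare k ν) :
    branchSchur (laurentVar k) k (ascRows k ν) = ∑ a : Fin k → Fin (k + 1),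
      (kostka ν (expOf (valExp a)) : ℂ) • mono fun i => ((a i : ℕ) : ℤ) := by
  have h1 := congrArg (MvPolynomial.aeval (R := ℂ) (laurentVar k)) (branchSchur_X_eq_sum hν)
  have h2 := map_branchSchur ((MvPolynomial.aeval (R := ℂ) (laurentVar k) :
    MvPolynomial ℕ ℂ →ₐ[ℂ] Laurent k) : MvPolynomial ℕ ℂ →+* Laurent k)
    MvPolynomial.X k (ascRows k ν)
  simp only [RingHom.coe_coe, MvPolynomial.aeval_X] at h2
  rw [h2] at h1
  rw [h1, map_sum]
  refine Finset.sum_congr rfl fun a _ => ?_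
  rw [MvPolynomial.aeval_monomial, ← Algebra.smul_def]
  congr 1
  rw [Finsupp.prod_of_support_subset _ (support_expOf_subset _) _ (by simp),
    ← Fin.prod_univ_eq_prod_range (fun i => laurentVar k i ^ expOf (valExp a) i)]
  have h3 := prod_mono_unitExp_pow (valExp a)
  refine Eq.trans ?_ h3
  refine Finset.prod_congr rfl fun i _ => ?_
  rw [laurentVar_val, expOf_apply, dif_pos i.2]

/-- The Schur polynomial `∑ K_{νa} z^a` times the Vandermonde determinant is the alternant with
exponents `ν_i + i`; both descriptions are multiplied by `vdmInv` and mapped by `hprod`. -/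
theorem sum_kostka_weylSum {ν : YoungDiagram} (hν : InSquare k ν) :
    ∑ a : Fin k → Fin (k + 1), (kostka ν (expOf (valExp a)) : ℂ) •
      weylSum (fun i => ((a i : ℕ) : ℤ)) =
      (k.factorial : ℂ) • jtPoly fun i : Fin k => (ascRows k ν i : ℤ) + (i : ℕ) := by
  have h1 := hprod_laurentAlternant fun i : Fin k => ascRows k ν i + i
  rw [← branchSchur_mul_vdm (monotone_ascRows k ν), branchSchur_laurentVar_eq_sum hν, mul_assoc,
    Finset.sum_mul, map_sum] at h1
  simp only [smul_mul_assoc, map_smul, Nat.cast_add] at h1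
  exact h1

theorem comp_perm_eq_of_antitone {α : Type*} [PartialOrder α] {f : Fin k → α} (hf : Antitone f)
    {σ : Equiv.Perm (Fin k)} (hσ : Antitone (f ∘ σ)) : f ∘ σ = f := by
  have h1 : Monotone (f ∘ (Fin.revPerm : Equiv.Perm (Fin k))) := fun i j hij =>
    hf (Fin.rev_le_rev.2 hij)
  have h2 : Monotone (f ∘ (σ * Fin.revPerm : Equiv.Perm (Fin k))) := fun i j hij =>
    hσ (Fin.rev_le_rev.2 hij)
  have h3 := Tuple.unique_monotone h2 h1
  funext i
  have h4 := congrFun h3 (Fin.rev i)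
  simpa using h4

theorem exists_antitone_comp_perm {α : Type*} [LinearOrder α] (f : Fin k → α) :
    ∃ σ : Equiv.Perm (Fin k), Antitone (f ∘ σ) :=
  ⟨Tuple.sort f * Fin.revPerm, fun _ _ hij => Tuple.monotone_sort f (Fin.rev_le_rev.2 hij)⟩

/-- The number of rearrangements of a sequence: a sum over all sequences of a symmetric function
as a sum over decreasing sequences. -/
theorem sum_eq_sum_squarePartition {M : Type*} [AddCommGroup M] [Module ℂ M]
    (G : (Fin k → Fin (k + 1)) → M)
    (hG : ∀ (a : Fin k → Fin (k + 1)) (σ : Equiv.Perm (Fin k)), G (a ∘ σ) = G a) :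
    ∑ a, G a = ∑ μ : SquarePartition k,
      ((k.factorial : ℂ) / ((∏ j : Fin (k + 1), (mult μ j).factorial : ℕ) : ℂ)) • G μ.1 := by
  classical
  have hfact : ∀ μ : SquarePartition k,
      ((∏ j : Fin (k + 1), (mult μ j).factorial : ℕ) : ℂ) ≠ 0 := by
    intro μ
    rw [Nat.cast_ne_zero]
    exact Finset.prod_ne_zero_iff.2 fun j _ => Nat.factorial_ne_zero _
  have h1 : ∀ μ : SquarePartition k,
      ((k.factorial : ℂ) / ((∏ j : Fin (k + 1), (mult μ j).factorial : ℕ) : ℂ)) • G μ.1 =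
      ∑ σ : Equiv.Perm (Fin k),
        (((∏ j : Fin (k + 1), (mult μ j).factorial : ℕ) : ℂ))⁻¹ • G (μ.1 ∘ σ) := by
    intro μ
    simp only [hG, Finset.sum_const, Finset.card_univ, Fintype.card_perm, Fintype.card_fin]
    rw [← Nat.cast_smul_eq_nsmul ℂ, smul_smul, div_eq_mul_inv]
  -- The sum now runs over pairs of a decreasing sequence and a permutation, and is regrouped by the
  -- rearranged sequence `a`.
  rw [Finset.sum_congr rfl fun μ _ => h1 μ, ← Fintype.sum_prod_type',
    ← Finset.sum_fiberwise_of_maps_to (s := Finset.univ) (t := Finset.univ)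
      (g := fun p : SquarePartition k × Equiv.Perm (Fin k) => p.1.1 ∘ p.2)
      (fun _ _ => Finset.mem_univ _)]
  refine Finset.sum_congr rfl fun a _ => ?_
  obtain ⟨σ, hσ⟩ := exists_antitone_comp_perm a
  set μ : SquarePartition k := ⟨a ∘ σ, hσ⟩ with hμ
  have hfib : ∀ p ∈ Finset.univ.filter
      (fun p : SquarePartition k × Equiv.Perm (Fin k) => p.1.1 ∘ p.2 = a), p.1 = μ := by
    rintro ⟨μ', τ⟩ hp
    rw [Finset.mem_filter] at hp
    have h2 : μ'.1 ∘ τ = a := hp.2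
    refine Subtype.ext ?_
    have h3 : Antitone (μ'.1 ∘ (τ * σ : Equiv.Perm (Fin k))) := by
      have : μ'.1 ∘ (τ * σ : Equiv.Perm (Fin k)) = a ∘ σ := by rw [← h2]; rfl
      rw [this]; exact hσ
    have h4 := comp_perm_eq_of_antitone μ'.2 h3
    change μ'.1 = a ∘ σ
    rw [← h4, ← h2]
    rfl
  have hterm : ∀ p ∈ Finset.univ.filter
      (fun p : SquarePartition k × Equiv.Perm (Fin k) => p.1.1 ∘ p.2 = a),
      (((∏ j : Fin (k + 1), (mult p.1 j).factorial : ℕ) : ℂ))⁻¹ • G (p.1.1 ∘ p.2) =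
      (((∏ j : Fin (k + 1), (mult μ j).factorial : ℕ) : ℂ))⁻¹ • G a := by
    intro p hp
    rw [hfib p hp, ← (Finset.mem_filter.1 hp).2, hfib p hp]
  rw [Finset.sum_congr rfl hterm, Finset.sum_const]
  -- The pairs over `a` all have the first component `μ`; their permutations form a coset of the
  -- stabilizer of `μ`, of order `∏ r_j!`.
  have hcard : (Finset.univ.filter
      (fun p : SquarePartition k × Equiv.Perm (Fin k) => p.1.1 ∘ p.2 = a)).card =
      ∏ j : Fin (k + 1), (mult μ j).factorial := by
    have h5 := DomMulAct.stabilizer_card (f := μ.1)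
    have h6 : ∀ j, Fintype.card {i // μ.1 i = j} = mult μ j := fun j => by
      rw [mult, Fintype.card_subtype]
    simp only [h6] at h5
    rw [← h5, Fintype.card_subtype]
    refine Finset.card_bij' (fun p _ => p.2 * σ) (fun τ _ => (μ, τ * σ⁻¹)) ?_ ?_ ?_ ?_
    · intro p hp
      have h7 := hfib p hp
      rw [Finset.mem_filter] at hp ⊢
      refine ⟨Finset.mem_univ _, ?_⟩
      rw [h7] at hp
      change (μ.1 ∘ p.2) ∘ σ = μ.1
      rw [hp.2]
    · intro τ hτ
      rw [Finset.mem_filter] at hτ ⊢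
      refine ⟨Finset.mem_univ _, ?_⟩
      change (μ.1 ∘ τ) ∘ (σ⁻¹ : Equiv.Perm (Fin k)) = a
      rw [hτ.2]
      funext i
      simp [hμ]
    · intro p hp
      have h7 := hfib p hp
      ext1
      · exact h7.symm
      · simp
    · intro τ _
      simp
  rw [hcard, ← Nat.cast_smul_eq_nsmul ℂ, smul_smul, mul_inv_cancel₀ (hfact μ), one_smul]

theorem expOf_squarePartition (μ : SquarePartition k) : ⇑(expOf (valExp μ.1)) = parts μ := by
  funext i
  rw [expOf_apply, parts]
  rfl

/-- A Schur function as a linear combination of symmetrized monomials. -/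
theorem jtPoly_eq_sum {ν : YoungDiagram} (hν : InSquare k ν) :
    jtPoly (fun i : Fin k => (ascRows k ν i : ℤ) + (i : ℕ)) = ∑ μ : SquarePartition k,
      ((kostka ν (parts μ) : ℂ) / ((∏ j : Fin (k + 1), (mult μ j).factorial : ℕ) : ℂ)) •
        weylSum fun i => ((μ.1 i : ℕ) : ℤ) := by
  have h1 := sum_kostka_weylSum hν
  rw [sum_eq_sum_squarePartition (fun a : Fin k → Fin (k + 1) =>
    (kostka ν (expOf (valExp a)) : ℂ) • weylSum (fun i => ((a i : ℕ) : ℤ))) fun a σ => ?_] at h1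
  · have hk : (k.factorial : ℂ) ≠ 0 := Nat.cast_ne_zero.2 (Nat.factorial_ne_zero k)
    have h2 := congrArg (fun y => (k.factorial : ℂ)⁻¹ • y) h1
    simp only [smul_smul, inv_mul_cancel₀ hk, one_smul, Finset.smul_sum] at h2
    rw [← h2]
    refine Finset.sum_congr rfl fun μ _ => ?_
    rw [expOf_squarePartition]
    congr 1
    field_simp
  · have h2 := weylSum_comp_perm (fun i => ((a i : ℕ) : ℤ)) σ
    have h3 := kostka_expOf_comp_perm (fun c hc => (hν c hc).1) (valExp a) σ
    change (kostka ν (expOf (valExp a ∘ σ)) : ℂ) • weylSum (fun i => ((a (σ i) : ℕ) : ℤ)) = _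
    rw [h2, h3]

end Symmetrization

end FockSL2
end

noncomputable section
namespace FockSL2
attribute [local instance] endRing

/-! ### The realization by symmetric functions -/

section Realization

/-- The value at `1` and the action of the power sums determine a realization, since the power sums
generate. -/
theorem IsRealization.apply_powerHom {Φ : SymFun ≃ₗ[ℂ] chargeZero} (hΦ : IsRealization Φ)
    (g : MvPolynomial ℕ ℂ) : (Φ (powerHom g) : Fock) = polyAct g vacuum := by
  induction g using MvPolynomial.induction_on with
  | C a =>
    rw [polyAct_C, ← MvPolynomial.algebraMap_eq, AlgHom.commutes, Algebra.algebraMap_eq_smul_one,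
      map_smul, SetLike.val_smul, hΦ.map_one]
    rfl
  | add p q hp hq =>
    rw [map_add, map_add, map_add, LinearMap.add_apply, AddMemClass.coe_add, hp, hq]
  | mul_X p i hp =>
    rw [mul_comm, map_mul powerHom, map_mul polyAct, powerHom_X, polyAct_X,
      hΦ.map_psum_mul (i + 1) (Nat.succ_pos i), hp, Module.End.mul_apply, Nat.cast_succ]

/-- The realization of the charge zero subspace by symmetric functions. -/
def realization : SymFun ≃ₗ[ℂ] chargeZero :=
  powerEquiv.symm.toLinearEquiv ≪≫ₗ
    LinearEquiv.ofInjective (polyActOn vacuum) polyActOn_vacuum_injective ≪≫ₗ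
      LinearEquiv.ofEq _ _ chargeZero_eq.symm

theorem realization_powerHom (g : MvPolynomial ℕ ℂ) :
    (realization (powerHom g) : Fock) = polyAct g vacuum := by
  have h1 : powerEquiv.symm (powerHom g) = g := powerEquiv.symm_apply_apply g
  change ((LinearEquiv.ofInjective (polyActOn vacuum) polyActOn_vacuum_injective)
    (powerEquiv.symm (powerHom g)) : Fock) = _
  rw [h1]
  rfl

/-- The derivation `2n ∂/∂p_n`, for `n = i + 1`. -/
def psumDerivation (i : ℕ) : Derivation ℂ SymFun SymFun :=
  Derivation.mk' (powerEquiv.toLinearMap ∘ₗ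
    ((2 * ((i : ℂ) + 1)) • (MvPolynomial.pderiv i).toLinearMap) ∘ₗ
      powerEquiv.symm.toLinearMap) <| by
    intro a b
    simp only [LinearMap.comp_apply, LinearMap.smul_apply, AlgEquiv.toLinearMap_apply, map_mul,
      Derivation.coeFn_coe, Derivation.leibniz, map_smul, smul_eq_mul,
      map_add, AlgEquiv.apply_symm_apply, smul_add, mul_smul_comm]

theorem psumDerivation_powerHom (i : ℕ) (g : MvPolynomial ℕ ℂ) :
    psumDerivation i (powerHom g) =
      powerHom ((2 * ((i : ℂ) + 1)) • MvPolynomial.pderiv i g) := by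
  have h1 : powerEquiv.symm (powerHom g) = g := powerEquiv.symm_apply_apply g
  change powerEquiv ((2 * ((i : ℂ) + 1)) • MvPolynomial.pderiv i (powerEquiv.symm (powerHom g))) = _
  rw [h1, powerEquiv_apply]

theorem isRealization_realization : IsRealization realization where
  map_one := by
    rw [← map_one powerHom, realization_powerHom, map_one]
    rfl
  map_psum_mul := by
    intro n hn g
    obtain ⟨q, rfl⟩ := powerHom_surjective g
    obtain ⟨i, rfl⟩ : ∃ i, n = i + 1 := ⟨n - 1, by omega⟩
    rw [← powerHom_X, ← map_mul, realization_powerHom, realization_powerHom, map_mul, polyAct_X,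
      Module.End.mul_apply, Nat.cast_succ]
  map_deriv := by
    intro n hn
    obtain ⟨i, rfl⟩ : ∃ i, n = i + 1 := ⟨n - 1, by omega⟩
    refine ⟨psumDerivation i, fun m hm => ?_, fun g => ?_⟩
    · obtain ⟨j, rfl⟩ : ∃ j, m = j + 1 := ⟨m - 1, by omega⟩
      rw [← powerHom_X, psumDerivation_powerHom, MvPolynomial.pderiv_X]
      by_cases hij : j = i
      · subst hij
        rw [if_pos rfl, Pi.single_eq_same, map_smul, map_one, ← Algebra.algebraMap_eq_smul_one]
        have : (2 * ((j : ℂ) + 1)) = ((2 * (j + 1) : ℕ) : ℂ) := by push_cast; ring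
        rw [this, map_natCast]
      · rw [if_neg (by omega), Pi.single_eq_of_ne (by omega), smul_zero, map_zero]
    · obtain ⟨q, rfl⟩ := powerHom_surjective g
      rw [psumDerivation_powerHom, realization_powerHom, realization_powerHom, Nat.cast_succ,
        h_polyAct_apply fun r hr => h_vacuum hr, map_smul]
      rfl

theorem existsUnique_isRealization : ∃! Φ : SymFun ≃ₗ[ℂ] chargeZero, IsRealization Φ := by
  refine ⟨realization, isRealization_realization, fun Φ hΦ => ?_⟩
  refine LinearEquiv.ext fun g => Subtype.ext ?_
  obtain ⟨q, rfl⟩ := powerHom_surjective g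
  rw [hΦ.apply_powerHom, realization_powerHom]

end Realization

/-! ### The basis of the finite part -/

section FinitePart

variable {k : ℕ}

theorem eProd_eq_weylSum (a : Fin k → ℤ) : eProd k a =
    (-1 : ℂ) ^ (k * (k - 1) / 2) • polyActOn vacuum (weylSum a) := eProd_eq k a

theorem eVec_eq (μ : SquarePartition k) : eVec k μ =
    (-1 : ℂ) ^ (k * (k - 1) / 2) • polyActOn vacuum (weylSum fun i => ((μ.1 i : ℕ) : ℤ)) := by
  rw [← eProd_eq_weylSum, eVec, eProd]
  simp only [neg_sub]

/-- The Schur function of a partition in the square, in terms of the power sums. -/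
def squareSchur (μ : SquarePartition k) : MvPolynomial ℕ ℂ :=
  jtPoly fun i => ((μ.1 (Fin.rev i) : ℕ) : ℤ) + (i : ℕ)

theorem squareSchur_mem_span (μ : SquarePartition k) :
    squareSchur μ ∈ Submodule.span ℂ
      (Set.range fun μ : SquarePartition k => weylSum fun i => ((μ.1 i : ℕ) : ℤ)) := by
  set ν : Fin k → ℕ := fun i => (μ.1 (Fin.rev i) : ℕ) with hν
  have hmono : Monotone ν := fun i j hij => μ.2 (Fin.rev_le_rev.2 hij)
  have hsq : InSquare k (ofAsc ν) := by
    rintro ⟨i, j⟩ hc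
    refine ⟨fst_lt_of_mem_ofAsc hmono _ hc, ?_⟩
    rw [mem_ofAsc hmono, descRow] at hc
    split_ifs at hc with hi
    · refine lt_of_lt_of_le hc (Nat.lt_succ_iff.1 (Fin.is_lt _))
    · omega
  have h1 := jtPoly_eq_sum hsq
  rw [ascRows_ofAsc hmono] at h1
  rw [squareSchur, h1]
  exact Submodule.sum_mem _ fun μ _ => Submodule.smul_mem _ _ (Submodule.subset_span ⟨μ, rfl⟩)

theorem linearIndependent_squareSchur (k : ℕ) :
    LinearIndependent ℂ (squareSchur (k := k)) := by
  let c : SquarePartition k → {c : Fin k → ℕ // StrictMono c} := fun μ =>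
    ⟨fun i => (μ.1 (Fin.rev i) : ℕ) + i, fun i j hij => by
      have h1 : (μ.1 (Fin.rev i) : ℕ) ≤ μ.1 (Fin.rev j) := μ.2 (Fin.rev_le_rev.2 hij.le)
      have h2 : (i : ℕ) < j := hij
      simp only
      omega⟩
  have hc : Function.Injective c := by
    intro μ μ' h
    refine Subtype.ext (funext fun i => Fin.ext ?_)
    have h1 := congrFun (Subtype.ext_iff.1 h) (Fin.rev i)
    simpa [c] using h1
  have h1 := (linearIndependent_jtPoly k).comp c hc
  convert h1 using 1
  funext μ
  simp [squareSchur, c]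

/-- The span contains the independent family `squareSchur` with the same index set, so its dimension
is at least the number of generators. -/
theorem linearIndependent_weylSum (k : ℕ) : LinearIndependent ℂ
    fun μ : SquarePartition k => weylSum fun i => ((μ.1 i : ℕ) : ℤ) := by
  rw [linearIndependent_iff_card_le_finrank_span]
  have h1 := linearIndependent_iff_card_le_finrank_span.1 (linearIndependent_squareSchur k)
  have := FiniteDimensional.span_of_finite ℂ (Set.finite_range
    fun μ : SquarePartition k => weylSum fun i => ((μ.1 i : ℕ) : ℤ))
  refine h1.trans (Submodule.finrank_mono (Submodule.span_le.2 ?_))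
  rintro _ ⟨μ, rfl⟩
  exact squareSchur_mem_span μ

theorem neg_one_pow_smul_self {M : Type*} [AddCommGroup M] [Module ℂ M] (n : ℕ) (x : M) :
    (-1 : ℂ) ^ n • (-1 : ℂ) ^ n • x = x := by
  rw [smul_smul, ← mul_pow]
  simp

theorem span_eVec (k : ℕ) : Submodule.span ℂ (Set.range (eVec k)) =
    (Submodule.span ℂ (Set.range fun μ : SquarePartition k =>
      weylSum fun i => ((μ.1 i : ℕ) : ℤ))).map (polyActOn vacuum) := by
  rw [Submodule.map_span]
  refine le_antisymm (Submodule.span_le.2 ?_) (Submodule.span_le.2 ?_)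
  · rintro _ ⟨μ, rfl⟩
    rw [eVec_eq]
    exact Submodule.smul_mem _ _ (Submodule.subset_span ⟨_, ⟨μ, rfl⟩, rfl⟩)
  · rintro _ ⟨_, ⟨μ, rfl⟩, rfl⟩
    have h1 := eVec_eq μ
    have h2 := congrArg (fun y => (-1 : ℂ) ^ (k * (k - 1) / 2) • y) h1
    simp only [neg_one_pow_smul_self] at h2
    rw [← h2]
    exact Submodule.smul_mem _ _ (Submodule.subset_span ⟨μ, rfl⟩)

theorem linearIndependent_eVec (k : ℕ) : LinearIndependent ℂ (eVec k) := by
  have h1 := (linearIndependent_weylSum k).map' (polyActOn vacuum)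
    (LinearMap.ker_eq_bot.2 polyActOn_vacuum_injective)
  have h2 := h1.units_smul fun _ => ((-1 : ℂˣ) ^ (k * (k - 1) / 2))
  have h3 : eVec k = (fun _ : SquarePartition k => (-1 : ℂˣ) ^ (k * (k - 1) / 2)) • polyActOn vacuum ∘
      fun μ : SquarePartition k => weylSum fun i => ((μ.1 i : ℕ) : ℤ) := by
    funext μ
    rw [eVec_eq, Pi.smul_apply', Units.smul_def]
    simp
  rw [h3]
  exact h2

theorem add_le_of_strictMono {c : Fin k → ℤ} (hc : StrictMono c) {i j : Fin k} (hij : i ≤ j) :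
    c i + ((j : ℕ) - (i : ℕ) : ℤ) ≤ c j := by
  obtain ⟨n, hn⟩ : ∃ n : ℕ, (j : ℕ) = i + n := ⟨j - i, by rw [Fin.le_def] at hij; omega⟩
  induction n generalizing j with
  | zero =>
    have : i = j := Fin.ext (by omega)
    subst this
    simp
  | succ n ih =>
    have hj := j.2
    let j' : Fin k := ⟨i + n, by omega⟩
    have h1 := ih (j := j') (by rw [Fin.le_def]; simp only [j']; omega) rfl
    have h2 : c j' < c j := hc (by rw [Fin.lt_def]; simp only [j']; omega)
    simp only [j'] at h1 h2
    push_cast at h1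
    omega

/-- Straightening: a negative entry gives a zero row and equal entries give equal rows. Otherwise
sorting costs a sign, and a strictly increasing sequence of length `k` in `[0, 2k)` has `0 ≤ c_i - i
≤ k`, a partition in the square. -/
theorem jtPoly_mem_span_squareSchur {c : Fin k → ℤ} (hc : ∀ i, c i < 2 * k) :
    jtPoly c ∈ Submodule.span ℂ (Set.range (squareSchur (k := k))) := by
  by_cases hneg : ∃ i, c i < 0
  · obtain ⟨i, hi⟩ := hneg
    have : jtPoly c = 0 := Matrix.det_eq_zero_of_row_eq_zero i fun j => by
      rw [Matrix.of_apply, hpolyInt_of_neg (by omega)]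
    rw [this]
    exact Submodule.zero_mem _
  push Not at hneg
  by_cases hinj : Function.Injective c
  · set τ := Tuple.sort c with hτ
    have hs : StrictMono (c ∘ τ) :=
      (Tuple.monotone_sort c).strictMono_of_injective (hinj.comp τ.injective)
    have hlow : ∀ i : Fin k, ((i : ℕ) : ℤ) ≤ c (τ i) := by
      intro i
      have hk : 0 < k := lt_of_le_of_lt (Nat.zero_le _) i.2
      have h1 := add_le_of_strictMono hs (i := ⟨0, hk⟩) (j := i) (by rw [Fin.le_def]; simp)
      have h2 := hneg (τ ⟨0, hk⟩)
      simp only [Function.comp_apply, Nat.cast_zero, sub_zero] at h1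
      omega
    have hupp : ∀ i : Fin k, c (τ i) ≤ k + (i : ℕ) := by
      intro i
      have hi := i.2
      have h1 := add_le_of_strictMono hs (i := i) (j := ⟨k - 1, by omega⟩)
        (by rw [Fin.le_def]; simp only; omega)
      have h2 := hc (τ ⟨k - 1, by omega⟩)
      simp only [Function.comp_apply] at h1
      omega
    let μ : SquarePartition k := ⟨fun i => ⟨(c (τ (Fin.rev i)) - (Fin.rev i : ℕ)).toNat, by
        have := hupp (Fin.rev i)
        omega⟩, fun i j hij => by
        rw [Fin.le_def]
        have h1 := add_le_of_strictMono hs (Fin.rev_le_rev.2 hij)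
        simp only [Function.comp_apply] at h1
        simp only
        omega⟩
    have h1 : squareSchur μ = jtPoly fun i => c (τ i) := by
      rw [squareSchur]
      congr 1
      funext i
      have := hlow i
      simp only [μ, Fin.rev_rev]
      omega
    have h2 : jtPoly c = ((Equiv.Perm.sign τ : ℤ) : ℂ) • squareSchur μ := by
      rw [h1, jtPoly_comp_perm, smul_smul, sign_mul_self_cast, one_smul]
    rw [h2]
    exact Submodule.smul_mem _ _ (Submodule.subset_span ⟨μ, rfl⟩)
  · rw [Function.Injective] at hinj
    push Not at hinj
    obtain ⟨i, j, hij, hne⟩ := hinj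
    have : jtPoly c = 0 := Matrix.det_zero_of_row_eq hne (by
      funext l
      simp only [Matrix.of_apply, hij])
    rw [this]
    exact Submodule.zero_mem _

/-- The second Vandermonde determinant adds at most `k - 1` to each exponent, so `a_i ≤ k` keeps the
entries below `2k`. -/
theorem eProd_mem_span_eVec {a : Fin k → ℤ} (ha : ∀ i, a i ≤ k) :
    eProd k a ∈ Submodule.span ℂ (Set.range (eVec k)) := by
  rw [eProd_eq_weylSum, span_eVec]
  refine Submodule.smul_mem _ _ (Submodule.mem_map_of_mem ?_)
  rw [weylSum_eq]
  refine Submodule.sum_mem _ fun σ _ => Submodule.smul_mem _ _ ?_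
  have h1 : Submodule.span ℂ (Set.range (squareSchur (k := k))) ≤ Submodule.span ℂ
      (Set.range fun μ : SquarePartition k => weylSum fun i => ((μ.1 i : ℕ) : ℤ)) := by
    rw [Submodule.span_le]
    rintro _ ⟨μ, rfl⟩
    exact squareSchur_mem_span μ
  refine h1 (jtPoly_mem_span_squareSchur fun i => ?_)
  have := ha i
  have := (σ i).2
  omega

theorem list_prod_mem_generated {A : Set (Module.End ℂ Fock)} {x : Fock}
    {l : List (Module.End ℂ Fock)} (hl : ∀ T ∈ l, T ∈ A) : l.prod x ∈ generated A x := by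
  induction l with
  | nil => exact mem_generated A x
  | cons T l ih =>
    rw [List.prod_cons, Module.End.mul_apply]
    exact apply_mem_generated (hl T List.mem_cons_self)
      (ih fun S hS => hl S (List.mem_cons_of_mem T hS))

theorem eVec_mem_finitePart (μ : SquarePartition k) : eVec k μ ∈ finitePart k := by
  refine list_prod_mem_generated fun T hT => ?_
  rw [List.mem_ofFn] at hT
  obtain ⟨i, rfl⟩ := hT
  have h1 := (μ.1 i).2
  have h2 := i.2
  exact ⟨k - (μ.1 i : ℕ), by omega, by
    congr 2
    omega⟩

/-- The span of the words of length `r` in the `e_n`, `n ≤ 0`, applied to `Ω_{-2k}`. -/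
def wordSpan (k r : ℕ) : Submodule ℂ Fock :=
  Submodule.span ℂ {x | ∃ l : List ℤ, l.length = r ∧ (∀ n ∈ l, n ≤ 0) ∧
    x = (l.map e).prod (Om k)}

theorem finitePart_le_iSup_wordSpan (k : ℕ) : finitePart k ≤ ⨆ r, wordSpan k r := by
  refine generated_le ?_ ?_
  · exact Submodule.mem_iSup_of_mem 0 (Submodule.subset_span ⟨[], rfl, by simp, rfl⟩)
  · rintro T ⟨i, _, rfl⟩ y hy
    refine map_mem_iSup (fun r y hy => ?_) hy
    refine Submodule.mem_iSup_of_mem (r + 1) ?_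
    have h1 : wordSpan k r ≤ (wordSpan k (r + 1)).comap (e (-(i : ℤ))) := by
      refine Submodule.span_le.2 ?_
      rintro _ ⟨l, hl, hn, rfl⟩
      refine Submodule.subset_span ⟨-(i : ℤ) :: l, by simp [hl], ?_, rfl⟩
      intro n hmem
      rcases List.mem_cons.1 hmem with rfl | h
      · omega
      · exact hn n h
    exact h1 hy

/-- Each letter raises the charge by `2`, starting from `-2k`. -/
theorem h_zero_word (k : ℕ) (l : List ℤ) : h 0 ((l.map e).prod (Om k)) =
    (2 * (l.length : ℂ) - 2 * k) • (l.map e).prod (Om k) := by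
  induction l with
  | nil =>
    rw [List.map_nil, List.prod_nil, Module.End.one_apply, h_zero_Om]
    congr 1
    simp
  | cons n l ih =>
    have h1 := congrArg (fun T : Module.End ℂ Fock => T ((l.map e).prod (Om k))) (lie_h_e 0 n)
    simp only [Ring.lie_def, LinearMap.sub_apply, Module.End.mul_apply, LinearMap.smul_apply,
      sub_zero] at h1
    rw [sub_eq_iff_eq_add] at h1
    rw [List.map_cons, List.prod_cons, Module.End.mul_apply, h1, ih, map_smul, ← add_smul]
    congr 1
    simp
    ring

theorem exists_eq_ofFn {α : Type*} {l : List α} {r : ℕ} (hl : l.length = r) :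
    ∃ n : Fin r → α, l = List.ofFn n := by
  subst hl
  exact ⟨l.get, (List.ofFn_get l).symm⟩

theorem wordSpan_le_span_eVec (k : ℕ) : wordSpan k k ≤ Submodule.span ℂ (Set.range (eVec k)) := by
  refine Submodule.span_le.2 ?_
  rintro _ ⟨l, hl, hn, rfl⟩
  obtain ⟨n, rfl⟩ := exists_eq_ofFn hl
  have h1 : ((List.ofFn n).map e).prod (Om k) = eProd k fun i => n i + k := by
    rw [eProd, List.map_ofFn]
    simp only [add_sub_cancel_right]
    rfl
  rw [h1]
  refine eProd_mem_span_eVec fun i => ?_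
  have := hn (n i) (List.mem_ofFn.2 ⟨i, rfl⟩)
  omega

/-- The charge determines the length of a word, so an element of charge zero involves only words of
length `k`. -/
theorem span_eVec_eq (k : ℕ) :
    Submodule.span ℂ (Set.range (eVec k)) = finitePart k ⊓ chargeZero := by
  refine le_antisymm (Submodule.span_le.2 ?_) ?_
  · rintro _ ⟨μ, rfl⟩
    refine ⟨eVec_mem_finitePart μ, ?_⟩
    rw [chargeZero_eq, eVec_eq]
    exact Submodule.smul_mem _ _ ⟨_, rfl⟩
  · rintro x ⟨hx, hx0⟩
    refine wordSpan_le_span_eVec k ?_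
    refine mem_of_mem_iSup_of_eigenvector (T := h 0) (c := fun r : ℕ => 2 * (r : ℂ) - 2 * k)
      (fun r s hrs => ?_) (fun r y hy => ?_) (finitePart_le_iSup_wordSpan k hx) ?_
    · simpa using hrs
    · have h1 : wordSpan k r ≤ Module.End.eigenspace (h 0) (2 * (r : ℂ) - 2 * k) := by
        refine Submodule.span_le.2 ?_
        rintro _ ⟨l, hl, -, rfl⟩
        rw [SetLike.mem_coe, Module.End.mem_eigenspace_iff, h_zero_word, hl]
      exact Module.End.mem_eigenspace_iff.1 (h1 hy)
    · rw [sub_self, zero_smul]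
      exact LinearMap.mem_ker.1 hx0.2

theorem IsRealization.exists_schur {Φ : SymFun ≃ₗ[ℂ] chargeZero} (hΦ : IsRealization Φ)
    {ν : YoungDiagram} (hν : InSquare k ν) :
    ∃ s : SymFun, (s : MvPowerSeries ℕ ℂ) = schur ν ∧
      (Φ s : Fock) = (-1 : ℂ) ^ (k * (k - 1) / 2) • ∑ μ : SquarePartition k,
        ((kostka ν (parts μ) : ℂ) / ((∏ j : Fin (k + 1), (mult μ j).factorial : ℕ) : ℂ)) •
          eVec k μ := by
  refine ⟨powerHom (jtPoly fun i : Fin k => (ascRows k ν i : ℤ) + (i : ℕ)),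
    coe_powerHom_jtPoly fun c hc => (hν c hc).1, ?_⟩
  rw [hΦ.apply_powerHom, jtPoly_eq_sum hν, ← polyActOn_apply, map_sum, Finset.smul_sum]
  refine Finset.sum_congr rfl fun μ _ => ?_
  -- The sign in `eVec_eq` and the one in the formula cancel.
  rw [map_smul, eVec_eq, smul_comm, neg_one_pow_smul_self]

end FinitePart

end FockSL2
end

theorem theorem2 :
    (∃! Φ : FockSL2.SymFun ≃ₗ[ℂ] FockSL2.chargeZero, FockSL2.IsRealization Φ) ∧
    ∀ k : ℕ,
      (LinearIndependent ℂ (FockSL2.eVec k) ∧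
        Submodule.span ℂ (Set.range (FockSL2.eVec k)) =
          FockSL2.finitePart k ⊓ FockSL2.chargeZero) ∧
      ∀ Φ : FockSL2.SymFun ≃ₗ[ℂ] FockSL2.chargeZero, FockSL2.IsRealization Φ →
      ∀ ν : YoungDiagram, FockSL2.InSquare k ν →
        ∃ s : FockSL2.SymFun, (s : MvPowerSeries ℕ ℂ) = FockSL2.schur ν ∧
          (Φ s : FockSL2.Fock) = (-1 : ℂ) ^ (k * (k - 1) / 2) •
            ∑ μ : FockSL2.SquarePartition k,
              ((FockSL2.kostka ν (FockSL2.parts μ) : ℂ) /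
                ((∏ j : Fin (k + 1), (FockSL2.mult μ j).factorial : ℕ) : ℂ)) •
                  FockSL2.eVec k μ := by
  refine ⟨FockSL2.existsUnique_isRealization, fun k =>
    ⟨⟨FockSL2.linearIndependent_eVec k, FockSL2.span_eVec_eq k⟩, fun Φ hΦ ν hν => ?_⟩⟩
  exact hΦ.exists_schur hν
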